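/- **Setting.** A Boolean function $f:\{-1,1\}^n\to\{-1,1\}$ has satisfying set $f^{-1}(1)$; if it is non-empty, $\mathcal U_{f^{-1}(1)}$ is the uniform distribution on it, and $p_f=|f^{-1}(1)|/2^n$. Algorithms are randomized programs of one fixed, Turing-complete language with fair coin flips, a step count (arithmetic charged by bit length) and unit-cost oracle calls. They receive $n$, the accuracy $\epsilon=1/a$ and the confidence $\delta=1/b$ with integers $a,b\ge 1$ (smaller is more demanding, so a general $\epsilon$ is treated by $a=\lceil 1/\epsilon\rceil$, likewise $\delta$). A time bound $T(n,1/\epsilon,1/\delta)$ is worst case, over all coin flips, samples and oracle answers; if the output is itself a function or a sampler (given as a program, or as a representation to be evaluated), then the bound also covers one run of that output. $\mathcal C=(\mathcal C_n)$ is a class of Boolean functions and $\mathcal C'$ a representation class: its functions are given by finite data, from which a program evaluates them. Write $\gamma=1/\Gamma$ and $\tau=1/S$ with integer-valued functions $\Gamma(n,1/\epsilon,1/\delta)\geq 1$ and $S(n,1/\epsilon)$. * A *$\gamma$-densifier for $\mathcal C$ using $\mathcal C'$*, given sample access to $\mathcal U_{f^{-1}(1)}$ for a satisfiable $f\in\mathcal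 C_n$ and a number $\widehat p=j/2^n$, $1\le j\le 2^n$, outputs (a representation of) some $g\in\mathcal C'_n$; and if $p_f\le\widehat p<(1+\epsilon)p_f$, then with probability at least $1-\delta$ this $g$ satisfies $\Pr_{x\sim\mathcal U_{f^{-1}(1)}}[g(x)=1]\ge1-\epsilon$ and $\Pr_{x\sim\mathcal U_{g^{-1}(1)}}[f(x)=1]\ge\gamma(n,1/\epsilon,1/\delta)$. * An *approximate uniform generation algorithm for $\mathcal C'$*, given $g\in\mathcal C'_n$, halts in the stated time, and for every satisfiable $g$ and every $\epsilon$ there is a distribution $D$ on $g^{-1}(1)$ with $\frac1{1+\epsilon}\frac1{|g^{-1}(1)|}\le D(x)\le(1+\epsilon)\frac1{|g^{-1}(1)|}$ for $x\in g^{-1}(1)$ such that for every $\delta$ the algorithm outputs $\bot$ with some probability at most $\delta$ and otherwise a point distributed exactly according to $D$. * An *approximate counting algorithm for $\mathcal C'$*, given $g\in\mathcal C'_n$, outputs with probability at least $1-\delta$ a rational $\widehat p$ with $p_g/(1+\epsilon)\le\widehat p\le(1+\epsilon)p_g$. * An *SQ learner for $\mathcal C$* with running time $t_1(n,1/\epsilon,1/\delta)$,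 query evaluation time $t_2(n)$ and tolerance $\tau(n,1/\epsilon)$ has access to samples from an arbitrary distribution $D$ on $\{-1,1\}^n$ and to an oracle to which it submits queries $(\chi,1/s)$: a deterministic program for some $\chi:\{-1,1\}^n\times\{-1,1\}\to[-1,1]\cap\mathbb Q$ running in time $t_2(n)$, and an integer $s\ge1$ with $1/s\ge\tau(n,1/\epsilon)$. The answers are numbers $k/s$, $k\in\mathbb Z$, $|k|\le s$. Whatever they are, it outputs a hypothesis $h:\{-1,1\}^n\to\{-1,1\}$. For every $f\in\mathcal C_n$ and $D$, if all answers satisfy $|\mathbf E_{x\sim D}[\chi(x,f(x))]-k/s|\le1/s$ (possibly chosen at random, independently of the past), then with probability at least $1-\delta$, $\Pr_{x\sim D}[h(x)\ne f(x)]\le\epsilon$. * A *sampler* for a distribution $D$ on $\{-1,1\}^n$ is a program that from coin flips alone outputs a point distributed exactly as $D$; it is an $\epsilon$-sampler for every $D'$ with $d_{\rm TV}(D,D')\le\epsilon$. An *inverse approximate uniform generation algorithm for $\mathcal C$*, given sample access to $\mathcal U_{f^{-1}(1)}$ for a satisfiable $f\in\mathcal C_n$, outputs a sampler, which with probability at least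 $1-\delta$ is an $\epsilon$-sampler for $\mathcal U_{f^{-1}(1)}$. **Theorem (General Upper Bound).** There are a constant $c\geq 1$ and polynomials $q,q',P$ with non-negative integer coefficients, independent of everything below, such that the following holds. Suppose that there are a $\gamma$-densifier for $\mathcal C$ using $\mathcal C'$ running in time $T_{\rm den}$, an approximate uniform generation algorithm for $\mathcal C'$ running in time $T_{\rm gen}$, an approximate counting algorithm for $\mathcal C'$ running in time $T_{\rm count}$, and an SQ learner for $\mathcal C$ with parameters $t_1,t_2,\tau$; and that the function $1/\gamma$ is computable in time $T_{\rm den}$, and $t_1$ and $1/\tau$ are computable in time $t_1$. Then $\mathcal C$ has an inverse approximate uniform generation algorithm with running time at most $$P\bigl(n,\tfrac1\epsilon,\log\tfrac1\delta,\;T_{\rm den}(n,\tfrac c\epsilon,\tfrac c\delta),\;\tfrac1\gamma,\;T_{\rm gen}(n,\tfrac1{\epsilon_3},\tfrac1{\delta_3}),\;T_{\rm count}(n,\tfrac1{\epsilon_3},\tfrac1{\delta_3}),\;T_1,\;t_2(n),\;\tfrac1{\tau}\bigr),$$ where $\gamma=\gamma(n,\frac c\epsilon,\frac c\delta)$, $\tau=\tau(n,\frac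 c{\epsilon\gamma})$, $T_1=t_1(n,\frac c{\epsilon\gamma},\frac c\delta)$, $\frac1{\epsilon_3}=q(n,\frac1\epsilon,\frac1\gamma,\frac1\tau,T_1)$, $\frac1{\delta_3}=q'(n,\frac1\epsilon,\frac1\delta,\frac1\gamma,\frac1\tau,T_1)$, and $\log\frac1\delta$ stands for the bit length of the integer $1/\delta$. -/

import Mathlib

open scoped ENNReal

noncomputable section

namespace InvGen

/-! ### The machine model

A small call-by-value functional language with coin flips and oracle calls, evaluated with
environments.  Every elementary operation costs one step, looking up the `i`-th variable costs
`i + 1`, and arithmetic is charged by the bit length of its operands (logarithmic cost). -/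

/-- Built-in integer operations (`div` is integer division, `le` returns `1` or `0`). -/
inductive Arith where
  | add | sub | mul | div | le

def Arith.apply : Arith → ℤ → ℤ → ℤ
  | .add, x, y => x + y
  | .sub, x, y => x - y
  | .mul, x, y => x * y
  | .div, x, y => x / y
  | .le, x, y => if x ≤ y then 1 else 0

/-- Program text, with de Bruijn variables.  `lam` is a function of one argument that may call
itself: in its body `var 0` is the argument, `var 1` is the function itself, and the variables of
the context are shifted by two.  `proc` is a top-level procedure: a function with empty context. -/
inductive Code where
  | var (i : ℕ)
  | lit (z : ℤ)
  | lam (body : Code)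
  | proc (body : Code)
  | app (f a : Code)
  | pair (a b : Code)
  | fst (a : Code)
  | snd (a : Code)
  | isPair (a : Code)
  | ite (c t e : Code)
  | arith (o : Arith) (a b : Code)
  | flip

/-- Run-time values.  Environments are values as well (nested pairs).  `orc k` is a handle for
the `k`-th oracle; applying it to a value calls the oracle. -/
inductive Val where
  | int (z : ℤ)
  | pair (a b : Val)
  | clo (body : Code) (env : Val)
  | orc (k : ℕ)

namespace Val

def fst : Val → Val
  | pair a _ => a
  | _ => int 0

def snd : Val → Val
  | pair _ b => b
  | _ => int 0

def toInt : Val → ℤ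
  | int z => z
  | _ => 0

def isPair : Val → Bool
  | pair _ _ => true
  | _ => false

/-- Is the value different from the integer `0`? -/
def truthy : Val → Bool
  | int z => z ≠ 0
  | _ => true

def lookup : ℕ → Val → Val
  | 0, e => e.fst
  | i + 1, e => lookup i e.snd

/-- Plain data: built from integers and pairs only, without functions or oracle handles. -/
def IsData : Val → Prop
  | int _ => True
  | pair a b => IsData a ∧ IsData b
  | clo _ _ => False
  | orc _ => False

def bit (b : Bool) : Val := int (if b then 1 else 0)

end Val

/-- Randomized, memoryless oracles.  The answer `none` aborts the computation. -/
abbrev Oracle := ℕ → Val → PMF (Option Val)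

/-- No oracle is available: every oracle call aborts. -/
def noOracle : Oracle := fun _ _ => PMF.pure none

/-- The result of an evaluation: a value with the number of steps, or `none` if the evaluation
ran out of fuel or aborted. -/
abbrev Outcome := Option (Val × ℕ)

def ret (v : Val) (cost : ℕ) : PMF Outcome := PMF.pure (some (v, cost))

/-- Sequencing: the costs add up. -/
def andThen (p : PMF Outcome) (k : Val → PMF Outcome) : PMF Outcome :=
  p.bind fun
    | none => PMF.pure none
    | some (v, c) => (k v).map (Option.map fun w => (w.1, c + w.2))

/-- Application of a function value to an argument, `ev` being the evaluator for the body. -/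
def call (ev : Val → Code → PMF Outcome) (O : Oracle) (f a : Val) : PMF Outcome :=
  match f with
  | .clo body env => ev (.pair a (.pair f env)) body
  | .orc k => (O k a).map (Option.map fun v => (v, 1))
  | _ => ret (.int 0) 1

/-- The cost-counting evaluator.  The first natural number is fuel, a bound on the depth of the
evaluation; the depth never exceeds the cost, so that fuel `T` suffices for all evaluations
of cost at most `T`. -/
def eval (O : Oracle) : ℕ → Val → Code → PMF Outcome
  | 0, _, _ => PMF.pure none
  | d + 1, env, t =>
    match t with
    | .var i => ret (Val.lookup i env) (i + 1)
    | .lit z => ret (.int z) (z.natAbs.size + 1)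
    | .lam body => ret (.clo body env) 1
    | .proc body => ret (.clo body (.int 0)) 1
    | .app f a =>
        andThen (eval O d env f) fun vf =>
        andThen (eval O d env a) fun va =>
        andThen (ret (.int 0) 1) fun _ => call (eval O d) O vf va
    | .pair a b =>
        andThen (eval O d env a) fun va =>
        andThen (eval O d env b) fun vb => ret (.pair va vb) 1
    | .fst a => andThen (eval O d env a) fun v => ret v.fst 1
    | .snd a => andThen (eval O d env a) fun v => ret v.snd 1
    | .isPair a => andThen (eval O d env a) fun v => ret (Val.bit v.isPair) 1
    | .ite c t e =>
        andThen (eval O d env c) fun v =>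
        andThen (ret (.int 0) 1) fun _ => eval O d env (if v.truthy then t else e)
    | .arith o a b =>
        andThen (eval O d env a) fun va =>
        andThen (eval O d env b) fun vb =>
        ret (.int (o.apply va.toInt vb.toInt))
          (1 + va.toInt.natAbs.size + vb.toInt.natAbs.size)
    | .flip => (PMF.uniformOfFintype Bool).bind fun b => ret (Val.bit b) 1

/-- Run the function value `f` on the argument `a` for at most `T` steps: the distribution of the
value returned, `none` standing for a run that aborts or does not halt within `T` steps. -/
def exec (O : Oracle) (T : ℕ) (f a : Val) : PMF (Option Val) :=
  (call (eval O T) O f a).map fun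
    | none => none
    | some (v, c) => if c ≤ T then some v else none

/-- A program as a function value. -/
def program (A : Code) : Val := .clo A (.int 0)

/-! ### Boolean functions and distributions -/

/-- The cube `{-1,1}^n`, with `true` for `1` and `false` for `-1`. -/
abbrev Cube (n : ℕ) := Fin n → Bool

/-- A point of the cube as a machine value: the list of its bits. -/
def enc {n : ℕ} (x : Cube n) : Val :=
  (List.ofFn x).foldr (fun b v => .pair (Val.bit b) v) (.int 0)

/-- The satisfying assignments of `f`. -/
def sat {n : ℕ} (f : Cube n → Bool) : Finset (Cube n) := Finset.univ.filter fun x => f x = true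

/-- `Pr_{x ∼ U_n}[f(x) = 1]`. -/
def bias {n : ℕ} (f : Cube n → Bool) : ℝ := ((sat f).card : ℝ) / 2 ^ n

/-- `Pr_{x ∼ U_{f⁻¹(1)}}[g(x) = 1]` (and `0` if `f` is unsatisfiable). -/
def condProb {n : ℕ} (f g : Cube n → Bool) : ℝ :=
  ((sat f ∩ sat g).card : ℝ) / ((sat f).card : ℝ)

/-- The uniform distribution on the satisfying assignments of `f`. -/
def unifSat {n : ℕ} (f : Cube n → Bool) (hf : (sat f).Nonempty) : PMF (Cube n) :=
  PMF.uniformOfFinset (sat f) hf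

/-- Probability of an event, as a real number. -/
def prob {α : Type} (p : PMF α) (E : Set α) : ℝ := (p.toOuterMeasure E).toReal

/-- Total variation distance. -/
def dTV {n : ℕ} (D D' : PMF (Cube n)) : ℝ :=
  (1 / 2) * ∑ x, |(D x).toReal - (D' x).toReal|

/-- Access to independent samples from `D`, through oracle `0`. -/
def sampleOracle {n : ℕ} (D : PMF (Cube n)) : Oracle := fun k _ =>
  if k = 0 then D.map fun x => some (enc x) else PMF.pure none

/-- A class of Boolean functions, for every number `n` of variables. -/
abbrev ConceptClass := (n : ℕ) → Set (Cube n → Bool)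

/-- A representation class: for every `n` a set of representations (plain data), the Boolean
function that each of them represents, and a program that evaluates it. -/
structure RepClass where
  Rep : ℕ → Set Val
  fn : (n : ℕ) → Val → Cube n → Bool
  ev : Code
  isData : ∀ n, ∀ r ∈ Rep n, r.IsData
  ev_spec : ∀ n, ∀ r ∈ Rep n, ∀ x : Cube n, ∃ t : ℕ,
    exec noOracle t (program ev) (.pair (.int n) (.pair r (enc x)))
      = PMF.pure (some (Val.bit (fn n r x)))

/-- The argument `(n, a, b, rest)` of an algorithm, with accuracy `ε = 1/a` and
confidence `δ = 1/b`. -/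
def args (n a b : ℕ) (rest : Val) : Val :=
  .pair (.int n) (.pair (.int a) (.pair (.int b) rest))

/-- The function value `h` computes `φ`, deterministically, within `t` steps on every input. -/
def Computes {n : ℕ} (t : ℕ) (h : Val) (φ : Cube n → Bool) : Prop :=
  ∀ x, exec noOracle t h (enc x) = PMF.pure (some (Val.bit (φ x)))

/-! ### Approximate counting and approximate uniform generation -/

/-- `A` is an approximate counting algorithm for `C'` with running time `T(n, 1/ε, 1/δ)`.
The estimate is output as a fraction `p / q`. -/
structure IsApproxCount (C' : RepClass) (A : Code) (T : ℕ → ℕ → ℕ → ℕ) : Prop where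
  halts : ∀ n a b : ℕ, 1 ≤ a → 1 ≤ b → ∀ r ∈ C'.Rep n,
    exec noOracle (T n a b) (program A) (args n a b r) none = 0
  correct : ∀ n a b : ℕ, 1 ≤ a → 1 ≤ b → ∀ r ∈ C'.Rep n,
    1 - 1 / (b : ℝ) ≤ prob (exec noOracle (T n a b) (program A) (args n a b r))
      {w | ∃ p q : ℤ, w = some (.pair (.int p) (.int q)) ∧ 0 < q ∧
        1 / (1 + 1 / (a : ℝ)) * bias (C'.fn n r) ≤ (p : ℝ) / q ∧
        (p : ℝ) / q ≤ (1 + 1 / (a : ℝ)) * bias (C'.fn n r)}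

/-- Output of a generator: the failure symbol. -/
def genBot : Val := .pair (.int 0) (.int 0)

/-- Output of a generator: a point of the cube. -/
def genPoint {n : ℕ} (x : Cube n) : Val := .pair (.int 1) (enc x)

/-- `A` is an approximate uniform generation algorithm for `C'` with running time
`T(n, 1/ε, 1/δ)`: for every satisfiable `g` in the class and every `ε` there is a distribution `D`
on `g⁻¹(1)`, multiplicatively `(1+ε)`-close to uniform, such that for every `δ` the algorithm
outputs `⊥` with some probability `q ≤ δ`, and otherwise a point distributed as `D`. -/
structure IsApproxGen (C' : RepClass) (A : Code) (T : ℕ → ℕ → ℕ → ℕ) : Prop where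
  halts : ∀ n a b : ℕ, 1 ≤ a → 1 ≤ b → ∀ r ∈ C'.Rep n,
    exec noOracle (T n a b) (program A) (args n a b r) none = 0
  correct : ∀ n a : ℕ, 1 ≤ a → ∀ r ∈ C'.Rep n, (sat (C'.fn n r)).Nonempty →
    ∃ D : PMF (Cube n),
      (∀ x, C'.fn n r x = false → D x = 0) ∧
      (∀ x, C'.fn n r x = true →
        1 / (1 + 1 / (a : ℝ)) * (1 / ((sat (C'.fn n r)).card : ℝ)) ≤ (D x).toReal ∧
        (D x).toReal ≤ (1 + 1 / (a : ℝ)) * (1 / ((sat (C'.fn n r)).card : ℝ))) ∧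
      ∀ b : ℕ, 1 ≤ b → ∃ q : ℝ, q ≤ 1 / (b : ℝ) ∧
        prob (exec noOracle (T n a b) (program A) (args n a b r)) {some genBot} = q ∧
        ∀ x : Cube n, prob (exec noOracle (T n a b) (program A) (args n a b r))
          {some (genPoint x)} = (1 - q) * (D x).toReal

/-! ### Densifiers -/

/-- `A` is a `γ`-densifier for `C` using `C'`, where `γ = 1 / gammaInv`, with running time
`T(n, 1/ε, 1/δ)`.  The estimate of the bias is the number `j / 2^n`, passed as the integer `j`.
Whatever the estimate, the output represents a function in `C'`, and the time bound covers the
run of `A` as well as the evaluation of the function that it outputs. -/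
structure IsDensifier (C : ConceptClass) (C' : RepClass) (gammaInv : ℕ → ℕ → ℕ → ℕ)
    (A : Code) (T : ℕ → ℕ → ℕ → ℕ) : Prop where
  pos : ∀ n a b : ℕ, 1 ≤ a → 1 ≤ b → 1 ≤ gammaInv n a b
  halts : ∀ n a b : ℕ, 1 ≤ a → 1 ≤ b → ∀ f ∈ C n, ∀ hf : (sat f).Nonempty,
    ∀ j : ℕ, 1 ≤ j → j ≤ 2 ^ n →
    ∀ w ∈ (exec (sampleOracle (unifSat f hf)) (T n a b) (program A)
      (args n a b (.pair (.int j) (.orc 0)))).support,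
    ∃ r ∈ C'.Rep n, w = some r ∧ ∀ x : Cube n,
      exec noOracle (T n a b) (program C'.ev) (.pair (.int n) (.pair r (enc x)))
        = PMF.pure (some (Val.bit (C'.fn n r x)))
  dense : ∀ n a b : ℕ, 1 ≤ a → 1 ≤ b → ∀ f ∈ C n, ∀ hf : (sat f).Nonempty,
    ∀ j : ℕ, 1 ≤ j → j ≤ 2 ^ n →
    bias f ≤ (j : ℝ) / 2 ^ n → (j : ℝ) / 2 ^ n < (1 + 1 / (a : ℝ)) * bias f →
    1 - 1 / (b : ℝ) ≤ prob (exec (sampleOracle (unifSat f hf)) (T n a b) (program A)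
        (args n a b (.pair (.int j) (.orc 0))))
      {w | ∃ r ∈ C'.Rep n, w = some r ∧
        1 - 1 / (a : ℝ) ≤ condProb f (C'.fn n r) ∧
        1 / (gammaInv n a b : ℝ) ≤ condProb (C'.fn n r) f}

/-! ### Statistical query learning -/

/-- The function value `χ` computes the query function `φ : {-1,1}^n × {-1,1} → [-1,1]`,
deterministically, within `t` steps; values are output as fractions `p / q`. -/
def QueryComputes {n : ℕ} (t : ℕ) (χ : Val) (φ : Cube n → Bool → ℝ) : Prop :=
  ∀ x y, ∃ p q : ℤ, 0 < q ∧ |p| ≤ q ∧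
    exec noOracle t χ (.pair (enc x) (Val.bit y)) = PMF.pure (some (.pair (.int p) (.int q))) ∧
    φ x y = (p : ℝ) / q

/-- An admissible query `(s, χ)` on functions of `n` variables: the tolerance is `1/s`, at least
`1/S`, and `χ` computes a query function within `t` steps. -/
def Admissible (n t S : ℕ) (query : Val) : Prop :=
  ∃ (s : ℕ) (χ : Val) (φ : Cube n → Bool → ℝ),
    query = .pair (.int s) χ ∧ 1 ≤ s ∧ s ≤ S ∧ QueryComputes t χ φ

/-- `R` answers every admissible query of tolerance `1/s` by an integer `k`, `|k| ≤ s`, which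
stands for the number `k / s`; any other query aborts. -/
structure Answers (n t S : ℕ) (R : Val → PMF (Option Val)) : Prop where
  admissible : ∀ (s : ℕ) (χ : Val), Admissible n t S (.pair (.int s) χ) →
    ∀ w ∈ (R (.pair (.int s) χ)).support, ∃ k : ℤ, |k| ≤ s ∧ w = some (.int k)
  otherwise : ∀ query, ¬ Admissible n t S query → R query = PMF.pure none

/-- `R` is a statistical query oracle `STAT(f, D)`: every answer to a query is, with certainty,
within the tolerance of `E_{x ∼ D}[φ(x, f(x))]`. -/
def IsStat {n : ℕ} (f : Cube n → Bool) (D : PMF (Cube n)) (t S : ℕ)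
    (R : Val → PMF (Option Val)) : Prop :=
  Answers n t S R ∧
  ∀ (s : ℕ) (χ : Val) (φ : Cube n → Bool → ℝ), 1 ≤ s → s ≤ S → QueryComputes t χ φ →
    ∀ k : ℤ, some (.int k) ∈ (R (.pair (.int s) χ)).support →
      |∑ x, (D x).toReal * φ x (f x) - (k : ℝ) / s| ≤ 1 / (s : ℝ)

/-- Oracle `0` answers statistical queries through `R`, oracle `1` draws samples from `D`. -/
def sqOracle {n : ℕ} (R : Val → PMF (Option Val)) (D : PMF (Cube n)) : Oracle := fun k v =>
  if k = 0 then R v else if k = 1 then D.map fun x => some (enc x) else PMF.pure none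

/-- `Pr_{x ∼ D}[h(x) ≠ f(x)]`. -/
def err {n : ℕ} (D : PMF (Cube n)) (h f : Cube n → Bool) : ℝ :=
  ∑ x, if h x = f x then 0 else (D x).toReal

/-- `A` is a distribution-independent SQ learning algorithm for `C` with running time
`t₁(n, 1/ε, 1/δ)` (oracle calls costing one step), query evaluation time `t₂(n)` and
smallest tolerance `τ(n, 1/ε) = 1 / tauInv`.  The time bound holds whatever the answers
to its queries, and covers the run of `A` as well as the evaluation of its hypothesis.
(Queries that are not admissible abort, hence are never made.) -/
structure IsSQLearner (C : ConceptClass) (A : Code) (t₁ : ℕ → ℕ → ℕ → ℕ) (t₂ : ℕ → ℕ)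
    (tauInv : ℕ → ℕ → ℕ) : Prop where
  halts : ∀ n a b : ℕ, 1 ≤ a → 1 ≤ b → ∀ (D : PMF (Cube n)) (R : Val → PMF (Option Val)),
    Answers n (t₂ n) (tauInv n a) R →
    ∀ w ∈ (exec (sqOracle R D) (t₁ n a b) (program A)
      (args n a b (.pair (.orc 0) (.orc 1)))).support,
    ∃ (h : Val) (φ : Cube n → Bool), w = some h ∧ Computes (t₁ n a b) h φ
  learns : ∀ n a b : ℕ, 1 ≤ a → 1 ≤ b → ∀ f ∈ C n, ∀ (D : PMF (Cube n))
    (R : Val → PMF (Option Val)), IsStat f D (t₂ n) (tauInv n a) R →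
    1 - 1 / (b : ℝ) ≤ prob (exec (sqOracle R D) (t₁ n a b) (program A)
        (args n a b (.pair (.orc 0) (.orc 1))))
      {w | ∃ (h : Val) (φ : Cube n → Bool), w = some h ∧ Computes (t₁ n a b) h φ ∧
        err D φ f ≤ 1 / (a : ℝ)}

/-! ### Inverse approximate uniform generation -/

/-- `G` is a sampler for `D` with running time `t`: a program without access to any oracle
which, run on (at most `t`) fair coin flips, always halts within `t` steps with a point of the
cube distributed exactly as `D`. -/
def IsSampler {n : ℕ} (t : ℕ) (G : Val) (D : PMF (Cube n)) : Prop :=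
  exec noOracle t G (.int 0) = D.map fun x => some (enc x)

/-- `A` is an inverse approximate uniform generation algorithm for `C` with running time
`T(n, 1/ε, 1/δ)`, which covers the run of `A` as well as that of the sampler it outputs. -/
structure IsInvGen (C : ConceptClass) (A : Code) (T : ℕ → ℕ → ℕ → ℕ) : Prop where
  halts : ∀ n a b : ℕ, 1 ≤ a → 1 ≤ b → ∀ f ∈ C n, ∀ hf : (sat f).Nonempty,
    ∀ w ∈ (exec (sampleOracle (unifSat f hf)) (T n a b) (program A)
      (args n a b (.orc 0))).support,
    ∃ (G : Val) (D : PMF (Cube n)), w = some G ∧ IsSampler (T n a b) G D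
  accurate : ∀ n a b : ℕ, 1 ≤ a → 1 ≤ b → ∀ f ∈ C n, ∀ hf : (sat f).Nonempty,
    1 - 1 / (b : ℝ) ≤ prob (exec (sampleOracle (unifSat f hf)) (T n a b) (program A)
        (args n a b (.orc 0)))
      {w | ∃ (G : Val) (D : PMF (Cube n)), w = some G ∧ IsSampler (T n a b) G D ∧
        dTV D (unifSat f hf) ≤ 1 / (a : ℝ)}

/-- Some program computes `F(n, a, b)` from `n, a, b` within `T(n, a, b)` steps. -/
def ComputableWithin (F T : ℕ → ℕ → ℕ → ℕ) : Prop :=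
  ∃ A : Code, ∀ n a b : ℕ, 1 ≤ a → 1 ≤ b →
    exec noOracle (T n a b) (program A) (args n a b (.int 0))
      = PMF.pure (some (.int (F n a b)))

/-- A polynomial in `n`, `1/ε = a`, `log(1/δ)` (the bit length of `b`), in the running times of
the ingredients, in `1/γ` and in `1/τ`.  The ingredients are called with the parameters

* densifier: `1/ε₁ = c/ε` and `1/δ₁ = c/δ`, giving the density `γ`;
* SQ learner: `1/ε₂ = c/(ε γ)` and `1/δ₂ = c/δ`, giving the tolerance `τ` and the time `t₁`;
* generator and counter: `1/ε₃` a polynomial in `n`, `1/ε`, `1/γ`, `1/τ`, `t₁`, and `1/δ₃` a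
  polynomial in these and `1/δ`. -/
def invTime (c : ℕ) (pε : MvPolynomial (Fin 5) ℕ) (pδ : MvPolynomial (Fin 6) ℕ)
    (P : MvPolynomial (Fin 10) ℕ) (Tden gammaInv Tgen Tcount t₁ : ℕ → ℕ → ℕ → ℕ)
    (t₂ : ℕ → ℕ) (tauInv : ℕ → ℕ → ℕ) (n a b : ℕ) : ℕ :=
  let Γ := gammaInv n (c * a) (c * b)
  let a₂ := c * a * Γ
  let S := tauInv n a₂
  let T₁ := t₁ n a₂ (c * b)
  let a₃ := MvPolynomial.eval ![n, a, Γ, S, T₁] pε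
  let b₃ := MvPolynomial.eval ![n, a, b, Γ, S, T₁] pδ
  MvPolynomial.eval
    ![n, a, b.size, Tden n (c * a) (c * b), Γ, Tgen n a₃ b₃, Tcount n a₃ b₃, T₁, t₂ n, S] P

end InvGen

end

open InvGen

open scoped ENNReal

noncomputable section

namespace InvGen

/-! ### Generalities on probability mass functions -/

/-! Write F and G for the numbers of satisfying points of `f` and `g`, and κ = 1/(64a). The
algorithm guesses F along a progression of ratio about 1 + 1/K (`nextGuess`). From each guess `j` it
builds a candidate sampler and tests it, and it outputs the first candidate that passes
(`search_meets`).

A candidate arises as follows. The densifier, given `j`, returns `g`. The counter estimates the bias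
of `g`. The SQ learner is run for the distribution D of the generator's output on `g`, and returns a
hypothesis φ. With A = g ∧ φ, the sampler draws from D until it hits A. If `j` is right, then `g`
covers most of `f`, at least a fraction 1/Γ of `g` lies in `f`, and φ errs on so little of D that A
is almost the satisfying set of `f` (`card_disagree_le`). Rejection sampling then needs about Γ/κ
rounds (`rejDist_close`).

The learner's queries have to be answered without labelled examples. Split χ(x, f(x)) as χ(x, -1)
plus the indicator of f(x) = 1 times χ(x, 1) - χ(x, -1). The first term is averaged over D. The
second, averaged over the uniform distribution on `g`, equals F/G times an average over positive
samples that lie in `g` (`sum_unifSat_swap`), and F/G is known approximately from the guess and the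
count (`ratio_error`). Hence generated points and positive samples suffice (`stat_expect_error`,
`stat_correct`).

The test estimates how much of `f` lies in A and how much of D lies in A, and checks that A covers
nearly all of `f`, is not too rare under D, and is not larger than the guess. If F ≤ j(1+κ) fails
because the guess is too small, passing is still sound: `passes_sound` needs only that `j` is not
much larger than F, and uses neither the densifier's nor the learner's guarantee. A right guess
passes (`passes_complete`). As the guesses increase and the first one that is at least F is right
(`reaches_one`), the search stops at or before a right guess, and in both cases with a good sampler.
Only the count and the test can fail at every guess. The densifier and the learner are charged once,
at a right guess, so a constant multiple of 1/δ is enough for their confidence.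

Two facts about the machine model make this rigorous. First, oracle handles may be replaced by
closures that simulate the oracles, at a multiplicative cost (`eval_sim`, `callRuns_of_exec`); this
runs the learner inside the algorithm. Secondly, the learner is promised correct answers with
certainty, whereas simulated answers are correct only with probability 1 - η. Conditioning each
answer on being correct gives an honest oracle R' with (1 - η) R' ≤ R, and a run of T steps loses at
most the factor (1 - η)^T (`exec_dom`, `IsSQLearner.learns_of_prob`).

Running times are handled by one number L that exceeds every time, size and bit length in sight;
every routine is bounded by a power of L (`runs_short`, `sizes_params`). Certainty of halting and
probability of success are carried together by `Meets`. -/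

theorem bind_congr_support {α β : Type} (p : PMF α) {f g : α → PMF β}
    (h : ∀ a ∈ p.support, f a = g a) : p.bind f = p.bind g := by
  ext b
  simp only [PMF.bind_apply]
  refine tsum_congr fun a => ?_
  by_cases ha : a ∈ p.support
  · rw [h a ha]
  · have : p a = 0 := by simpa [PMF.mem_support_iff] using ha
    simp [this]

theorem map_congr_support {α β : Type} (p : PMF α) {f g : α → β}
    (h : ∀ a ∈ p.support, f a = g a) : p.map f = p.map g := by
  rw [← PMF.bind_pure_comp, ← PMF.bind_pure_comp]
  exact bind_congr_support p fun a ha => by simp [h a ha]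

/-- Certain halting is stated as `p none = 0`; this turns it into a distribution of values, the form
in which the rules for programs consume it. -/
theorem exists_map_some {α : Type} (p : PMF (Option α)) (h : p none = 0) :
    ∃ q : PMF α, p = q.map some := by
  have hne : ∃ a : α, True := by
    by_contra hc
    push Not at hc
    obtain ⟨o, ho⟩ := p.support_nonempty
    cases o with
    | none => exact ho h
    | some a => exact hc a
  obtain ⟨a₀, -⟩ := hne
  refine ⟨p.map fun o => o.getD a₀, ?_⟩
  rw [PMF.map_comp]
  conv_lhs => rw [← PMF.map_id p]
  refine map_congr_support p fun o ho => ?_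
  cases o with
  | none => exact absurd h ho
  | some a => rfl

theorem map_some_injective {α : Type} {p q : PMF α} (h : p.map some = q.map some) : p = q := by
  obtain ⟨a, -⟩ := p.support_nonempty
  have := congrArg (PMF.map fun o : Option α => o.getD a) h
  have e : (fun o : Option α => o.getD a) ∘ some = id := rfl
  simpa only [PMF.map_comp, e, PMF.map_id] using this

/-! ### Substitution of function values for oracle handles -/

/-- A closure or an oracle handle. -/
def Val.IsFn : Val → Prop
  | .clo _ _ => True
  | .orc _ => True
  | _ => False

/-- Replace the oracle handles in a value. -/
def Val.subst (σ : ℕ → Val) : Val → Val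
  | .int z => .int z
  | .pair a b => .pair (a.subst σ) (b.subst σ)
  | .clo body env => .clo body (env.subst σ)
  | .orc k => σ k

/-- The largest bit length of an integer in a value. -/
def Val.width : Val → ℕ
  | .int z => z.natAbs.size
  | .pair a b => max a.width b.width
  | .clo _ env => env.width
  | .orc _ => 0

section subst

variable {σ : ℕ → Val}

theorem subst_fst (hσ : ∀ k, (σ k).IsFn) (v : Val) : (v.subst σ).fst = v.fst.subst σ := by
  cases v with
  | orc k => have := hσ k; revert this; cases h : σ k <;> simp [Val.IsFn, Val.subst, Val.fst, h]
  | _ => rfl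

theorem subst_snd (hσ : ∀ k, (σ k).IsFn) (v : Val) : (v.subst σ).snd = v.snd.subst σ := by
  cases v with
  | orc k => have := hσ k; revert this; cases h : σ k <;> simp [Val.IsFn, Val.subst, Val.snd, h]
  | _ => rfl

theorem subst_toInt (hσ : ∀ k, (σ k).IsFn) (v : Val) : (v.subst σ).toInt = v.toInt := by
  cases v with
  | orc k => have := hσ k; revert this; cases h : σ k <;> simp [Val.IsFn, Val.subst, Val.toInt, h]
  | _ => rfl

theorem subst_isPair (hσ : ∀ k, (σ k).IsFn) (v : Val) : (v.subst σ).isPair = v.isPair := by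
  cases v with
  | orc k => have := hσ k; revert this; cases h : σ k <;> simp [Val.IsFn, Val.subst, Val.isPair, h]
  | _ => rfl

theorem subst_truthy (hσ : ∀ k, (σ k).IsFn) (v : Val) : (v.subst σ).truthy = v.truthy := by
  cases v with
  | orc k => have := hσ k; revert this; cases h : σ k <;> simp [Val.IsFn, Val.subst, Val.truthy, h]
  | _ => rfl

theorem subst_lookup (hσ : ∀ k, (σ k).IsFn) (i : ℕ) (v : Val) :
    Val.lookup i (v.subst σ) = (Val.lookup i v).subst σ := by
  induction i generalizing v with
  | zero => exact subst_fst hσ v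
  | succ i ih => simp only [Val.lookup]; rw [subst_snd hσ, ih]

theorem subst_bit (b : Bool) : (Val.bit b).subst σ = Val.bit b := rfl

theorem subst_enc {n : ℕ} (x : Cube n) : (enc x).subst σ = enc x := by
  unfold enc
  induction List.ofFn x with
  | nil => rfl
  | cons b l ih => simp only [List.foldr, Val.subst, ih]; rfl

end subst

theorem subst_orc (v : Val) : v.subst Val.orc = v := by
  induction v <;> simp_all [Val.subst]

/-! ### Widths of values and bit lengths of arithmetic results -/

theorem width_fst (v : Val) : v.fst.width ≤ v.width := by
  cases v <;> simp [Val.fst, Val.width]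

theorem width_snd (v : Val) : v.snd.width ≤ v.width := by
  cases v <;> simp [Val.snd, Val.width]

theorem width_lookup (i : ℕ) (v : Val) : (Val.lookup i v).width ≤ v.width := by
  induction i generalizing v with
  | zero => exact width_fst v
  | succ i ih => exact (ih _).trans (width_snd v)

theorem size_toInt (v : Val) : v.toInt.natAbs.size ≤ v.width := by
  cases v <;> simp [Val.toInt, Val.width]

theorem width_bit (b : Bool) : (Val.bit b).width ≤ 1 := by
  cases b <;> simp [Val.bit, Val.width]

theorem width_enc {n : ℕ} (x : Cube n) : (enc x).width ≤ 1 := by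
  unfold enc
  induction List.ofFn x with
  | nil => simp [Val.width]
  | cons b l ih => simp only [List.foldr, Val.width]; exact max_le (width_bit b) ih

theorem width_subst {σ : ℕ → Val} {B : ℕ} (hσ : ∀ k, (σ k).width ≤ B) (v : Val)
    (hv : v.width ≤ B) : (v.subst σ).width ≤ B := by
  induction v with
  | int z => exact hv
  | pair a b iha ihb =>
    simp only [Val.width, Val.subst] at *
    exact max_le (iha (le_of_max_le_left hv)) (ihb (le_of_max_le_right hv))
  | clo t e ih => exact ih hv
  | orc k => exact hσ k

theorem size_mul_le (x y : ℕ) : (x * y).size ≤ x.size + y.size := by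
  rw [Nat.size_le, pow_add]
  exact Nat.mul_lt_mul'' (Nat.lt_size_self x) (Nat.lt_size_self y)

theorem size_add_le (x y : ℕ) : (x + y).size ≤ max x.size y.size + 1 := by
  rw [Nat.size_le, pow_succ]
  have hx := (Nat.lt_size_self x).trans_le
    (Nat.pow_le_pow_right (by norm_num : 0 < 2) (le_max_left x.size y.size))
  have hy := (Nat.lt_size_self y).trans_le
    (Nat.pow_le_pow_right (by norm_num : 0 < 2) (le_max_right x.size y.size))
  omega

/-- The right-hand side is the cost charged for the operation. So a computed integer has at most as
many bits as the step that produced it costs, and a time bound is also a bound on widths. -/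
theorem size_arith (o : Arith) (x y : ℤ) :
    (o.apply x y).natAbs.size ≤ x.natAbs.size + y.natAbs.size + 1 := by
  have key : ∀ z : ℤ, z.natAbs ≤ x.natAbs + y.natAbs →
      z.natAbs.size ≤ x.natAbs.size + y.natAbs.size + 1 := fun z hz => by
    have h1 := Nat.size_le_size hz
    have h2 := size_add_le x.natAbs y.natAbs
    omega
  cases o with
  | add => exact key _ (Int.natAbs_add_le x y)
  | sub => exact key _ (Int.natAbs_sub_le x y)
  | mul =>
    simp only [Arith.apply, Int.natAbs_mul]
    exact (size_mul_le _ _).trans (Nat.le_succ _)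
  | div =>
    simp only [Arith.apply]
    have := Nat.size_le_size (Int.natAbs_ediv_le_natAbs x y)
    omega
  | le =>
    simp only [Arith.apply]
    split <;> simp

/-! ### Runs that always halt -/

/-- Every outcome is a value, with cost at most `B`. -/
def Safe (p : PMF Outcome) (B : ℕ) : Prop :=
  ∀ o ∈ p.support, ∃ v c, o = some (v, c) ∧ c ≤ B

theorem support_andThen {p : PMF Outcome} {k : Val → PMF Outcome} {v w : Val} {c c' : ℕ}
    (h : some (v, c) ∈ p.support) (h' : some (w, c') ∈ (k v).support) :
    some (w, c + c') ∈ (andThen p k).support := by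
  unfold andThen
  rw [PMF.mem_support_bind_iff]
  refine ⟨_, h, ?_⟩
  simp only [PMF.support_map]
  exact ⟨_, h', rfl⟩

/-- Failure propagates and costs add up, so a failure or an overrun of either half would show in the
composite. The bound on the first half is read off a complete run, which exists because the support
of the continuation is non-empty. -/
theorem Safe.of_andThen {p : PMF Outcome} {k : Val → PMF Outcome} {B : ℕ}
    (h : Safe (andThen p k) B) :
    Safe p B ∧ ∀ v c, some (v, c) ∈ p.support → Safe (k v) B := by
  have hk : ∀ v c, some (v, c) ∈ p.support → Safe (k v) B := by
    intro v c hv o ho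
    cases o with
    | none =>
      have : none ∈ (andThen p k).support := by
        unfold andThen
        rw [PMF.mem_support_bind_iff]
        refine ⟨_, hv, ?_⟩
        simp only [PMF.support_map]
        exact ⟨_, ho, rfl⟩
      obtain ⟨_, _, h1, _⟩ := h _ this
      cases h1
    | some w =>
      obtain ⟨w, c'⟩ := w
      obtain ⟨_, _, h1, h2⟩ := h _ (support_andThen hv ho)
      cases h1
      exact ⟨_, _, rfl, by omega⟩
  refine ⟨fun o ho => ?_, hk⟩
  cases o with
  | none =>
    have : none ∈ (andThen p k).support := by
      unfold andThen
      rw [PMF.mem_support_bind_iff]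
      exact ⟨_, ho, by simp⟩
    obtain ⟨_, _, h1, _⟩ := h _ this
    cases h1
  | some w =>
    obtain ⟨v, c⟩ := w
    obtain ⟨o', ho'⟩ := (k v).support_nonempty
    obtain ⟨w, c', rfl, -⟩ := hk v c ho _ ho'
    obtain ⟨_, _, h1, h2⟩ := h _ (support_andThen ho ho')
    cases h1
    exact ⟨_, _, rfl, by omega⟩

/-- The family `e`, indexed by fuel, halts within `B` steps, with values distributed as `μ`. -/
def HasRun (e : ℕ → PMF Outcome) (B : ℕ) (μ : PMF Val) : Prop :=
  ∃ ν : PMF (Val × ℕ), ν.map Prod.fst = μ ∧ (∀ w ∈ ν.support, w.2 ≤ B) ∧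
    ∀ d, B ≤ d → e d = ν.map some

/-- The term `t` halts within `B` steps, with values distributed as `μ`. -/
def Runs (O : Oracle) (env : Val) (t : Code) (B : ℕ) (μ : PMF Val) : Prop :=
  HasRun (fun d => eval O d env t) B μ

/-- The call of `f` on `a` halts within `B` steps, with values distributed as `μ`. -/
def CallRuns (O : Oracle) (f a : Val) (B : ℕ) (μ : PMF Val) : Prop :=
  HasRun (fun d => call (eval O d) O f a) B μ

theorem HasRun.mono {e : ℕ → PMF Outcome} {B B' : ℕ} {μ : PMF Val} (h : HasRun e B μ)
    (hB : B ≤ B') : HasRun e B' μ := by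
  obtain ⟨ν, h1, h2, h3⟩ := h
  exact ⟨ν, h1, fun w hw => (h2 w hw).trans hB, fun d hd => h3 d (hB.trans hd)⟩

theorem HasRun.ret (v : Val) (c : ℕ) : HasRun (fun _ => ret v c) c (PMF.pure v) :=
  ⟨PMF.pure (v, c), by simp [PMF.pure_map], by simp, fun _ _ => by simp [InvGen.ret, PMF.pure_map]⟩

theorem HasRun.succ {e e' : ℕ → PMF Outcome} {B : ℕ} {μ : PMF Val}
    (he : ∀ d, e (d + 1) = e' d) (h : HasRun e' B μ) : HasRun e (B + 1) μ := by
  obtain ⟨ν, h1, h2, h3⟩ := h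
  refine ⟨ν, h1, fun w hw => (h2 w hw).trans (Nat.le_succ _), fun d hd => ?_⟩
  obtain ⟨d, rfl⟩ : ∃ d', d = d' + 1 := ⟨d - 1, by omega⟩
  rw [he]
  exact h3 d (by omega)

theorem andThen_map_some (ν : PMF (Val × ℕ)) (k : Val → PMF Outcome) (κ : Val → PMF (Val × ℕ))
    (h : ∀ w ∈ ν.support, k w.1 = (κ w.1).map some) :
    andThen (ν.map some) k =
      (ν.bind fun w => (κ w.1).map fun u => (u.1, w.2 + u.2)).map some := by
  unfold andThen
  rw [PMF.bind_map, PMF.map_bind]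
  refine bind_congr_support ν fun w hw => ?_
  simp only [Function.comp, h w hw, PMF.map_comp]
  rfl

/-- The witness draws from the two joint laws of value and cost in succession and adds the costs.
Both halves run with the same fuel, which is at least either bound. -/
theorem HasRun.andThen {e : ℕ → PMF Outcome} {k : ℕ → Val → PMF Outcome} {B B' : ℕ}
    {μ : PMF Val} {κ : Val → PMF Val} (h : HasRun e B μ)
    (hk : ∀ v ∈ μ.support, HasRun (fun d => k d v) B' (κ v)) :
    HasRun (fun d => InvGen.andThen (e d) (k d)) (B + B') (μ.bind κ) := by
  classical
  obtain ⟨ν, rfl, h2, h3⟩ := h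
  have hs : ∀ w ∈ ν.support, w.1 ∈ (ν.map Prod.fst).support := fun w hw => by
    rw [PMF.support_map]; exact ⟨w, hw, rfl⟩
  choose! ξ h4 h5 h6 using hk
  refine ⟨ν.bind fun w => (ξ w.1).map fun u => (u.1, w.2 + u.2), ?_, ?_, ?_⟩
  · rw [PMF.map_bind, PMF.bind_map]
    refine bind_congr_support ν fun w hw => ?_
    rw [PMF.map_comp, Function.comp_apply, ← h4 w.1 (hs w hw)]
    rfl
  · intro w hw
    rw [PMF.mem_support_bind_iff] at hw
    obtain ⟨u, hu, hw⟩ := hw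
    rw [PMF.support_map] at hw
    obtain ⟨x, hx, rfl⟩ := hw
    have := h2 u hu
    have := h5 u.1 (hs u hu) x hx
    dsimp only
    omega
  · intro d hd
    beta_reduce
    rw [h3 d (by omega)]
    exact andThen_map_some ν _ ξ fun w hw => h6 w.1 (hs w hw) d (by omega)

theorem CallRuns.exec {O : Oracle} {f a : Val} {B T : ℕ} {μ : PMF Val}
    (h : CallRuns O f a B μ) (hB : B ≤ T) : exec O T f a = μ.map some := by
  obtain ⟨ν, rfl, h2, h3⟩ := h
  unfold InvGen.exec
  beta_reduce at h3
  rw [h3 T hB, PMF.map_comp, PMF.map_comp]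
  refine map_congr_support ν fun w hw => ?_
  simp [(h2 w hw).trans hB]

/-! ### Simulation of oracles by closures -/

/-- Coupling of a run `p` with a family of runs `e` on substituted values: the values correspond,
and the cost grows by a factor of at most `W + 1`. -/
def Sim (σ : ℕ → Val) (W B : ℕ) (p : PMF Outcome) (e : ℕ → PMF Outcome) (D : ℕ) : Prop :=
  ∃ ν : PMF (Val × ℕ × ℕ), p = ν.map (fun w => some (w.1, w.2.1)) ∧
    (∀ d, D ≤ d → e d = ν.map fun w => some (w.1.subst σ, w.2.2)) ∧
    ∀ w ∈ ν.support, w.1.width ≤ B ∧ w.2.2 ≤ (W + 1) * w.2.1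

theorem Sim.succ {σ : ℕ → Val} {W B D : ℕ} {p : PMF Outcome} {e e' : ℕ → PMF Outcome}
    (he : ∀ d, e (d + 1) = e' d) (h : Sim σ W B p e' D) : Sim σ W B p e (D + 1) := by
  obtain ⟨ν, h1, h2, h3⟩ := h
  refine ⟨ν, h1, fun d hd => ?_, h3⟩
  obtain ⟨d, rfl⟩ : ∃ d', d = d' + 1 := ⟨d - 1, by omega⟩
  rw [he]
  exact h2 d (by omega)

theorem Sim.ret {σ : ℕ → Val} {W B D : ℕ} (v : Val) (c : ℕ) (hv : v.width ≤ B) :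
    Sim σ W B (ret v c) (fun _ => InvGen.ret (v.subst σ) c) D :=
  ⟨PMF.pure (v, c, c), by simp [InvGen.ret, PMF.pure_map],
    fun _ _ => by simp [InvGen.ret, PMF.pure_map], by
      simp only [PMF.support_pure, Set.mem_singleton_iff, forall_eq]
      exact ⟨hv, Nat.le_mul_of_pos_left _ (Nat.succ_pos _)⟩⟩

/-- One law on triples (value, cost, simulated cost) couples the two runs. Such couplings compose,
and the linear inequality between the costs is additive. -/
theorem Sim.andThen {σ : ℕ → Val} {W B D : ℕ} {p : PMF Outcome} {e : ℕ → PMF Outcome}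
    {k : Val → PMF Outcome} {k' : ℕ → Val → PMF Outcome} (h : Sim σ W B p e D)
    (hk : ∀ v c, some (v, c) ∈ p.support → v.width ≤ B →
      Sim σ W B (k v) (fun d => k' d (v.subst σ)) D) :
    Sim σ W B (andThen p k) (fun d => InvGen.andThen (e d) (k' d)) D := by
  classical
  obtain ⟨ν, rfl, h2, h3⟩ := h
  have hk' : ∀ w ∈ ν.support, Sim σ W B (k w.1) (fun d => k' d (w.1.subst σ)) D := by
    intro w hw
    refine hk w.1 w.2.1 ?_ (h3 w hw).1
    rw [PMF.support_map]
    exact ⟨w, hw, rfl⟩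
  choose! ξ h4 h5 h6 using hk'
  refine ⟨ν.bind fun w => (ξ w).map fun u => (u.1, w.2.1 + u.2.1, w.2.2 + u.2.2), ?_, ?_, ?_⟩
  · unfold InvGen.andThen
    rw [PMF.bind_map, PMF.map_bind]
    refine bind_congr_support ν fun w hw => ?_
    simp only [Function.comp, PMF.map_comp]
    rw [h4 w hw, PMF.map_comp]
    rfl
  · intro d hd
    unfold InvGen.andThen
    beta_reduce at h5 ⊢
    rw [h2 d hd, PMF.bind_map, PMF.map_bind]
    refine bind_congr_support ν fun w hw => ?_
    simp only [Function.comp, PMF.map_comp]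
    rw [h5 w hw d hd, PMF.map_comp]
    rfl
  · intro w hw
    rw [PMF.mem_support_bind_iff] at hw
    obtain ⟨u, hu, hw⟩ := hw
    rw [PMF.support_map] at hw
    obtain ⟨x, hx, rfl⟩ := hw
    have e1 := (h3 u hu).2
    have e2 := h6 u hu x hx
    exact ⟨e2.1, by dsimp only; rw [mul_add]; exact add_le_add e1 e2.2⟩

/-- The function values `σ` simulate under `O'` the oracles `O`, at a cost of at most `W` for
every query of width at most `B`. -/
def Simulates (O O' : Oracle) (σ : ℕ → Val) (W B : ℕ) : Prop :=
  ∀ k v, v.width ≤ B → none ∉ (O k v).support → ∃ μ : PMF Val, O k v = μ.map some ∧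
    (∀ w ∈ μ.support, w.subst σ = w ∧ w.width ≤ B) ∧ CallRuns O' (σ k) (v.subst σ) W μ

section simulation

variable {O O' : Oracle} {σ : ℕ → Val} {W B : ℕ}

/-- The oracle call costs one step and the simulating closure at most `W`, which fits the factor `W
+ 1`. Fuel measures depth, so `W` extra levels are enough. -/
theorem Sim.oracle (hO : Simulates O O' σ W B) (k d : ℕ) (v : Val) (hv : v.width ≤ B)
    (hs : Safe ((O k v).map (Option.map fun v => (v, 1))) B) :
    Sim σ W B ((O k v).map (Option.map fun v => (v, 1)))
      (fun d' => call (eval O' d') O' (σ k) (v.subst σ)) (d + W) := by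
  have hn : none ∉ (O k v).support := by
    intro h
    obtain ⟨_, _, h1, _⟩ := hs none (by rw [PMF.support_map]; exact ⟨none, h, rfl⟩)
    cases h1
  obtain ⟨μ, h1, h2, ν, rfl, h4, h5⟩ := hO k v hv hn
  refine ⟨ν.map fun w => (w.1, 1, w.2), ?_, ?_, ?_⟩
  · rw [h1, PMF.map_comp, PMF.map_comp, PMF.map_comp]
    rfl
  · intro d' hd'
    beta_reduce at h5 ⊢
    rw [h5 d' (by omega), PMF.map_comp]
    refine map_congr_support ν fun w hw => ?_
    simp only [Function.comp]
    rw [(h2 w.1 (by rw [PMF.support_map]; exact ⟨w, hw, rfl⟩)).1]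
  · intro w hw
    rw [PMF.support_map] at hw
    obtain ⟨u, hu, rfl⟩ := hw
    refine ⟨(h2 u.1 (by rw [PMF.support_map]; exact ⟨u, hu, rfl⟩)).2, ?_⟩
    have := h4 u hu
    dsimp only
    omega

theorem Sim.call_of_eval (hO : Simulates O O' σ W B) (d : ℕ)
    (ih : ∀ env t, env.width ≤ B → Safe (eval O d env t) B →
      Sim σ W B (eval O d env t) (fun d' => eval O' d' (env.subst σ) t) (d + W))
    (f a : Val) (hf : f.width ≤ B) (ha : a.width ≤ B) (hs : Safe (call (eval O d) O f a) B) :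
    Sim σ W B (call (eval O d) O f a)
      (fun d' => call (eval O' d') O' (f.subst σ) (a.subst σ)) (d + W) := by
  cases f with
  | clo body env => exact ih _ body (by simp only [Val.width] at *; omega) hs
  | orc k => exact Sim.oracle hO k d a ha hs
  | int z => exact Sim.ret (.int 0) 1 (by simp [Val.width])
  | pair x y => exact Sim.ret (.int 0) 1 (by simp [Val.width])

/-- Handles are replaced by function values, and apart from application no operation can tell one
function value from another; this is what the `subst_` lemmas say. Widths stay below `B` because an
integer has at most as many bits as its step costs, and `Safe` bounds that cost by `B`. -/
theorem eval_sim (hσ : ∀ k, (σ k).IsFn) (hO : Simulates O O' σ W B) (d : ℕ) :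
    ∀ env t, env.width ≤ B → Safe (eval O d env t) B →
    Sim σ W B (eval O d env t) (fun d' => eval O' d' (env.subst σ) t) (d + W) := by
  induction d with
  | zero =>
    intro env t _ hs
    obtain ⟨_, _, h, _⟩ := hs none (by simp [eval])
    cases h
  | succ d ih =>
    intro env t he hs
    rw [Nat.add_right_comm]
    cases t with
    | var i =>
      refine Sim.succ (e' := fun d' => ret (Val.lookup i (env.subst σ)) (i + 1)) (fun d' => rfl) ?_
      simp only [subst_lookup hσ]
      exact Sim.ret _ _ ((width_lookup i env).trans he)
    | lit z =>
      refine Sim.succ (e' := fun d' => ret (.int z) (z.natAbs.size + 1)) (fun d' => rfl)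
        (Sim.ret _ _ ?_)
      obtain ⟨v, c, h1, h2⟩ := hs (some (.int z, z.natAbs.size + 1)) (by simp [eval, ret])
      cases h1
      simp only [Val.width]
      omega
    | lam body =>
      exact Sim.succ (e' := fun d' => ret (.clo body (env.subst σ)) 1) (fun d' => rfl)
        (Sim.ret (.clo body env) 1 he)
    | proc body =>
      exact Sim.succ (e' := fun d' => ret (.clo body (.int 0)) 1) (fun d' => rfl)
        (Sim.ret (.clo body (.int 0)) 1 (by simp [Val.width]))
    | app f a =>
      refine Sim.succ (e' := fun d' => andThen (eval O' d' (env.subst σ) f) fun vf =>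
        andThen (eval O' d' (env.subst σ) a) fun va =>
        andThen (ret (.int 0) 1) fun _ => call (eval O' d') O' vf va) (fun d' => rfl) ?_
      obtain ⟨s1, s2⟩ := Safe.of_andThen hs
      refine Sim.andThen (k' := fun d' vf => andThen (eval O' d' (env.subst σ) a) fun va =>
        andThen (ret (.int 0) 1) fun _ => call (eval O' d') O' vf va)
        (ih env f he s1) fun vf c hf hfw => ?_
      obtain ⟨s3, s4⟩ := Safe.of_andThen (s2 vf c hf)
      refine Sim.andThen (k' := fun d' va => andThen (ret (.int 0) 1) fun _ =>
        call (eval O' d') O' (vf.subst σ) va) (ih env a he s3) fun va c' ha haw => ?_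
      obtain ⟨s5, s6⟩ := Safe.of_andThen (s4 va c' ha)
      refine Sim.andThen (k' := fun d' _ => call (eval O' d') O' (vf.subst σ) (va.subst σ))
        (Sim.ret (.int 0) 1 (by simp [Val.width])) fun w c'' hw _ => ?_
      exact Sim.call_of_eval hO d ih vf va hfw haw (s6 w c'' hw)
    | pair a b =>
      refine Sim.succ (e' := fun d' => andThen (eval O' d' (env.subst σ) a) fun va =>
        andThen (eval O' d' (env.subst σ) b) fun vb => ret (.pair va vb) 1) (fun d' => rfl) ?_
      obtain ⟨s1, s2⟩ := Safe.of_andThen hs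
      refine Sim.andThen (k' := fun d' va =>
        andThen (eval O' d' (env.subst σ) b) fun vb => ret (.pair va vb) 1)
        (ih env a he s1) fun va c ha haw => ?_
      obtain ⟨s3, s4⟩ := Safe.of_andThen (s2 va c ha)
      exact Sim.andThen (k' := fun d' vb => ret (.pair (va.subst σ) vb) 1)
        (ih env b he s3) fun vb c' hb hbw => Sim.ret (.pair va vb) 1 (max_le haw hbw)
    | fst a =>
      refine Sim.succ (e' := fun d' => andThen (eval O' d' (env.subst σ) a) fun v => ret v.fst 1)
        (fun d' => rfl) ?_
      obtain ⟨s1, s2⟩ := Safe.of_andThen hs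
      refine Sim.andThen (k' := fun d' v => ret v.fst 1) (ih env a he s1) fun v c _ hw => ?_
      simp only [subst_fst hσ]
      exact Sim.ret _ _ ((width_fst v).trans hw)
    | snd a =>
      refine Sim.succ (e' := fun d' => andThen (eval O' d' (env.subst σ) a) fun v => ret v.snd 1)
        (fun d' => rfl) ?_
      obtain ⟨s1, s2⟩ := Safe.of_andThen hs
      refine Sim.andThen (k' := fun d' v => ret v.snd 1) (ih env a he s1) fun v c _ hw => ?_
      simp only [subst_snd hσ]
      exact Sim.ret _ _ ((width_snd v).trans hw)
    | isPair a =>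
      refine Sim.succ (e' := fun d' => andThen (eval O' d' (env.subst σ) a) fun v =>
        ret (Val.bit v.isPair) 1) (fun d' => rfl) ?_
      obtain ⟨s1, s2⟩ := Safe.of_andThen hs
      refine Sim.andThen (k' := fun d' v => ret (Val.bit v.isPair) 1) (ih env a he s1)
        fun v c hv hw => ?_
      simp only [subst_isPair hσ]
      refine Sim.ret (Val.bit v.isPair) _ ((width_bit _).trans ?_)
      obtain ⟨_, _, h1, h2⟩ := s2 v c hv _ (by simp [ret]; rfl)
      cases h1
      exact h2
    | ite c t e =>
      refine Sim.succ (e' := fun d' => andThen (eval O' d' (env.subst σ) c) fun v =>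
        andThen (ret (.int 0) 1) fun _ => eval O' d' (env.subst σ) (if v.truthy then t else e))
        (fun d' => rfl) ?_
      obtain ⟨s1, s2⟩ := Safe.of_andThen hs
      refine Sim.andThen (k' := fun d' v => andThen (ret (.int 0) 1) fun _ =>
        eval O' d' (env.subst σ) (if v.truthy then t else e)) (ih env c he s1) fun v c' hv hw => ?_
      obtain ⟨s3, s4⟩ := Safe.of_andThen (s2 v c' hv)
      simp only [subst_truthy hσ]
      exact Sim.andThen (k' := fun d' _ => eval O' d' (env.subst σ) (if v.truthy then t else e))
        (Sim.ret (.int 0) 1 (by simp [Val.width])) fun w c'' hw _ => ih env _ he (s4 w c'' hw)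
    | arith o a b =>
      refine Sim.succ (e' := fun d' => andThen (eval O' d' (env.subst σ) a) fun va =>
        andThen (eval O' d' (env.subst σ) b) fun vb => ret (.int (o.apply va.toInt vb.toInt))
          (1 + va.toInt.natAbs.size + vb.toInt.natAbs.size)) (fun d' => rfl) ?_
      obtain ⟨s1, s2⟩ := Safe.of_andThen hs
      refine Sim.andThen (k' := fun d' va => andThen (eval O' d' (env.subst σ) b) fun vb =>
        ret (.int (o.apply va.toInt vb.toInt)) (1 + va.toInt.natAbs.size + vb.toInt.natAbs.size))
        (ih env a he s1) fun va c ha haw => ?_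
      obtain ⟨s3, s4⟩ := Safe.of_andThen (s2 va c ha)
      refine Sim.andThen (k' := fun d' vb => ret (.int (o.apply (va.subst σ).toInt vb.toInt))
        (1 + (va.subst σ).toInt.natAbs.size + vb.toInt.natAbs.size))
        (ih env b he s3) fun vb c' hb hbw => ?_
      simp only [subst_toInt hσ]
      refine Sim.ret (.int _) _ ((size_arith o va.toInt vb.toInt).trans ?_)
      obtain ⟨_, _, h1, h2⟩ := s4 vb c' hb _ (by simp [ret]; rfl)
      cases h1
      omega
    | flip =>
      refine Sim.succ (e' := fun d' => (PMF.uniformOfFintype Bool).bind fun b =>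
        ret (Val.bit b) 1) (fun d' => rfl) ?_
      refine ⟨(PMF.uniformOfFintype Bool).map fun b => (Val.bit b, 1, 1), ?_, ?_, ?_⟩
      · rw [PMF.map_comp, ← PMF.bind_pure_comp]; rfl
      · intro d' _
        rw [PMF.map_comp, ← PMF.bind_pure_comp]; rfl
      · intro w hw
        rw [PMF.support_map] at hw
        obtain ⟨b, -, rfl⟩ := hw
        refine ⟨(width_bit b).trans ?_, Nat.le_mul_of_pos_left _ (Nat.succ_pos _)⟩
        obtain ⟨_, _, h1, h2⟩ := hs (some (Val.bit b, 1)) (by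
          simp only [eval, PMF.mem_support_bind_iff]
          exact ⟨b, by simp, by simp [ret]⟩)
        cases h1
        exact h2

/-- A run that certainly halts within `T` steps, with the oracles simulated by closures. -/
theorem callRuns_of_exec (hσ : ∀ k, (σ k).IsFn) (hO : Simulates O O' σ W B)
    {T : ℕ} {f a : Val} {μ : PMF Val} (hf : f.width ≤ B) (ha : a.width ≤ B) (hT : T ≤ B)
    (h : exec O T f a = μ.map some) :
    (∀ v ∈ μ.support, v.width ≤ B) ∧
      CallRuns O' (f.subst σ) (a.subst σ) ((W + 1) * (T + 1)) (μ.map (Val.subst σ)) := by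
  have hn : exec O T f a none = 0 := by
    rw [h, PMF.apply_eq_zero_iff, PMF.support_map]
    simp
  have hs : Safe (call (eval O T) O f a) T := by
    intro o ho
    cases o with
    | none =>
      exfalso
      have : none ∈ (exec O T f a).support := by
        unfold exec
        rw [PMF.support_map]
        exact ⟨none, ho, rfl⟩
      exact this hn
    | some w =>
      obtain ⟨v, c⟩ := w
      refine ⟨v, c, rfl, ?_⟩
      by_contra hc
      have : none ∈ (exec O T f a).support := by
        unfold exec
        rw [PMF.support_map]
        exact ⟨_, ho, by simp [hc]⟩
      exact this hn
  have hs' : Safe (call (eval O T) O f a) B := fun o ho => by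
    obtain ⟨v, c, h1, h2⟩ := hs o ho
    exact ⟨v, c, h1, h2.trans hT⟩
  obtain ⟨ν, h1, h2, h3⟩ := Sim.call_of_eval hO T (eval_sim hσ hO T) f a hf ha hs'
  have hc : ∀ w ∈ ν.support, w.2.1 ≤ T := fun w hw => by
    obtain ⟨v, c, e1, e2⟩ := hs (some (w.1, w.2.1)) (by
      rw [h1, PMF.support_map]; exact ⟨w, hw, rfl⟩)
    cases e1
    exact e2
  obtain rfl : ν.map Prod.fst = μ := by
    refine map_some_injective (Eq.trans ?_ h)
    unfold exec
    symm
    rw [h1, PMF.map_comp, PMF.map_comp]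
    refine map_congr_support ν fun w hw => ?_
    simp [hc w hw]
  refine ⟨?_, ?_⟩
  · intro v hv
    rw [PMF.support_map] at hv
    obtain ⟨w, hw, rfl⟩ := hv
    exact (h3 w hw).1
  · refine ⟨ν.map fun w => (w.1.subst σ, w.2.2), ?_, ?_, ?_⟩
    · rw [PMF.map_comp, PMF.map_comp]; rfl
    · intro w hw
      rw [PMF.support_map] at hw
      obtain ⟨u, hu, rfl⟩ := hw
      exact (h3 u hu).2.trans (Nat.mul_le_mul_left _ ((hc u hu).trans (Nat.le_succ T)))
    · intro d hd
      beta_reduce at h2 ⊢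
      -- Fuel `T + W` suffices, and it is at most `(W + 1) * (T + 1)`.
      rw [h2 d (le_trans (by nlinarith) hd), PMF.map_comp]
      rfl

end simulation

/-- Vacuous: every call aborts, hence no call occurs in a run that certainly halts. Code that runs
without oracles therefore tolerates any oracle and any substitution. -/
theorem simulates_noOracle (O : Oracle) (σ : ℕ → Val) (B : ℕ) : Simulates noOracle O σ 0 B :=
  fun _ _ _ h => absurd (by simp [noOracle]) h

theorem callRuns_orc {O : Oracle} {k : ℕ} {v : Val} {μ : PMF Val} (h : O k v = μ.map some) :
    CallRuns O (.orc k) v 1 μ :=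
  ⟨μ.map fun w => (w, 1), by rw [PMF.map_comp]; exact PMF.map_id μ, by
    intro w hw
    rw [PMF.support_map] at hw
    obtain ⟨u, -, rfl⟩ := hw
    rfl, fun d _ => by simp only [call, h, PMF.map_comp]; rfl⟩

/-- Handles stand for themselves at cost one. This yields width bounds and fuel-independent runs for
a program that keeps its oracle, as the densifier does. -/
theorem simulates_self {O : Oracle} {B : ℕ}
    (h : ∀ k v, ∀ w, some w ∈ (O k v).support → w.width ≤ B) : Simulates O O Val.orc 1 B := by
  intro k v _ hn
  obtain ⟨μ, hμ⟩ := exists_map_some (O k v) (by simpa [PMF.mem_support_iff] using hn)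
  refine ⟨μ, hμ, fun w hw => ⟨subst_orc w, h k v w ?_⟩, ?_⟩
  · rw [hμ, PMF.support_map]; exact ⟨w, hw, rfl⟩
  · rw [subst_orc]; exact callRuns_orc hμ

/-- A run without oracles, transported to any oracle and any substitution. -/
theorem callRuns_of_noOracle {T B : ℕ} {f a : Val} {μ : PMF Val} (hf : f.width ≤ B)
    (ha : a.width ≤ B) (hT : T ≤ B) (h : exec noOracle T f a = μ.map some) :
    (∀ v ∈ μ.support, v.width ≤ B) ∧ ∀ (O : Oracle) (σ : ℕ → Val), (∀ k, (σ k).IsFn) →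
      CallRuns O (f.subst σ) (a.subst σ) (T + 1) (μ.map (Val.subst σ)) := by
  refine ⟨(callRuns_of_exec (σ := Val.orc) (fun _ => trivial)
    (simulates_noOracle noOracle _ B) hf ha hT h).1, fun O σ hσ => ?_⟩
  simpa using (callRuns_of_exec hσ (simulates_noOracle O σ B) hf ha hT h).2

theorem map_subst_orc (μ : PMF Val) : μ.map (Val.subst Val.orc) = μ := by
  have : Val.subst Val.orc = id := funext subst_orc
  rw [this, PMF.map_id]

theorem callRuns_of_noOracle' {T : ℕ} {f a : Val} {μ : PMF Val}
    (h : exec noOracle T f a = μ.map some) (O : Oracle) : CallRuns O f a (T + 1) μ := by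
  have := (callRuns_of_noOracle (B := max T (max f.width a.width)) (by simp) (by simp) (by simp)
    h).2 O Val.orc (fun _ => trivial)
  rwa [subst_orc, subst_orc, map_subst_orc] at this

/-! ### Straight-line code -/

/-- The value of a term without applications and coin flips. -/
def den : Code → Val → Val
  | .var i, e => Val.lookup i e
  | .lit z, _ => .int z
  | .lam b, e => .clo b e
  | .proc b, _ => .clo b (.int 0)
  | .app _ _, _ => .int 0
  | .pair a b, e => .pair (den a e) (den b e)
  | .fst a, e => (den a e).fst
  | .snd a, e => (den a e).snd
  | .isPair a, e => Val.bit (den a e).isPair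
  | .ite c t f, e => if (den c e).truthy then den t e else den f e
  | .arith o a b, e => .int (o.apply (den a e).toInt (den b e).toInt)
  | .flip, _ => .int 0

/-- Neither applications nor coin flips (outside of function bodies). -/
def simple : Code → Bool
  | .app _ _ => false
  | .flip => false
  | .pair a b => simple a && simple b
  | .fst a => simple a
  | .snd a => simple a
  | .isPair a => simple a
  | .ite c t f => simple c && simple t && simple f
  | .arith _ a b => simple a && simple b
  | _ => true

/-- The size of a term, function bodies not included. -/
def sz : Code → ℕ
  | .var i => i + 3
  | .lit z => z.natAbs + 3
  | .lam _ => 3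
  | .proc _ => 3
  | .app a b => sz a + sz b + 3
  | .pair a b => sz a + sz b + 3
  | .fst a => sz a + 3
  | .snd a => sz a + 3
  | .isPair a => sz a + 3
  | .ite c t f => sz c + sz t + sz f + 3
  | .arith _ a b => sz a + sz b + 3
  | .flip => 3

theorem three_le_sz (t : Code) : 3 ≤ sz t := by
  cases t <;> simp [sz]

theorem Runs.mono {O : Oracle} {env : Val} {t : Code} {B B' : ℕ} {μ : PMF Val}
    (h : Runs O env t B μ) (hB : B ≤ B') : Runs O env t B' μ := HasRun.mono h hB

theorem CallRuns.mono {O : Oracle} {f a : Val} {B B' : ℕ} {μ : PMF Val}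
    (h : CallRuns O f a B μ) (hB : B ≤ B') : CallRuns O f a B' μ := HasRun.mono h hB

theorem runs_ret {O : Oracle} {env : Val} {t : Code} {v : Val} {c B : ℕ}
    (h : ∀ d, eval O (d + 1) env t = ret v c) (hB : c + 1 ≤ B) : Runs O env t B (PMF.pure v) :=
  (HasRun.succ (e' := fun _ => ret v c) h (HasRun.ret v c)).mono hB

theorem runs_unary {O : Oracle} {env a' v : Val} {t a : Code} {c B : ℕ} (g : Val → PMF Outcome)
    (h : ∀ d, eval O (d + 1) env t = andThen (eval O d env a) g)
    (ha : Runs O env a c (PMF.pure a')) (hg : g a' = ret v 1)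
    (hB : c + 2 ≤ B) : Runs O env t B (PMF.pure v) := by
  have h1 := HasRun.andThen (k := fun _ => g) (B' := 1) (κ := fun _ => PMF.pure v) ha (by
    simp only [PMF.support_pure, Set.mem_singleton_iff, forall_eq, hg]
    exact HasRun.ret v 1)
  rw [PMF.pure_bind] at h1
  exact (HasRun.succ h h1).mono hB

theorem runs_binary {O : Oracle} {env va vb v : Val} {t a b : Code} {ca cb c B : ℕ}
    (g : Val → Val → PMF Outcome)
    (h : ∀ d, eval O (d + 1) env t =
      andThen (eval O d env a) fun x => andThen (eval O d env b) fun y => g x y)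
    (ha : Runs O env a ca (PMF.pure va)) (hb : Runs O env b cb (PMF.pure vb))
    (hg : g va vb = ret v c) (hB : ca + cb + c + 1 ≤ B) : Runs O env t B (PMF.pure v) := by
  have h1 := HasRun.andThen (k := fun d x => andThen (eval O d env b) fun y => g x y)
    (B' := cb + c) (κ := fun _ => PMF.pure v) ha (by
      simp only [PMF.support_pure, Set.mem_singleton_iff, forall_eq]
      have h2 := HasRun.andThen (k := fun _ y => g va y) (B' := c) (κ := fun _ => PMF.pure v) hb (by
        simp only [PMF.support_pure, Set.mem_singleton_iff, forall_eq, hg]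
        exact HasRun.ret v c)
      rwa [PMF.pure_bind] at h2)
  rw [PMF.pure_bind] at h1
  exact (HasRun.succ h h1).mono (by omega)

theorem runs_ite {O : Oracle} {env v : Val} {c t e : Code} {k B : ℕ} {μ : PMF Val}
    (hc : Runs O env c k (PMF.pure v))
    (h : Runs O env (if v.truthy then t else e) B μ) : Runs O env (.ite c t e) (k + B + 2) μ := by
  have h1 := HasRun.andThen (k := fun d (v : Val) => andThen (ret (.int 0) 1) fun _ =>
    eval O d env (if v.truthy then t else e)) (B' := 1 + B) (κ := fun _ => μ) hc (by
      simp only [PMF.support_pure, Set.mem_singleton_iff, forall_eq]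
      have h2 := HasRun.andThen (e := fun _ => ret (.int 0) 1)
        (k := fun d _ => eval O d env (if v.truthy then t else e)) (κ := fun _ => μ)
        (HasRun.ret (.int 0) 1) (fun _ _ => h)
      rwa [PMF.pure_bind] at h2)
  rw [PMF.pure_bind] at h1
  exact (HasRun.succ (fun d => rfl) h1).mono (by omega)

/-- An arithmetic operation adds one bit to the sum of the widths of its operands, so every value
has at most `sz t * (L + 1)` bits. There are at most `sz t` operations and each costs about that
much, hence the square. -/
theorem runs_simple (O : Oracle) {t : Code} (ht : simple t = true) {env : Val} {L : ℕ}
    (hL : env.width ≤ L) :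
    Runs O env t (sz t ^ 2 * (L + 1)) (PMF.pure (den t env)) ∧
      (den t env).width ≤ sz t * (L + 1) := by
  induction t with
  | var i =>
    refine ⟨runs_ret (c := i + 1) (fun d => rfl) ?_, ?_⟩
    · simp only [sz]; nlinarith
    · refine (width_lookup i env).trans (hL.trans ?_)
      simp only [sz]; nlinarith
  | lit z =>
    have hz : z.natAbs.size ≤ z.natAbs := Nat.size_le.2 Nat.lt_two_pow_self
    refine ⟨runs_ret (c := z.natAbs.size + 1) (fun d => rfl) ?_, ?_⟩
    · simp only [sz]; nlinarith
    · simp only [sz, den, Val.width]; nlinarith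
  | lam b =>
    refine ⟨runs_ret (c := 1) (fun d => rfl) ?_, ?_⟩
    · simp only [sz]; nlinarith
    · simp only [sz, den, Val.width]; nlinarith
  | proc b =>
    refine ⟨runs_ret (c := 1) (fun d => rfl) ?_, ?_⟩
    · simp only [sz]; nlinarith
    · simp [sz, den, Val.width]
  | app f a => simp [simple] at ht
  | flip => simp [simple] at ht
  | pair a b iha ihb =>
    simp only [simple, Bool.and_eq_true] at ht
    obtain ⟨a1, a2⟩ := iha ht.1
    obtain ⟨b1, b2⟩ := ihb ht.2
    refine ⟨runs_binary (fun x y => ret (.pair x y) 1) (fun d => rfl) a1 b1 rfl ?_, ?_⟩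
    · simp only [sz]; nlinarith
    · simp only [sz, den, Val.width]
      refine max_le (a2.trans ?_) (b2.trans ?_) <;> nlinarith
  | fst a iha =>
    obtain ⟨a1, a2⟩ := iha ht
    refine ⟨runs_unary (fun v => ret v.fst 1) (fun d => rfl) a1 rfl ?_, ?_⟩
    · simp only [sz]; nlinarith
    · refine (width_fst _).trans (a2.trans ?_)
      simp only [sz]; nlinarith
  | snd a iha =>
    obtain ⟨a1, a2⟩ := iha ht
    refine ⟨runs_unary (fun v => ret v.snd 1) (fun d => rfl) a1 rfl ?_, ?_⟩
    · simp only [sz]; nlinarith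
    · refine (width_snd _).trans (a2.trans ?_)
      simp only [sz]; nlinarith
  | isPair a iha =>
    obtain ⟨a1, a2⟩ := iha ht
    refine ⟨runs_unary (fun v => ret (Val.bit v.isPair) 1) (fun d => rfl) a1 rfl ?_, ?_⟩
    · simp only [sz]; nlinarith
    · refine (width_bit _).trans ?_
      simp only [sz]; nlinarith
  | ite c t e ihc iht ihe =>
    simp only [simple, Bool.and_eq_true] at ht
    obtain ⟨c1, c2⟩ := ihc ht.1.1
    obtain ⟨t1, t2⟩ := iht ht.1.2
    obtain ⟨e1, e2⟩ := ihe ht.2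
    have h0 := three_le_sz c
    refine ⟨?_, ?_⟩
    · have : Runs O env (if (den c env).truthy then t else e)
          ((sz t ^ 2 + sz e ^ 2) * (L + 1)) (PMF.pure (den (.ite c t e) env)) := by
        simp only [den]
        split
        · exact t1.mono (Nat.mul_le_mul_right _ (by omega))
        · exact e1.mono (Nat.mul_le_mul_right _ (by omega))
      refine (runs_ite c1 this).mono ?_
      have : sz c ^ 2 + sz t ^ 2 + sz e ^ 2 + 2 ≤ (sz c + sz t + sz e + 3) ^ 2 := by nlinarith
      simp only [sz]
      nlinarith
    · simp only [den, sz]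
      split
      · exact t2.trans (Nat.mul_le_mul_right _ (by omega))
      · exact e2.trans (Nat.mul_le_mul_right _ (by omega))
  | arith o a b iha ihb =>
    simp only [simple, Bool.and_eq_true] at ht
    obtain ⟨a1, a2⟩ := iha ht.1
    obtain ⟨b1, b2⟩ := ihb ht.2
    have a3 := (size_toInt (den a env)).trans a2
    have b3 := (size_toInt (den b env)).trans b2
    refine ⟨runs_binary (fun x y => ret (.int (o.apply x.toInt y.toInt))
      (1 + x.toInt.natAbs.size + y.toInt.natAbs.size)) (fun d => rfl) a1 b1 rfl ?_, ?_⟩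
    · have : sz a ^ 2 + sz b ^ 2 + sz a + sz b + 2 ≤ (sz a + sz b + 3) ^ 2 := by nlinarith
      simp only [sz]
      nlinarith
    · refine (size_arith o _ _).trans ?_
      simp only [sz]
      nlinarith

/-! ### Rules for programs -/

/-- Bind the value of `s` as variable `0` in `t`; the other variables are shifted by two. -/
def let_ (s t : Code) : Code := .app (.lam t) s

theorem runs_app {O : Oracle} {env : Val} {f a : Code} {L B : ℕ} {μ : PMF Val}
    (hf : simple f = true) (ha : simple a = true) (hL : env.width ≤ L)
    (h : CallRuns O (den f env) (den a env) B μ) :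
    Runs O env (.app f a) (B + sz (.app f a) ^ 2 * (L + 1)) μ := by
  obtain ⟨f1, -⟩ := runs_simple O hf hL
  obtain ⟨a1, -⟩ := runs_simple O ha hL
  have h1 := HasRun.andThen (k := fun d vf => andThen (eval O d env a) fun va =>
    andThen (ret (.int 0) 1) fun _ => call (eval O d) O vf va)
    (B' := sz a ^ 2 * (L + 1) + (1 + B)) (κ := fun _ => μ) f1 (by
      simp only [PMF.support_pure, Set.mem_singleton_iff, forall_eq]
      have h2 := HasRun.andThen (k := fun d va => andThen (ret (.int 0) 1) fun _ =>
        call (eval O d) O (den f env) va) (B' := 1 + B) (κ := fun _ => μ) a1 (by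
          simp only [PMF.support_pure, Set.mem_singleton_iff, forall_eq]
          have h3 := HasRun.andThen (e := fun _ => ret (.int 0) 1)
            (k := fun d _ => call (eval O d) O (den f env) (den a env)) (κ := fun _ => μ)
            (HasRun.ret (.int 0) 1) (fun _ _ => h)
          rwa [PMF.pure_bind] at h3)
      rwa [PMF.pure_bind] at h2)
  rw [PMF.pure_bind] at h1
  refine (HasRun.succ (fun d => rfl) h1).mono ?_
  have : sz f ^ 2 + sz a ^ 2 + 2 ≤ (sz f + sz a + 3) ^ 2 := by
    nlinarith [Nat.zero_le (sz f * sz a)]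
  simp only [sz]
  nlinarith

theorem runs_let {O : Oracle} {env : Val} {s t : Code} {B B' : ℕ} {μ : PMF Val}
    {κ : Val → PMF Val} (hs : Runs O env s B μ)
    (ht : ∀ v ∈ μ.support, Runs O (.pair v (.pair (.clo t env) env)) t B' (κ v)) :
    Runs O env (let_ s t) (B + B' + 4) (μ.bind κ) := by
  have h1 : Runs O env (.lam t) 2 (PMF.pure (.clo t env)) := runs_ret (c := 1) (fun _ => rfl) le_rfl
  have h2 := HasRun.andThen (k := fun d vf => andThen (eval O d env s) fun va =>
    andThen (ret (.int 0) 1) fun _ => call (eval O d) O vf va)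
    (B' := B + (1 + B')) (κ := fun _ => μ.bind κ) h1 (by
      simp only [PMF.support_pure, Set.mem_singleton_iff, forall_eq]
      refine HasRun.andThen (k := fun d va => andThen (ret (.int 0) 1) fun _ =>
        call (eval O d) O (.clo t env) va) (B' := 1 + B') hs fun v hv => ?_
      have h3 := HasRun.andThen (e := fun _ => ret (.int 0) 1)
        (k := fun d _ => call (eval O d) O (.clo t env) v) (κ := fun _ => κ v)
        (HasRun.ret (.int 0) 1) (fun _ _ => ht v hv)
      rwa [PMF.pure_bind] at h3)
  rw [PMF.pure_bind] at h2
  exact (HasRun.succ (fun d => rfl) h2).mono (by omega)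

theorem runs_if {O : Oracle} {env : Val} {c t e : Code} {L B : ℕ} {μ : PMF Val}
    (hc : simple c = true) (hL : env.width ≤ L)
    (h : Runs O env (if (den c env).truthy then t else e) B μ) :
    Runs O env (.ite c t e) (B + (sz c + 3) ^ 2 * (L + 1)) μ := by
  refine (runs_ite (runs_simple O hc hL).1 h).mono ?_
  have : sz c ^ 2 + 2 ≤ (sz c + 3) ^ 2 := by nlinarith [Nat.zero_le (sz c)]
  have := Nat.mul_le_mul_right (L + 1) this
  rw [add_mul] at this
  omega

/-- Short straight-line code. -/
def short (t : Code) : Bool := simple t && decide (sz t ≤ 1024)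

/-- `1027 ^ 2` is below `2 ^ 21`, far below the threshold for `L`, so the cost of a short term
disappears in `L ^ 2`. The number 1027 is the limit 1024 of `short` plus the 3 charged for a
branching. -/
theorem sq_bound {L s : ℕ} (hL : 2 ^ 30 ≤ L) (hs : s ≤ 1027) : s ^ 2 * (L + 1) ≤ L ^ 2 := by
  have h1 : s ^ 2 ≤ 2 ^ 21 := (Nat.pow_le_pow_left hs 2).trans (by norm_num)
  nlinarith [Nat.mul_le_mul_right (L + 1) h1]

theorem runs_short {O : Oracle} {env v : Val} {t : Code} {L : ℕ} (hL : 2 ^ 30 ≤ L)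
    (hw : env.width ≤ L) (ht : short t = true) (hv : den t env = v) :
    Runs O env t (L ^ 2) (PMF.pure v) := by
  simp only [short, Bool.and_eq_true, decide_eq_true_eq] at ht
  rw [← hv]
  exact (runs_simple O ht.1 hw).1.mono (sq_bound hL (by omega))

theorem runs_call {O : Oracle} {env vf va : Val} {f a : Code} {L B : ℕ} {μ : PMF Val}
    (hL : 2 ^ 30 ≤ L) (hw : env.width ≤ L) (ht : short (.pair f a) = true)
    (hf : den f env = vf) (ha : den a env = va) (h : CallRuns O vf va B μ) :
    Runs O env (.app f a) (B + L ^ 2) μ := by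
  simp only [short, simple, Bool.and_eq_true, decide_eq_true_eq] at ht
  refine (runs_app ht.1.1 ht.1.2 hw (hf ▸ ha ▸ h)).mono (Nat.add_le_add_left (sq_bound hL ?_) _)
  have : sz (.app f a) = sz (.pair f a) := rfl
  omega

theorem runs_cond {O : Oracle} {env v : Val} {c t e : Code} {L B : ℕ} {μ : PMF Val}
    (hL : 2 ^ 30 ≤ L) (hw : env.width ≤ L) (hs : short c = true) (hc : den c env = v)
    (h : Runs O env (if v.truthy then t else e) B μ) :
    Runs O env (.ite c t e) (B + L ^ 2) μ := by
  simp only [short, Bool.and_eq_true, decide_eq_true_eq] at hs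
  exact (runs_if hs.1 hw (hc ▸ h)).mono (Nat.add_le_add_left (sq_bound hL (by omega)) _)

theorem runs_then {O : Oracle} {env : Val} {c t e : Code} {L B : ℕ} {μ : PMF Val}
    (hL : 2 ^ 30 ≤ L) (hw : env.width ≤ L) (hs : short c = true) (hc : (den c env).truthy = true)
    (h : Runs O env t B μ) : Runs O env (.ite c t e) (B + L ^ 2) μ :=
  runs_cond hL hw hs rfl (by rwa [if_pos hc])

theorem runs_else {O : Oracle} {env : Val} {c t e : Code} {L B : ℕ} {μ : PMF Val}
    (hL : 2 ^ 30 ≤ L) (hw : env.width ≤ L) (hs : short c = true) (hc : (den c env).truthy = false)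
    (h : Runs O env e B μ) : Runs O env (.ite c t e) (B + L ^ 2) μ :=
  runs_cond hL hw hs rfl (by rwa [if_neg (by simp [hc])])

theorem runs_let_pure {O : Oracle} {env v : Val} {s t : Code} {B B' : ℕ} {μ : PMF Val}
    (hs : Runs O env s B (PMF.pure v))
    (ht : Runs O (.pair v (.pair (.clo t env) env)) t B' μ) :
    Runs O env (let_ s t) (B + B' + 4) μ := by
  have := runs_let (κ := fun _ => μ) hs (by simpa using ht)
  rwa [PMF.pure_bind] at this

/-- The decoder `i` recovers the mathematical sample from its encoding, so that the continuation is
indexed by samples and not by values. -/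
theorem runs_let_map {α : Type} {O : Oracle} {env : Val} {s t : Code} {B B' : ℕ} {P : PMF α}
    {e : α → Val} {κ : α → PMF Val} {i : Val → α} (hi : ∀ a, i (e a) = a)
    (hs : Runs O env s B (P.map e))
    (ht : ∀ a ∈ P.support, Runs O (.pair (e a) (.pair (.clo t env) env)) t B' (κ a)) :
    Runs O env (let_ s t) (B + B' + 4) (P.bind κ) := by
  have h := runs_let (κ := fun v => κ (i v)) (B' := B') hs (by
    intro v hv
    rw [PMF.support_map] at hv
    obtain ⟨a, ha, rfl⟩ := hv
    rw [hi]
    exact ht a ha)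
  rw [PMF.bind_map] at h
  simpa only [Function.comp_def, hi] using h

theorem width_let {v env : Val} {t : Code} {L : ℕ} (hv : v.width ≤ L) (he : env.width ≤ L) :
    (Val.pair v (.pair (.clo t env) env)).width ≤ L := by
  simp only [Val.width]
  omega

/-! ### Domination of runs under dominated oracles -/

/-- Every outcome of `p` of cost `c` has under `p'` at least `θ ^ c` times its probability. -/
def Dom (θ : ℝ≥0∞) (p' p : PMF Outcome) : Prop :=
  ∀ v c, θ ^ c * p (some (v, c)) ≤ p' (some (v, c))

theorem Dom.refl {θ : ℝ≥0∞} (hθ : θ ≤ 1) (p : PMF Outcome) : Dom θ p p := fun _ c =>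
  (mul_le_mul_left (pow_le_one' hθ c) _).trans (one_mul _).le

theorem map_shift_apply (p : PMF Outcome) (c₁ : ℕ) (w : Val) (c : ℕ) :
    (p.map (Option.map fun w => (w.1, c₁ + w.2))) (some (w, c)) =
      if c₁ ≤ c then p (some (w, c - c₁)) else 0 := by
  rw [PMF.map_apply]
  split
  · rename_i hc
    rw [tsum_eq_single (some (w, c - c₁))]
    · simp [hc]
    · intro o ho
      rw [if_neg]
      rintro h
      cases o with
      | none => simp at h
      | some u =>
        obtain ⟨u1, u2⟩ := u
        simp only [Option.map_some, Option.some.injEq, Prod.mk.injEq] at h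
        apply ho
        rw [h.1, h.2]
        simp
  · rename_i hc
    rw [ENNReal.tsum_eq_zero]
    intro o
    rw [if_neg]
    rintro h
    cases o with
    | none => simp at h
    | some u =>
      simp only [Option.map_some, Option.some.injEq, Prod.mk.injEq] at h
      omega

/-- A total cost `c` splits as `c₁ + (c - c₁)`, and `θ ^ c` factors accordingly; the comparison then
holds term by term. -/
theorem Dom.andThen {θ : ℝ≥0∞} {p p' : PMF Outcome} {k k' : Val → PMF Outcome}
    (h : Dom θ p' p) (hk : ∀ v, Dom θ (k' v) (k v)) :
    Dom θ (andThen p' k') (InvGen.andThen p k) := by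
  intro w c
  unfold InvGen.andThen
  rw [PMF.bind_apply, PMF.bind_apply, ← ENNReal.tsum_mul_left]
  refine ENNReal.tsum_le_tsum fun o => ?_
  cases o with
  | none => simp
  | some u =>
    obtain ⟨v, c₁⟩ := u
    simp only [map_shift_apply]
    split
    · rename_i hc
      calc θ ^ c * (p (some (v, c₁)) * (k v) (some (w, c - c₁)))
          = (θ ^ c₁ * p (some (v, c₁))) * (θ ^ (c - c₁) * (k v) (some (w, c - c₁))) := by
            conv_lhs => rw [← Nat.add_sub_cancel' hc, pow_add]
            rw [Nat.add_sub_cancel']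
            · ring
            · exact hc
        _ ≤ _ := mul_le_mul' (h v c₁) (hk v w (c - c₁))
    · simp

/-- An oracle call has cost exactly one, which pays for the one factor `θ` that it loses. Nothing
else changes with the oracle. -/
theorem call_dom {θ : ℝ≥0∞} (hθ : θ ≤ 1) {O O' : Oracle}
    (hO : ∀ k v w, θ * O k v (some w) ≤ O' k v (some w)) {ev ev' : Val → Code → PMF Outcome}
    (h : ∀ env t, Dom θ (ev' env t) (ev env t)) (f a : Val) :
    Dom θ (call ev' O' f a) (call ev O f a) := by
  cases f with
  | clo body env => exact h _ _
  | orc k =>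
    intro v c
    simp only [call, PMF.map_apply]
    rw [← ENNReal.tsum_mul_left]
    refine ENNReal.tsum_le_tsum fun o => ?_
    split
    · rename_i he
      cases o with
      | none => simp at he
      | some u =>
        simp only [Option.map_some, Option.some.injEq, Prod.mk.injEq] at he
        rw [he.2, pow_one]
        exact hO k a u
    · simp
  | int z => exact Dom.refl hθ _
  | pair x y => exact Dom.refl hθ _

theorem eval_dom {θ : ℝ≥0∞} (hθ : θ ≤ 1) {O O' : Oracle}
    (hO : ∀ k v w, θ * O k v (some w) ≤ O' k v (some w)) (d : ℕ) :
    ∀ env t, Dom θ (eval O' d env t) (eval O d env t) := by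
  induction d with
  | zero => exact fun env t => Dom.refl hθ _
  | succ d ih =>
    intro env t
    have R : ∀ p, Dom θ p p := Dom.refl hθ
    cases t with
    | var i => exact R _
    | lit z => exact R _
    | lam b => exact R _
    | proc b => exact R _
    | flip => exact R _
    | app f a =>
      exact (ih env f).andThen fun vf => (ih env a).andThen fun va => (R _).andThen fun _ =>
        call_dom hθ hO ih vf va
    | pair a b => exact (ih env a).andThen fun va => (ih env b).andThen fun vb => R _
    | fst a => exact (ih env a).andThen fun v => R _
    | snd a => exact (ih env a).andThen fun v => R _
    | isPair a => exact (ih env a).andThen fun v => R _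
    | ite c t e => exact (ih env c).andThen fun v => (R _).andThen fun _ => ih env _
    | arith o a b => exact (ih env a).andThen fun va => (ih env b).andThen fun vb => R _

/-- A run of at most `T` steps calls the oracle at most `T` times and loses a factor `θ` at each
call. -/
theorem exec_dom {θ : ℝ≥0∞} (hθ : θ ≤ 1) {O O' : Oracle}
    (hO : ∀ k v w, θ * O k v (some w) ≤ O' k v (some w)) (T : ℕ) (f a v : Val) :
    θ ^ T * exec O T f a (some v) ≤ exec O' T f a (some v) := by
  have h := call_dom hθ hO (eval_dom hθ hO T) f a
  unfold exec
  rw [PMF.map_apply, PMF.map_apply, ← ENNReal.tsum_mul_left]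
  refine ENNReal.tsum_le_tsum fun o => ?_
  cases o with
  | none => simp
  | some u =>
    obtain ⟨w, c⟩ := u
    by_cases hc : c ≤ T
    · by_cases hv : v = w
      · simp only [hc, if_true, hv]
        exact (mul_le_mul_left (pow_le_pow_right_of_le_one' hθ hc) _).trans (h w c)
      · have : some v ≠ if c ≤ T then some w else none := by simp [hc, hv]
        simp only [this, if_false, mul_zero, le_refl]
    · simp [hc]

/-! ### Probabilities of events -/

theorem outer_le_one {α : Type} (p : PMF α) (E : Set α) : p.toOuterMeasure E ≤ 1 := by
  rw [PMF.toOuterMeasure_apply, ← p.tsum_coe]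
  exact ENNReal.tsum_le_tsum fun a => Set.indicator_le_self _ _ _

theorem outer_ne_top {α : Type} (p : PMF α) (E : Set α) : p.toOuterMeasure E ≠ ⊤ :=
  ((outer_le_one p E).trans_lt ENNReal.one_lt_top).ne

theorem prob_nonneg {α : Type} (p : PMF α) (E : Set α) : 0 ≤ prob p E := ENNReal.toReal_nonneg

theorem prob_mono {α : Type} (p : PMF α) {E F : Set α} (h : E ⊆ F) : prob p E ≤ prob p F :=
  ENNReal.toReal_mono (outer_ne_top p F) (p.toOuterMeasure.mono h)

theorem prob_mono_support {α : Type} (p : PMF α) {E F : Set α}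
    (h : ∀ a ∈ p.support, a ∈ E → a ∈ F) : prob p E ≤ prob p F := by
  refine ENNReal.toReal_mono (outer_ne_top p F) (PMF.toOuterMeasure_mono p ?_)
  exact fun a ha => h a ha.2 ha.1

theorem prob_compl {α : Type} (p : PMF α) (E : Set α) : prob p Eᶜ = 1 - prob p E := by
  have h : p.toOuterMeasure E + p.toOuterMeasure Eᶜ = 1 := by
    rw [PMF.toOuterMeasure_apply, PMF.toOuterMeasure_apply, ← ENNReal.tsum_add, ← p.tsum_coe]
    refine tsum_congr fun a => ?_
    by_cases ha : a ∈ E <;> simp [ha]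
  have := congrArg ENNReal.toReal h
  rw [ENNReal.toReal_add (outer_ne_top p E) (outer_ne_top p _), ENNReal.toReal_one] at this
  unfold prob
  linarith

theorem prob_map {α β : Type} (p : PMF α) (f : α → β) (E : Set β) :
    prob (p.map f) E = prob p (f ⁻¹' E) := by
  unfold prob
  rw [PMF.toOuterMeasure_map_apply]

theorem prob_pure {α : Type} (a : α) (E : Set α) [Decidable (a ∈ E)] :
    prob (PMF.pure a) E = if a ∈ E then 1 else 0 := by
  unfold prob
  rw [PMF.toOuterMeasure_pure_apply]
  split <;> simp

theorem prob_singleton {α : Type} (p : PMF α) (a : α) : prob p {a} = (p a).toReal := by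
  unfold prob
  rw [PMF.toOuterMeasure_apply_singleton]

/-- Union bound along a sequential composition. -/
theorem prob_bind_le {α β : Type} (p : PMF α) (k : α → PMF β) (E : Set β) (bad : Set α)
    {δ ε : ℝ} (hε : 0 ≤ ε) (hbad : prob p bad ≤ δ)
    (h : ∀ a ∈ p.support, a ∉ bad → prob (k a) E ≤ ε) : prob (p.bind k) E ≤ δ + ε := by
  have h1 : (p.bind k).toOuterMeasure E ≤ p.toOuterMeasure bad + ENNReal.ofReal ε := by
    rw [PMF.toOuterMeasure_bind_apply, PMF.toOuterMeasure_apply]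
    calc _ ≤ ∑' a, (bad.indicator p a + p a * ENNReal.ofReal ε) := by
          refine ENNReal.tsum_le_tsum fun a => ?_
          by_cases ha : a ∈ bad
          · rw [Set.indicator_of_mem ha]
            refine le_trans ?_ le_self_add
            exact (mul_le_mul_right (outer_le_one _ _) _).trans (mul_one _).le
          · by_cases hs : a ∈ p.support
            · refine le_trans (mul_le_mul_right ?_ _) le_add_self
              rw [ENNReal.le_ofReal_iff_toReal_le (outer_ne_top _ _) hε]
              exact h a hs ha
            · have : p a = 0 := by simpa [PMF.mem_support_iff] using hs
              simp [this]
      _ = _ := by rw [ENNReal.tsum_add, ENNReal.tsum_mul_right, p.tsum_coe, one_mul]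
  have h2 := ENNReal.toReal_mono (by simp [outer_ne_top]) h1
  rw [ENNReal.toReal_add (outer_ne_top p bad) (by simp), ENNReal.toReal_ofReal hε] at h2
  unfold prob at *
  linarith

theorem prob_bind_fintype {Ω β : Type} [Fintype Ω] (P : PMF Ω) (k : Ω → PMF β) (E : Set β) :
    prob (P.bind k) E = ∑ ω, (P ω).toReal * prob (k ω) E := by
  unfold prob
  rw [PMF.toOuterMeasure_bind_apply, tsum_fintype, ENNReal.toReal_sum]
  · simp
  · intro ω _
    exact ENNReal.mul_ne_top (P.apply_ne_top ω) (outer_ne_top _ _)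

theorem sum_toReal {Ω : Type} [Fintype Ω] (P : PMF Ω) : ∑ ω, (P ω).toReal = 1 := by
  rw [← ENNReal.toReal_sum (fun ω _ => P.apply_ne_top ω), ← tsum_fintype (L := .unconditional _),
    P.tsum_coe, ENNReal.toReal_one]

theorem bind_apply_toReal {Ω β : Type} [Fintype Ω] (P : PMF Ω) (k : Ω → PMF β) (b : β) :
    ((P.bind k) b).toReal = ∑ ω, (P ω).toReal * (k ω b).toReal := by
  rw [← prob_singleton, prob_bind_fintype]
  simp [prob_singleton]

/-! ### Sums of independent variables -/

/-- The distribution of `s` plus the sum of `k` independent copies of `X`. -/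
def iidSum {Ω : Type} (P : PMF Ω) (X : Ω → ℤ × ℤ) : ℕ → ℤ × ℤ → PMF (ℤ × ℤ)
  | 0, s => PMF.pure s
  | k + 1, s => P.bind fun ω => iidSum P X k (s + X ω)

/-- Uses `exp y ≤ 1 + y + y ^ 2` for `|y| ≤ 1`. The linear term has mean zero, and `1 + x ≤ exp x`
closes the estimate. -/
theorem mgf_le {Ω : Type} [Fintype Ω] (P : PMF Ω) (Y : Ω → ℝ) {c l : ℝ}
    (hY : ∀ ω, |Y ω| ≤ c) (h0 : ∑ ω, (P ω).toReal * Y ω = 0) (hl : 0 ≤ l) (hlc : l * c ≤ 1) :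
    ∑ ω, (P ω).toReal * Real.exp (l * Y ω) ≤ Real.exp (l ^ 2 * c ^ 2) := by
  have h1 : ∀ ω, (P ω).toReal * Real.exp (l * Y ω) ≤
      (P ω).toReal * (1 + l ^ 2 * c ^ 2) + l * ((P ω).toReal * Y ω) := by
    intro ω
    have hb : |l * Y ω| ≤ l * c := by
      rw [abs_mul, abs_of_nonneg hl]
      exact mul_le_mul_of_nonneg_left (hY ω) hl
    have h2 := (abs_le.1 (Real.abs_exp_sub_one_sub_id_le (hb.trans hlc))).2
    have h3 : (l * Y ω) ^ 2 ≤ l ^ 2 * c ^ 2 := by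
      rw [← mul_pow, ← sq_abs]
      exact pow_le_pow_left₀ (abs_nonneg _) hb 2
    have : (P ω).toReal * Real.exp (l * Y ω) ≤ (P ω).toReal * (1 + l * Y ω + l ^ 2 * c ^ 2) :=
      mul_le_mul_of_nonneg_left (by linarith) ENNReal.toReal_nonneg
    linarith
  calc _ ≤ ∑ ω, ((P ω).toReal * (1 + l ^ 2 * c ^ 2) + l * ((P ω).toReal * Y ω)) :=
        Finset.sum_le_sum fun ω _ => h1 ω
    _ = 1 + l ^ 2 * c ^ 2 := by
        rw [Finset.sum_add_distrib, ← Finset.sum_mul, ← Finset.mul_sum, h0, sum_toReal]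
        ring
    _ ≤ _ := by linarith [Real.add_one_le_exp (l ^ 2 * c ^ 2)]

/-- Chernoff's method along the recursion: conditioning on the first summand moves the start to `s +
X ω` and the threshold by `e`. The exponential bound for the remaining sum splits off one moment
generating factor. -/
theorem iidSum_upper_tail {Ω : Type} [Fintype Ω] (P : PMF Ω) (X : Ω → ℤ × ℤ) (f : ℤ × ℤ → ℝ)
    (hf : ∀ s t, f (s + t) = f s + f t) {c l e : ℝ} (he : ∑ ω, (P ω).toReal * f (X ω) = e)
    (hc : ∀ ω, |f (X ω) - e| ≤ c) (hl : 0 ≤ l) (hlc : l * c ≤ 1) (k : ℕ) (s : ℤ × ℤ) (τ : ℝ) :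
    prob (iidSum P X k s) {u | τ ≤ f u - k * e} ≤
      Real.exp (l * (f s - τ)) * Real.exp (l ^ 2 * c ^ 2) ^ k := by
  induction k generalizing s τ with
  | zero =>
    classical
    simp only [iidSum, prob_pure, Set.mem_ofPred_eq, Nat.cast_zero, zero_mul, sub_zero, pow_zero,
      mul_one]
    split
    · rename_i h
      exact Real.one_le_exp (mul_nonneg hl (by linarith))
    · exact (Real.exp_pos _).le
  | succ k ih =>
    rw [iidSum, prob_bind_fintype]
    have hY0 : ∑ ω, (P ω).toReal * (f (X ω) - e) = 0 := by
      simp only [mul_sub, Finset.sum_sub_distrib, ← Finset.sum_mul, sum_toReal, he]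
      ring
    calc _ ≤ ∑ ω, (P ω).toReal * (Real.exp (l * (f (s + X ω) - (τ + e))) *
          Real.exp (l ^ 2 * c ^ 2) ^ k) := by
          refine Finset.sum_le_sum fun ω _ => mul_le_mul_of_nonneg_left ?_ ENNReal.toReal_nonneg
          refine le_trans (le_of_eq ?_) (ih (s + X ω) (τ + e))
          congr 1
          ext u
          simp only [Set.mem_ofPred_eq, Nat.cast_succ]
          constructor <;> intro h <;> linarith
      _ = (∑ ω, (P ω).toReal * Real.exp (l * (f (X ω) - e))) * (Real.exp (l * (f s - τ)) *
          Real.exp (l ^ 2 * c ^ 2) ^ k) := by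
          rw [Finset.sum_mul]
          refine Finset.sum_congr rfl fun ω _ => ?_
          rw [hf, show l * (f s + f (X ω) - (τ + e)) = l * (f (X ω) - e) + l * (f s - τ) by ring,
            Real.exp_add]
          ring
      _ ≤ Real.exp (l ^ 2 * c ^ 2) * (Real.exp (l * (f s - τ)) *
          Real.exp (l ^ 2 * c ^ 2) ^ k) :=
          mul_le_mul_of_nonneg_right (mgf_le P _ hc hY0 hl hlc) (by positivity)
      _ = _ := by ring

/-- Hoeffding's inequality, with a constant that is not optimal. -/
theorem iidSum_tail {Ω : Type} [Fintype Ω] (P : PMF Ω) (X : Ω → ℤ × ℤ) (f : ℤ × ℤ → ℝ)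
    (hf : ∀ s t, f (s + t) = f s + f t) {c t e : ℝ} (he : ∑ ω, (P ω).toReal * f (X ω) = e)
    (hc : ∀ ω, |f (X ω) - e| ≤ c) (hc0 : 0 < c) (ht : 0 ≤ t) (htc : t ≤ 2 * c) (k : ℕ) :
    prob (iidSum P X k 0) {u | ¬ |f u - k * e| < k * t} ≤
      2 * Real.exp (-(k * t ^ 2 / (4 * c ^ 2))) := by
  have f0 : f 0 = 0 := by have := hf 0 0; simp at this; exact this
  -- This minimises `-l t + l ^ 2 c ^ 2`; the hypothesis `htc` keeps `l * c ≤ 1`.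
  set l := t / (2 * c ^ 2) with hl
  have hl0 : 0 ≤ l := by positivity
  have hlc : l * c ≤ 1 := by
    rw [hl, div_mul_eq_mul_div, div_le_one (by positivity)]
    nlinarith
  have hb : Real.exp (l * (0 - k * t)) * Real.exp (l ^ 2 * c ^ 2) ^ k =
      Real.exp (-(k * t ^ 2 / (4 * c ^ 2))) := by
    rw [← Real.exp_nat_mul, ← Real.exp_add]
    congr 1
    rw [hl]
    field_simp
    ring
  have h1 := iidSum_upper_tail P X f hf he hc hl0 hlc k 0 (k * t)
  have h2 := iidSum_upper_tail P X (fun s => -f s) (fun s t => by simp only [hf]; ring)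
    (e := -e) (by simp [← he]) (fun ω => by
      rw [show -f (X ω) - -e = -(f (X ω) - e) by ring, abs_neg]; exact hc ω) hl0 hlc k 0 (k * t)
  simp only [f0, neg_zero] at h1 h2
  rw [hb] at h1 h2
  have hsub : {u | ¬ |f u - k * e| < k * t} ⊆
      {u | k * t ≤ f u - k * e} ∪ {u | k * t ≤ -f u - k * -e} := by
    intro u hu
    simp only [Set.mem_ofPred_eq, not_lt, le_abs] at hu
    rcases hu with hu | hu
    · exact Or.inl hu
    · refine Or.inr ?_
      simp only [Set.mem_ofPred_eq]
      linarith
  have h3 : prob (iidSum P X k 0) ({u | k * t ≤ f u - k * e} ∪ {u | k * t ≤ -f u - k * -e}) ≤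
      prob (iidSum P X k 0) {u | k * t ≤ f u - k * e} +
        prob (iidSum P X k 0) {u | k * t ≤ -f u - k * -e} := by
    unfold prob
    rw [← ENNReal.toReal_add (outer_ne_top _ _) (outer_ne_top _ _)]
    exact ENNReal.toReal_mono (by simp [outer_ne_top]) (MeasureTheory.measure_union_le _ _)
  linarith [prob_mono (iidSum P X k 0) hsub]

/-! ### Distance of distributions on the cube -/

/-- The `ℓ¹` distance, twice the total variation distance. -/
def l1 {n : ℕ} (D D' : PMF (Cube n)) : ℝ := ∑ x, |(D x).toReal - (D' x).toReal|

theorem l1_nonneg {n : ℕ} (D D' : PMF (Cube n)) : 0 ≤ l1 D D' :=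
  Finset.sum_nonneg fun _ _ => abs_nonneg _

theorem l1_le_two {n : ℕ} (D D' : PMF (Cube n)) : l1 D D' ≤ 2 := by
  calc l1 D D' ≤ ∑ x, ((D x).toReal + (D' x).toReal) := by
        refine Finset.sum_le_sum fun x _ => ?_
        have h1 : 0 ≤ (D x).toReal := ENNReal.toReal_nonneg
        have h2 : 0 ≤ (D' x).toReal := ENNReal.toReal_nonneg
        rw [abs_le]
        constructor <;> linarith
    _ = 2 := by rw [Finset.sum_add_distrib, sum_toReal, sum_toReal]; norm_num

theorem abs_expect_sub_le {n : ℕ} (D D' : PMF (Cube n)) (φ : Cube n → ℝ) {M : ℝ}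
    (hφ : ∀ x, |φ x| ≤ M) :
    |∑ x, (D x).toReal * φ x - ∑ x, (D' x).toReal * φ x| ≤ M * l1 D D' := by
  rw [← Finset.sum_sub_distrib, l1, Finset.mul_sum]
  refine (Finset.abs_sum_le_sum_abs _ _).trans (Finset.sum_le_sum fun x _ => ?_)
  rw [← sub_mul, abs_mul, mul_comm]
  exact mul_le_mul_of_nonneg_right (hφ x) (abs_nonneg _)

theorem unifSat_apply {n : ℕ} (f : Cube n → Bool) (hf : (sat f).Nonempty) (x : Cube n) :
    (unifSat f hf x).toReal = if f x then 1 / ((sat f).card : ℝ) else 0 := by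
  unfold unifSat
  rw [PMF.uniformOfFinset_apply]
  by_cases h : f x = true
  · simp [sat, h]
  · simp [sat, h]

theorem sum_unifSat {n : ℕ} (f : Cube n → Bool) (hf : (sat f).Nonempty) (φ : Cube n → ℝ) :
    ∑ x, (unifSat f hf x).toReal * φ x = (∑ x ∈ sat f, φ x) / ((sat f).card : ℝ) := by
  rw [sat, Finset.sum_filter, Finset.sum_div]
  refine Finset.sum_congr rfl fun x _ => ?_
  rw [unifSat_apply, sat]
  by_cases h : f x = true
  · simp [h]; ring
  · simp [h]

/-- A distribution that dominates all but a fraction `q` of an almost uniform one. -/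
theorem l1_unifSat_le {n : ℕ} (g : Cube n → Bool) (hg : (sat g).Nonempty) (D D' : PMF (Cube n))
    {q ε : ℝ} (hq : 0 ≤ q)
    (h0 : ∀ x, g x = false → (D x).toReal = 0)
    (h1 : ∀ x, g x = true → |(D x).toReal - 1 / ((sat g).card : ℝ)| ≤ ε / ((sat g).card : ℝ))
    (h2 : ∀ x, (1 - q) * (D x).toReal ≤ (D' x).toReal) :
    l1 D' (unifSat g hg) ≤ 2 * q + ε := by
  have hG : (0 : ℝ) < (sat g).card := by exact_mod_cast hg.card_pos
  -- The difference `D' - (1 - q) D` is nonnegative with total mass `q`, so it needs no absolute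
  -- value; the missing `q D` contributes another `q`.
  have h3 : ∀ x, |(D' x).toReal - (unifSat g hg x).toReal| ≤
      ((D' x).toReal - (1 - q) * (D x).toReal) + q * (D x).toReal +
        (unifSat g hg x).toReal * ε := by
    intro x
    have h4 : |(D x).toReal - (unifSat g hg x).toReal| ≤ (unifSat g hg x).toReal * ε := by
      rw [unifSat_apply]
      by_cases h : g x = true
      · simp only [h, if_true]
        refine (h1 x h).trans (le_of_eq ?_)
        ring
      · simp [h, h0 x (by simpa using h)]
    have h5 := abs_le.1 h4
    have h6 := h2 x
    have h7 : 0 ≤ q * (D x).toReal := mul_nonneg hq ENNReal.toReal_nonneg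
    rw [abs_le]
    constructor <;> nlinarith
  calc _ ≤ ∑ x, (((D' x).toReal - (1 - q) * (D x).toReal) + q * (D x).toReal +
        (unifSat g hg x).toReal * ε) := Finset.sum_le_sum fun x _ => h3 x
    _ = 2 * q + ε := by
        rw [Finset.sum_add_distrib, Finset.sum_add_distrib, Finset.sum_sub_distrib,
          ← Finset.mul_sum, ← Finset.mul_sum, ← Finset.sum_mul, sum_toReal, sum_toReal,
          sum_toReal]
        ring

/-- Uniform distributions on overlapping sets. -/
theorem l1_unifSat_unifSat {n : ℕ} (A f : Cube n → Bool) (hA : (sat A).Nonempty)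
    (hf : (sat f).Nonempty) {m : ℝ} (h1 : ((sat A).card : ℝ) ≤ m) (h2 : ((sat f).card : ℝ) ≤ m) :
    l1 (unifSat A hA) (unifSat f hf) ≤ 2 * (1 - ((sat A ∩ sat f).card : ℝ) / m) := by
  have hA0 : (0 : ℝ) < (sat A).card := by exact_mod_cast hA.card_pos
  have hf0 : (0 : ℝ) < (sat f).card := by exact_mod_cast hf.card_pos
  have hm : 0 < m := hA0.trans_le h1
  -- For nonnegative numbers `|a - b| = a + b - 2 min a b`, and on the intersection both densities
  -- are at least `1 / m`.
  have key : ∀ x, |(unifSat A hA x).toReal - (unifSat f hf x).toReal| ≤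
      (unifSat A hA x).toReal + (unifSat f hf x).toReal -
        2 * (if x ∈ sat A ∩ sat f then 1 / m else 0) := by
    intro x
    rw [unifSat_apply, unifSat_apply]
    have e1 : 1 / m ≤ 1 / ((sat A).card : ℝ) := one_div_le_one_div_of_le hA0 h1
    have e2 : 1 / m ≤ 1 / ((sat f).card : ℝ) := one_div_le_one_div_of_le hf0 h2
    have e3 : 0 < 1 / m := by positivity
    by_cases ha : A x = true <;> by_cases hb : f x = true
    · simp only [ha, hb, if_true, sat, Finset.mem_inter, Finset.mem_filter, Finset.mem_univ,
        and_self]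
      simp only [sat] at e1 e2
      rw [abs_le]
      constructor <;> linarith
    all_goals simp [ha, hb, sat]
  calc _ ≤ ∑ x, ((unifSat A hA x).toReal + (unifSat f hf x).toReal -
        2 * (if x ∈ sat A ∩ sat f then 1 / m else 0)) := Finset.sum_le_sum fun x _ => key x
    _ = _ := by
        rw [Finset.sum_sub_distrib, Finset.sum_add_distrib, sum_toReal, sum_toReal,
          ← Finset.mul_sum, Finset.sum_ite_mem, Finset.univ_inter, Finset.sum_const, nsmul_eq_mul]
        ring

/-! ### Rejection sampling -/

/-- Draw from `D` until a point of `A` is found, for at most `k` rounds. -/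
def rejDist {n : ℕ} (D : PMF (Cube n)) (A : Cube n → Bool) (x₀ : Cube n) : ℕ → PMF (Cube n)
  | 0 => PMF.pure x₀
  | k + 1 => D.bind fun x => if A x then PMF.pure x else rejDist D A x₀ k

/-- Either the first draw is accepted, or the procedure starts afresh and independently of the
rejected point. -/
theorem rejDist_succ_apply {n : ℕ} (D : PMF (Cube n)) (A : Cube n → Bool) (x₀ : Cube n) (k : ℕ)
    (x : Cube n) : (rejDist D A x₀ (k + 1) x).toReal =
      (if A x then (D x).toReal else 0) +
        (∑ y, (D y).toReal * (if A y then 0 else 1)) * (rejDist D A x₀ k x).toReal := by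
  rw [rejDist, bind_apply_toReal, Finset.sum_mul]
  have : ∀ y, (D y).toReal * ((if A y then PMF.pure y else rejDist D A x₀ k) x).toReal =
      (if y = x then (if A x then (D x).toReal else 0) else 0) +
        (D y).toReal * (if A y then 0 else 1) * (rejDist D A x₀ k x).toReal := by
    intro y
    by_cases hy : A y = true
    · by_cases hxy : y = x
      · subst hxy; simp [hy]
      · simp [hy, hxy, PMF.pure_apply, Ne.symm hxy]
    · by_cases hxy : y = x
      · subst hxy; simp [hy]
      · simp [hy, hxy]
  simp only [this]
  rw [Finset.sum_add_distrib]
  simp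

/-- Let `e` be the sum on the right. One round contributes the unnormalised error `e` and multiplies
the error of the remaining rounds by `1 - p`. The map `d ↦ e + (1 - p) d` has the fixed point `e /
p`, and the initial distance is at most 2. -/
theorem rejDist_l1_le {n : ℕ} (D U : PMF (Cube n)) (A : Cube n → Bool) (x₀ : Cube n) {p : ℝ}
    (hp : ∑ y, (D y).toReal * (if A y then 1 else 0) = p) (hp0 : 0 < p) (k : ℕ) :
    l1 (rejDist D A x₀ k) U ≤
      (∑ x, |(if A x then (D x).toReal else 0) - p * (U x).toReal|) / p + 2 * (1 - p) ^ k := by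
  set e := ∑ x, |(if A x then (D x).toReal else 0) - p * (U x).toReal| with he
  have he0 : 0 ≤ e := Finset.sum_nonneg fun _ _ => abs_nonneg _
  have hq : ∑ y, (D y).toReal * (if A y then (0 : ℝ) else 1) = 1 - p := by
    have h := sum_toReal D
    rw [← hp]
    nth_rewrite 2 [← h]
    rw [← Finset.sum_sub_distrib]
    refine Finset.sum_congr rfl fun y _ => ?_
    split <;> simp
  have hp1 : 0 ≤ 1 - p := by
    rw [← hq]
    refine Finset.sum_nonneg fun y _ => mul_nonneg ENNReal.toReal_nonneg ?_
    split <;> norm_num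
  induction k with
  | zero =>
    have := l1_le_two (rejDist D A x₀ 0) U
    have : 0 ≤ e / p := by positivity
    simp
    linarith
  | succ k ih =>
    have h1 : l1 (rejDist D A x₀ (k + 1)) U ≤ e + (1 - p) * l1 (rejDist D A x₀ k) U := by
      rw [l1, he, l1, Finset.mul_sum, ← Finset.sum_add_distrib]
      refine Finset.sum_le_sum fun x _ => ?_
      rw [rejDist_succ_apply, hq]
      have : (if A x then (D x).toReal else 0) + (1 - p) * (rejDist D A x₀ k x).toReal -
          (U x).toReal = ((if A x then (D x).toReal else 0) - p * (U x).toReal) +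
            (1 - p) * ((rejDist D A x₀ k x).toReal - (U x).toReal) := by ring
      rw [this]
      refine (abs_add_le _ _).trans ?_
      rw [abs_mul, abs_of_nonneg hp1]
    calc _ ≤ e + (1 - p) * l1 (rejDist D A x₀ k) U := h1
      _ ≤ e + (1 - p) * (e / p + 2 * (1 - p) ^ k) := by
          have := mul_le_mul_of_nonneg_left ih hp1
          linarith
      _ = _ := by field_simp; ring

/-! ### Decoding points of the cube -/

/-- The point of the cube described by a list; every value is interpreted. -/
def dec (n : ℕ) (v : Val) : Cube n := fun i => (Val.lookup i v).truthy

theorem truthy_bit (b : Bool) : (Val.bit b).truthy = b := by cases b <;> rfl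

theorem enc_succ {n : ℕ} (x : Cube (n + 1)) :
    enc x = .pair (Val.bit (x 0)) (enc fun i : Fin n => x i.succ) := by
  simp [enc, List.ofFn_succ]

theorem dec_enc {n : ℕ} (x : Cube n) : dec n (enc x) = x := by
  induction n with
  | zero => exact Subsingleton.elim _ _
  | succ n ih =>
    funext i
    refine Fin.cases ?_ (fun i => ?_) i
    · simp [dec, enc_succ, Val.lookup, Val.fst, truthy_bit]
    · have := congrFun (ih fun i => x i.succ) i
      simpa [dec, enc_succ, Val.lookup, Val.snd] using this

theorem enc_dec_succ (n : ℕ) (v : Val) :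
    enc (dec (n + 1) v) = .pair (Val.bit v.fst.truthy) (enc (dec n v.snd)) := by
  rw [enc_succ]
  rfl

theorem bit_eq (v : Val) : (if v.truthy = true then Val.int 1 else Val.int 0) = Val.bit v.truthy := by
  cases v.truthy <;> rfl

/-! ### Auxiliary programs -/

theorem width_program {A : Code} {a : Val} {L : ℕ} (h : a.width ≤ L) :
    (Val.pair a (.pair (program A) (.int 0))).width ≤ L := by
  simpa [Val.width, program] using h

/-- `(n, v) ↦` the point of the cube described by `v`. -/
def san : Code :=
  .ite (.fst (.var 0))
    (let_ (.app (.var 1) (.pair (.arith .sub (.fst (.var 0)) (.lit 1)) (.snd (.snd (.var 0)))))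
      (.pair (.ite (.fst (.snd (.var 2))) (.lit 1) (.lit 0)) (.var 0)))
    (.lit 0)

theorem truthy_natCast_succ (n : ℕ) : (Val.int ((n + 1 : ℕ) : ℤ)).truthy = true := by
  simp [Val.truthy]
  omega

theorem size_le_of_le {n L : ℕ} (h : n ≤ L) : n.size ≤ L :=
  (Nat.size_le.2 Nat.lt_two_pow_self).trans h

theorem size_intCast_le {z : ℤ} {L : ℕ} (h : |z| < 2 ^ L) : z.natAbs.size ≤ L := by
  rw [Nat.size_le]
  zify
  simpa using h

theorem san_runs_aux (O : Oracle) {L : ℕ} (hL : 2 ^ 30 ≤ L) (n : ℕ) (v : Val) (hn : n ≤ L)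
    (hv : v.width ≤ L) :
    CallRuns O (program san) (.pair (.int n) v) ((n + 1) * (4 * L ^ 2))
      (PMF.pure (enc (dec n v))) := by
  induction n generalizing v with
  | zero =>
    have hw := width_program (A := san) (show (Val.pair (.int (0 : ℕ)) v).width ≤ L by
      simpa [Val.width] using hv)
    refine Runs.mono (B := L ^ 2 + L ^ 2) ?_ (by nlinarith)
    exact runs_else hL hw rfl rfl (runs_short hL hw rfl rfl)
  | succ n ih =>
    have hw := width_program (A := san) (show (Val.pair (.int (n + 1 : ℕ)) v).width ≤ L from
      max_le (size_le_of_le hn) hv)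
    refine Runs.mono (B := ((n + 1) * (4 * L ^ 2) + L ^ 2) + L ^ 2 + 4 + L ^ 2) ?_ (by nlinarith)
    refine runs_then hL hw rfl (truthy_natCast_succ n) ?_
    refine runs_let_pure (runs_call hL hw rfl rfl rfl ?_) (runs_short hL
      (width_let (v := enc (dec n v.snd)) ((width_enc _).trans (by omega)) hw) rfl ?_)
    · have := ih v.snd (by omega) ((width_snd v).trans hv)
      simpa [den, Arith.apply, Val.toInt, Val.lookup, Val.fst, Val.snd] using this
    · rw [enc_dec_succ, ← bit_eq]
      rfl

/-- The generator's output is unconstrained for unsatisfiable `g`, and may be `⊥` otherwise.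
Normalising it ensures that a sampler outputs a genuine point of the cube in all cases. -/
theorem san_runs (O : Oracle) {L : ℕ} (hL : 2 ^ 30 ≤ L) (n : ℕ) (v : Val) (hn : n < L)
    (hv : v.width ≤ L) :
    CallRuns O (program san) (.pair (.int n) v) (L ^ 4) (PMF.pure (enc (dec n v))) := by
  refine (san_runs_aux O hL n v hn.le hv).mono ?_
  calc (n + 1) * (4 * L ^ 2) ≤ L * (L * L ^ 2) := by gcongr <;> omega
    _ = L ^ 4 := by ring

/-- The bit length of a natural number. -/
def bitlen : Code :=
  .ite (.var 0)
    (let_ (.app (.var 1) (.arith .div (.var 0) (.lit 2))) (.arith .add (.var 0) (.lit 1)))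
    (.lit 0)

theorem size_eq_succ {b : ℕ} (hb : b ≠ 0) : b.size = (b / 2).size + 1 := by
  conv_lhs => rw [← Nat.bit_bodd_div2 b]
  rw [Nat.size_bit (by rwa [Nat.bit_bodd_div2]), Nat.div2_val]

theorem bitlen_runs_aux (O : Oracle) {L : ℕ} (hL : 2 ^ 30 ≤ L) (k b : ℕ) (hb : b.size = k)
    (hk : k ≤ L) :
    CallRuns O (program bitlen) (.int b) ((k + 1) * (4 * L ^ 2)) (PMF.pure (.int k)) := by
  have hw := width_program (A := bitlen) (show (Val.int b).width ≤ L from hb.trans_le hk)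
  induction k generalizing b with
  | zero =>
    obtain rfl : b = 0 := Nat.size_eq_zero.1 hb
    refine Runs.mono (B := L ^ 2 + L ^ 2) ?_ (by nlinarith)
    exact runs_else hL hw rfl rfl (runs_short hL hw rfl rfl)
  | succ k ih =>
    have hb0 : b ≠ 0 := by rintro rfl; simp at hb
    have hb2 : (b / 2).size = k := by have := size_eq_succ hb0; omega
    refine Runs.mono (B := ((k + 1) * (4 * L ^ 2) + L ^ 2) + L ^ 2 + 4 + L ^ 2) ?_ (by nlinarith)
    refine runs_then hL hw rfl (by simpa [den, Val.lookup, Val.fst, Val.truthy] using hb0) ?_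
    refine runs_let_pure (runs_call hL hw rfl rfl rfl ?_) (runs_short hL
      (width_let (v := .int k) (size_le_of_le (by simp; omega)) hw) rfl ?_)
    · have h2 := ih (b / 2) hb2 (by omega) (width_program (hb2.trans_le (by omega)))
      simpa [den, Arith.apply, Val.toInt, Val.lookup, Val.fst, Val.snd] using h2
    · simp [den, Arith.apply, Val.toInt, Val.lookup, Val.fst]

theorem bitlen_runs (O : Oracle) {L : ℕ} (hL : 2 ^ 30 ≤ L) (b : ℕ) (hb : b.size < L) :
    CallRuns O (program bitlen) (.int b) (L ^ 4) (PMF.pure (.int b.size)) := by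
  refine (bitlen_runs_aux O hL _ b rfl hb.le).mono ?_
  calc (b.size + 1) * (4 * L ^ 2) ≤ L * (L * L ^ 2) := by gcongr <;> omega
    _ = L ^ 4 := by ring

/-- `n ↦ 2 ^ n`. -/
def pow2 : Code :=
  .ite (.var 0)
    (let_ (.app (.var 1) (.arith .sub (.var 0) (.lit 1))) (.arith .add (.var 0) (.var 0)))
    (.lit 1)

theorem pow2_runs_aux (O : Oracle) {L : ℕ} (hL : 2 ^ 30 ≤ L) (n : ℕ) (hn : n < L) :
    CallRuns O (program pow2) (.int n) ((n + 1) * (4 * L ^ 2))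
      (PMF.pure (.int ((2 : ℤ) ^ n))) := by
  have hw := width_program (A := pow2) (show (Val.int n).width ≤ L from size_le_of_le hn.le)
  induction n with
  | zero =>
    refine Runs.mono (B := L ^ 2 + L ^ 2) ?_ (by nlinarith)
    exact runs_else hL hw rfl rfl (runs_short hL hw rfl rfl)
  | succ n ih =>
    have h2 := ih (by omega) (width_program (size_le_of_le (by simp; omega)))
    refine Runs.mono (B := ((n + 1) * (4 * L ^ 2) + L ^ 2) + L ^ 2 + 4 + L ^ 2) ?_ (by nlinarith)
    refine runs_then hL hw rfl (truthy_natCast_succ n) ?_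
    refine runs_let_pure (runs_call hL hw rfl rfl rfl ?_) (runs_short hL
      (width_let (v := .int (2 ^ n)) (size_intCast_le ?_) hw) rfl ?_)
    · simpa [den, Arith.apply, Val.toInt, Val.lookup, Val.fst, Val.snd] using h2
    · rw [abs_of_pos (by positivity)]
      exact pow_lt_pow_right₀ (by norm_num) (by omega)
    · simp [den, Arith.apply, Val.toInt, Val.lookup, Val.fst]
      ring

theorem pow2_runs (O : Oracle) {L : ℕ} (hL : 2 ^ 30 ≤ L) (n : ℕ) (hn : n < L) :
    CallRuns O (program pow2) (.int n) (L ^ 4) (PMF.pure (.int ((2 : ℤ) ^ n))) := by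
  refine (pow2_runs_aux O hL n hn).mono ?_
  calc (n + 1) * (4 * L ^ 2) ≤ L * (L * L ^ 2) := by gcongr <;> omega
    _ = L ^ 4 := by ring

/-! ### Drawing points -/

/-- The distribution of the point described by the output of a generator. -/
def genDist (Agen : Code) (T n a b : ℕ) (r : Val) : PMF (Cube n) :=
  (exec noOracle T (program Agen) (args n a b r)).map fun o => dec n (o.getD (.int 0)).snd

/-- Run the generator and interpret its output as a point. -/
def draw (Agen : Code) : Code :=
  let_ (.app (.proc Agen) (.var 0)) (.app (.proc san) (.pair (.fst (.var 2)) (.snd (.var 0))))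

/-- Only the halting of the generator is used, not its accuracy. The run is available under every
oracle, since the final sampler has to work without any. -/
theorem draw_runs (O : Oracle) {Agen : Code} {L T n a b : ℕ} {r : Val} (hL : 2 ^ 30 ≤ L)
    (hn : n < L) (hw : (args n a b r).width ≤ L) (hT : T < L)
    (h : exec noOracle T (program Agen) (args n a b r) none = 0) :
    CallRuns O (program (draw Agen)) (args n a b r) (L ^ 5)
      ((genDist Agen T n a b r).map enc) := by
  obtain ⟨μ, hμ⟩ := exists_map_some _ h
  have h1 := callRuns_of_noOracle' hμ O
  have h2 := (callRuns_of_noOracle (f := program Agen) (B := L) (by simp [Val.width, program])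
    hw hT.le hμ).1
  have hw' := width_program (A := draw Agen) hw
  have e : (genDist Agen T n a b r).map enc = μ.bind fun w => PMF.pure (enc (dec n w.snd)) := by
    rw [genDist, hμ, PMF.map_comp, PMF.map_comp, ← PMF.bind_pure_comp]
    rfl
  rw [e]
  refine Runs.mono (B := (T + 1 + L ^ 2) + (L ^ 4 + L ^ 2) + 4) ?_ ?_
  · refine runs_let (runs_call hL hw' rfl rfl rfl h1) fun v hv => ?_
    exact runs_call hL (width_let (h2 v hv) hw') rfl rfl rfl
      (san_runs O hL n v.snd hn ((width_snd v).trans (h2 v hv)))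
  · nlinarith [Nat.pow_le_pow_right (show 0 < L by omega) (show 2 ≤ 4 by norm_num),
      Nat.pow_le_pow_right (show 0 < L by omega) (show 1 ≤ 4 by norm_num), pow_succ L 4,
      Nat.mul_le_mul_left (L ^ 4) hL]

/-- `(A, (h, x)) ↦ g(x) ∧ h(x)`, where `A = (n, (a, (b, r)))` and `r` represents `g`. -/
def acc (ev : Code) : Code :=
  let_ (.app (.proc ev) (.pair (.fst (.fst (.var 0)))
      (.pair (.snd (.snd (.snd (.fst (.var 0))))) (.snd (.snd (.var 0))))))
    (.ite (.var 0) (.app (.fst (.snd (.var 2))) (.snd (.snd (.var 2)))) (.lit 0))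

theorem acc_runs (O : Oracle) {ev : Code} {L T T' n a b : ℕ} {r h : Val} {g φ : Cube n → Bool}
    (hL : 2 ^ 30 ≤ L) (hw : (args n a b r).width ≤ L) (hh : h.width ≤ L) (hT : T < L)
    (hT' : T' < L) (x : Cube n)
    (hg : exec noOracle T (program ev) (.pair (.int n) (.pair r (enc x)))
      = PMF.pure (some (Val.bit (g x))))
    (hφ : CallRuns O h (enc x) T' (PMF.pure (Val.bit (φ x)))) :
    CallRuns O (program (acc ev)) (.pair (args n a b r) (.pair h (enc x))) (L ^ 3)
      (PMF.pure (Val.bit (g x && φ x))) := by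
  have hx : (enc x).width ≤ L := (width_enc x).trans (by omega)
  have hw' := width_program (A := acc ev)
    (show (Val.pair (args n a b r) (.pair h (enc x))).width ≤ L from max_le hw (max_le hh hx))
  have h1 := callRuns_of_noOracle' (μ := PMF.pure (Val.bit (g x))) (by rw [hg, PMF.pure_map]) O
  have hw2 : ∀ t, (Val.pair (Val.bit (g x)) (.pair (.clo t _) _)).width ≤ L := fun t =>
    width_let ((width_bit _).trans (by omega)) hw'
  refine Runs.mono (B := (T + 1 + L ^ 2) + (T' + L ^ 2 + L ^ 2) + 4) ?_ (by nlinarith)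
  refine runs_let_pure (runs_call hL hw' rfl rfl rfl h1) ?_
  cases hb : g x with
  | true =>
    rw [hb] at hw2
    exact runs_then hL (hw2 _) rfl rfl (runs_call hL (hw2 _) rfl rfl rfl hφ)
  | false =>
    rw [hb] at hw2
    refine (runs_else hL (hw2 _) rfl rfl (runs_short hL (hw2 _) rfl rfl)).mono ?_
    omega

/-- `(k, (A, h)) ↦` a point accepted by `acc`, by rejection sampling with `k` rounds. -/
def rej (Agen ev : Code) : Code :=
  .ite (.fst (.var 0))
    (let_ (.app (.proc (draw Agen)) (.fst (.snd (.var 0))))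
      (let_ (.app (.proc (acc ev))
          (.pair (.fst (.snd (.var 2))) (.pair (.snd (.snd (.var 2))) (.var 0))))
        (.ite (.var 0) (.var 2)
          (.app (.var 5) (.pair (.arith .sub (.fst (.var 4)) (.lit 1)) (.snd (.var 4)))))))
    (.app (.proc san) (.pair (.fst (.fst (.snd (.var 0)))) (.lit 0)))

theorem rej_runs_aux (O : Oracle) {Agen ev : Code} {L n a b : ℕ} {r h : Val} {A : Cube n → Bool}
    {D : PMF (Cube n)} (hL : 2 ^ 30 ≤ L) (hn : n < L) (hw : (args n a b r).width ≤ L)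
    (hh : h.width ≤ L)
    (hD : CallRuns O (program (draw Agen)) (args n a b r) (L ^ 5) (D.map enc))
    (hA : ∀ x, CallRuns O (program (acc ev)) (.pair (args n a b r) (.pair h (enc x))) (L ^ 3)
      (PMF.pure (Val.bit (A x)))) (k : ℕ) (hk : k ≤ L) :
    CallRuns O (program (rej Agen ev)) (.pair (.int k) (.pair (args n a b r) h))
      ((k + 1) * (L ^ 5 + L ^ 4 + L ^ 3 + 6 * L ^ 2))
      ((rejDist D A (dec n (.int 0)) k).map enc) := by
  have hw' : ∀ k : ℕ, k ≤ L → _ := fun k hk => width_program (A := rej Agen ev)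
    (show (Val.pair (.int k) (.pair (args n a b r) h)).width ≤ L from
      max_le (size_le_of_le hk) (max_le hw hh))
  induction k with
  | zero =>
    refine Runs.mono (B := L ^ 4 + L ^ 2 + L ^ 2) ?_ (by omega)
    -- All rounds were rejected: the default is the point decoded from `0`, all of whose bits are
    -- `false`.
    refine runs_else hL (hw' 0 hk) rfl rfl (runs_call hL (hw' 0 hk) rfl rfl rfl ?_)
    rw [rejDist, PMF.pure_map]
    exact san_runs O hL n (.int 0) hn (by simp [Val.width])
  | succ k ih =>
    have ih := ih (by omega)
    set Q := (k + 1) * (L ^ 5 + L ^ 4 + L ^ 3 + 6 * L ^ 2) with hQ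
    have hk' := hw' (k + 1) hk
    have hL2 : 8 ≤ L ^ 2 := by nlinarith
    refine Runs.mono (B := (L ^ 5 + L ^ 2) + ((L ^ 3 + L ^ 2) + (Q + L ^ 2 + L ^ 2) + 4) + 4 + L ^ 2)
      ?_ (by rw [add_mul, ← hQ]; omega)
    refine runs_then hL hk' rfl (truthy_natCast_succ k) ?_
    rw [rejDist, PMF.map_bind]
    refine runs_let_map dec_enc (runs_call hL hk' rfl rfl rfl hD) fun x _ => ?_
    have hx : (enc x).width ≤ L := (width_enc x).trans (by omega)
    have hw2 := fun t => width_let (t := t) hx hk'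
    refine runs_let_pure (runs_call hL (hw2 _) rfl rfl rfl (hA x)) ?_
    have hw3 := fun t t' => width_let (t := t) ((width_bit (A x)).trans (by omega)) (hw2 t')
    cases hb : A x with
    | true =>
      rw [hb] at hw3
      rw [if_pos rfl, PMF.pure_map]
      exact (runs_then hL (hw3 _ _) rfl rfl (runs_short hL (hw3 _ _) rfl rfl)).mono (by omega)
    | false =>
      rw [hb] at hw3
      rw [if_neg (by simp)]
      refine runs_else hL (hw3 _ _) rfl rfl (runs_call hL (hw3 _ _) rfl rfl rfl ?_)
      simpa [den, Arith.apply, Val.toInt, Val.lookup, Val.fst, Val.snd] using ih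

theorem rej_runs (O : Oracle) {Agen ev : Code} {L n a b : ℕ} {r h : Val} {A : Cube n → Bool}
    {D : PMF (Cube n)} (hL : 2 ^ 30 ≤ L) (hn : n < L) (hw : (args n a b r).width ≤ L)
    (hh : h.width ≤ L)
    (hD : CallRuns O (program (draw Agen)) (args n a b r) (L ^ 5) (D.map enc))
    (hA : ∀ x, CallRuns O (program (acc ev)) (.pair (args n a b r) (.pair h (enc x))) (L ^ 3)
      (PMF.pure (Val.bit (A x)))) (k : ℕ) (hk : k < L) :
    CallRuns O (program (rej Agen ev)) (.pair (.int k) (.pair (args n a b r) h)) (L ^ 7)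
      ((rejDist D A (dec n (.int 0)) k).map enc) := by
  refine (rej_runs_aux O hL hn hw hh hD hA k hk.le).mono ?_
  have h1 : L ^ 5 + L ^ 4 + L ^ 3 + 6 * L ^ 2 ≤ L * L ^ 5 := by
    have := Nat.pow_le_pow_right (show 0 < L by omega) (show 2 ≤ 5 by norm_num)
    have := Nat.pow_le_pow_right (show 0 < L by omega) (show 3 ≤ 5 by norm_num)
    have := Nat.pow_le_pow_right (show 0 < L by omega) (show 4 ≤ 5 by norm_num)
    nlinarith
  calc (k + 1) * (L ^ 5 + L ^ 4 + L ^ 3 + 6 * L ^ 2) ≤ L * (L * L ^ 5) := by gcongr; omega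
    _ = L ^ 7 := by ring

/-! ### Sums of samples -/

/-- A pair of integers as a value. -/
def encPair (s : ℤ × ℤ) : Val := .pair (.int s.1) (.int s.2)

/-- Read off a pair of integers. -/
def decPair (v : Val) : ℤ × ℤ := (v.fst.toInt, v.snd.toInt)

theorem decPair_encPair (s : ℤ × ℤ) : decPair (encPair s) = s := rfl

/-- `(k, ((F, c), s)) ↦` the sum of `s` and the results of `k` calls of `F` on `c`. -/
def sumLoop : Code :=
  .ite (.fst (.var 0))
    (let_ (.app (.fst (.fst (.snd (.var 0)))) (.snd (.fst (.snd (.var 0)))))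
      (.app (.var 3) (.pair (.arith .sub (.fst (.var 2)) (.lit 1))
        (.pair (.fst (.snd (.var 2)))
          (.pair (.arith .add (.fst (.snd (.snd (.var 2)))) (.fst (.var 0)))
            (.arith .add (.snd (.snd (.snd (.var 2)))) (.snd (.var 0))))))))
    (.snd (.snd (.var 0)))

theorem width_encPair {s : ℤ × ℤ} {L : ℕ} (h1 : |s.1| < 2 ^ L) (h2 : |s.2| < 2 ^ L) :
    (encPair s).width ≤ L := max_le (size_intCast_le h1) (size_intCast_le h2)

/-- The hypothesis `hs` reserves room for the `k` summands still to come. It passes to `s + X ω`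
with one summand less, so every partial sum fits into `L` bits. -/
theorem sumLoop_runs_aux {Ω : Type} (O : Oracle) {L B : ℕ} {F c : Val} {P : PMF Ω}
    {X : Ω → ℤ × ℤ} {M : ℤ} (hL : 2 ^ 30 ≤ L) (hF : F.width ≤ L) (hc : c.width ≤ L)
    (hM : ∀ ω, |(X ω).1| ≤ M ∧ |(X ω).2| ≤ M)
    (h : CallRuns O F c B (P.map fun ω => encPair (X ω))) (k : ℕ) (s : ℤ × ℤ) (hk : k ≤ L)
    (hs : |s.1| + k * M < 2 ^ L ∧ |s.2| + k * M < 2 ^ L) (hM0 : 0 ≤ M) :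
    CallRuns O (program sumLoop) (.pair (.int k) (.pair (.pair F c) (encPair s)))
      ((k + 1) * (B + 4 * L ^ 2)) ((iidSum P X k s).map encPair) := by
  induction k generalizing s with
  | zero =>
    have hw := width_program (A := sumLoop) (show (Val.pair (.int (0 : ℕ))
      (.pair (.pair F c) (encPair s))).width ≤ L from max_le (by simp [Val.width]) (max_le
        (max_le hF hc) (width_encPair (by simpa using hs.1) (by simpa using hs.2))))
    refine Runs.mono (B := L ^ 2 + L ^ 2) ?_ (by nlinarith)
    rw [iidSum, PMF.pure_map]
    exact runs_else hL hw rfl rfl (runs_short hL hw rfl rfl)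
  | succ k ih =>
    push_cast at hs
    have hkM : 0 ≤ (k : ℤ) * M := by positivity
    have hw := width_program (A := sumLoop) (show (Val.pair (.int (k + 1 : ℕ))
      (.pair (.pair F c) (encPair s))).width ≤ L from max_le (size_le_of_le hk) (max_le
        (max_le hF hc) (width_encPair (by nlinarith) (by nlinarith))))
    refine Runs.mono (B := (B + L ^ 2) + ((k + 1) * (B + 4 * L ^ 2) + L ^ 2) + 4 + L ^ 2) ?_
      (by nlinarith)
    refine runs_then hL hw rfl (truthy_natCast_succ k) ?_
    rw [iidSum, PMF.map_bind]
    have e : (P.bind fun ω => PMF.map encPair (iidSum P X k (s + X ω))) =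
        (P.map X).bind fun u => PMF.map encPair (iidSum P X k (s + u)) := by
      rw [PMF.bind_map]; rfl
    rw [e]
    have h' : CallRuns O F c B ((P.map X).map encPair) := by rw [PMF.map_comp]; exact h
    refine runs_let_map decPair_encPair (runs_call hL hw rfl rfl rfl h') fun u hu => ?_
    rw [PMF.support_map] at hu
    obtain ⟨ω, -, rfl⟩ := hu
    have h3 := hM ω
    have h1 := abs_add_le s.1 (X ω).1
    have h2 := abs_add_le s.2 (X ω).2
    have h4 := abs_nonneg s.1
    have h5 := abs_nonneg s.2
    have hw2 := fun t => width_let (v := encPair (X ω)) (t := t)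
      (width_encPair (by nlinarith) (by nlinarith)) hw
    refine runs_call hL (hw2 _) rfl rfl rfl ?_
    have := ih (s + X ω) (by omega) ⟨by simp only [Prod.fst_add]; nlinarith,
      by simp only [Prod.snd_add]; nlinarith⟩
    simpa [den, Arith.apply, Val.toInt, Val.lookup, Val.fst, Val.snd, encPair] using this

theorem sumLoop_runs {Ω : Type} (O : Oracle) {L : ℕ} {F c : Val} {P : PMF Ω}
    {X : Ω → ℤ × ℤ} {M : ℤ} (hL : 2 ^ 30 ≤ L) (hF : F.width ≤ L) (hc : c.width ≤ L)
    (hM : ∀ ω, |(X ω).1| ≤ M ∧ |(X ω).2| ≤ M) (hM0 : 0 ≤ M)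
    (h : CallRuns O F c (L ^ 6) (P.map fun ω => encPair (X ω))) (k : ℕ) (hk : k < L)
    (hs : k * M < 2 ^ L) :
    CallRuns O (program sumLoop) (.pair (.int k) (.pair (.pair F c) (encPair 0)))
      (L ^ 8) ((iidSum P X k 0).map encPair) := by
  refine (sumLoop_runs_aux O hL hF hc hM h k 0 hk.le (by simpa using hs) hM0).mono ?_
  have h1 : L ^ 6 + 4 * L ^ 2 ≤ L * L ^ 6 := by
    have := Nat.pow_le_pow_right (show 0 < L by omega) (show 2 ≤ 6 by norm_num)
    nlinarith
  calc (k + 1) * (L ^ 6 + 4 * L ^ 2) ≤ L * (L * L ^ 6) := by gcongr; omega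
    _ = L ^ 8 := by ring

/-! ### Simulation of statistical queries -/

/-- A pair of independent points. -/
def prodDist {n : ℕ} (D U : PMF (Cube n)) : PMF (Cube n × Cube n) :=
  D.bind fun x => U.map fun y => (x, y)

theorem map_prodDist {n : ℕ} {β : Type} (D U : PMF (Cube n)) (F : Cube n × Cube n → β) :
    (prodDist D U).map F = D.bind fun x => U.bind fun y => PMF.pure (F (x, y)) := by
  rw [prodDist, PMF.map_bind]
  congr 1
  funext x
  rw [PMF.map_comp, ← PMF.bind_pure_comp]
  rfl

theorem prodDist_apply {n : ℕ} (D U : PMF (Cube n)) (x y : Cube n) :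
    (prodDist D U (x, y)).toReal = (D x).toReal * (U y).toReal := by
  classical
  rw [prodDist, bind_apply_toReal, Finset.sum_eq_single x]
  · congr 1
    rw [← PMF.bind_pure_comp, bind_apply_toReal, Finset.sum_eq_single y]
    · simp
    · intro z _ hz
      simp [PMF.pure_apply, Ne.symm hz]
    · simp
  · intro z _ hz
    rw [← PMF.bind_pure_comp, bind_apply_toReal, Finset.sum_eq_zero, mul_zero]
    intro w _
    simp [PMF.pure_apply, Ne.symm hz]
  · simp

theorem sum_prodDist {n : ℕ} (D U : PMF (Cube n)) (φ ψ : Cube n → ℝ) :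
    ∑ ω, (prodDist D U ω).toReal * (φ ω.1 + ψ ω.2) =
      ∑ x, (D x).toReal * φ x + ∑ y, (U y).toReal * ψ y := by
  rw [Fintype.sum_prod_type]
  simp only [prodDist_apply]
  have : ∀ x, ∑ y, (D x).toReal * (U y).toReal * (φ x + ψ y) =
      (D x).toReal * φ x + (D x).toReal * ∑ y, (U y).toReal * ψ y := by
    intro x
    have h1 : ∀ y, (D x).toReal * (U y).toReal * (φ x + ψ y) =
        (U y).toReal * ((D x).toReal * φ x) + (D x).toReal * ((U y).toReal * ψ y) := fun y => by
      ring
    simp only [h1]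
    rw [Finset.sum_add_distrib, ← Finset.sum_mul, ← Finset.mul_sum, sum_toReal, one_mul]
  simp only [this]
  rw [Finset.sum_add_distrib, ← Finset.sum_mul, sum_toReal, one_mul]

theorem iidSum_support {Ω : Type} {P : PMF Ω} {X : Ω → ℤ × ℤ} {M : ℤ}
    (hM : ∀ ω, |(X ω).1| ≤ M ∧ |(X ω).2| ≤ M) (k : ℕ) (s u : ℤ × ℤ)
    (hu : u ∈ (iidSum P X k s).support) : |u.1| ≤ |s.1| + k * M ∧ |u.2| ≤ |s.2| + k * M := by
  induction k generalizing s with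
  | zero =>
    simp only [iidSum, PMF.support_pure, Set.mem_singleton_iff] at hu
    simp [hu]
  | succ k ih =>
    rw [iidSum, PMF.mem_support_bind_iff] at hu
    obtain ⟨ω, -, hω⟩ := hu
    have h1 := ih _ hω
    have h2 := abs_add_le s.1 (X ω).1
    have h3 := abs_add_le s.2 (X ω).2
    have h4 := hM ω
    simp only [Prod.fst_add, Prod.snd_add] at h1
    push_cast
    constructor <;> linarith [h1.1, h1.2, h4.1, h4.2]

/-- `(χ, (l, z)) ↦ ⌊l χ(z)⌋`. -/
def quant : Code :=
  let_ (.app (.fst (.var 0)) (.snd (.snd (.var 0))))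
    (.arith .div (.arith .mul (.fst (.var 0)) (.fst (.snd (.var 2)))) (.snd (.var 0)))

theorem quant_runs (O : Oracle) {L B : ℕ} {χ z : Val} {l : ℕ} {w : ℤ × ℤ} (hL : 2 ^ 30 ≤ L)
    (hχ : χ.width ≤ L) (hl : l < L) (hz : z.width ≤ L) (hB : B < L) (hw : (encPair w).width ≤ L)
    (h : CallRuns O χ z B (PMF.pure (encPair w))) :
    CallRuns O (program quant) (.pair χ (.pair (.int l) z)) (L ^ 3)
      (PMF.pure (.int (w.1 * l / w.2))) := by
  have hw' := width_program (A := quant) (show (Val.pair χ (.pair (.int l) z)).width ≤ L from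
    max_le hχ (max_le (size_le_of_le hl.le) hz))
  refine Runs.mono (B := (B + L ^ 2) + L ^ 2 + 4) ?_ (by nlinarith)
  exact runs_let_pure (runs_call hL hw' rfl rfl rfl h)
    (runs_short hL (width_let hw hw') rfl rfl)

theorem quant_bound {w : ℤ × ℤ} (h0 : 0 < w.2) (h1 : |w.1| ≤ w.2) (l : ℕ) :
    |w.1 * l / w.2| ≤ l := by
  have h2 := abs_le.1 h1
  rw [abs_le]
  constructor
  · rw [Int.le_ediv_iff_mul_le h0]
    nlinarith
  · apply Int.le_of_lt_add_one
    rw [Int.ediv_lt_iff_lt_mul h0]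
    nlinarith

/-- One sample for a statistical query; the context is `(A, (o, (χ, l)))`. -/
def statStep (Agen ev : Code) : Code :=
  let_ (.app (.proc (draw Agen)) (.fst (.var 0)))
  (let_ (.app (.fst (.snd (.var 2))) (.lit 0))
  (let_ (.app (.proc quant) (.pair (.fst (.snd (.snd (.var 4))))
      (.pair (.snd (.snd (.snd (.var 4)))) (.pair (.var 2) (.lit 0)))))
  (let_ (.app (.proc ev) (.pair (.fst (.fst (.var 6)))
      (.pair (.snd (.snd (.snd (.fst (.var 6))))) (.var 2))))
  (.ite (.var 0)
    (let_ (.app (.proc quant) (.pair (.fst (.snd (.snd (.var 8))))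
        (.pair (.snd (.snd (.snd (.var 8)))) (.pair (.var 4) (.lit 1)))))
    (let_ (.app (.proc quant) (.pair (.fst (.snd (.snd (.var 10))))
        (.pair (.snd (.snd (.snd (.var 10)))) (.pair (.var 6) (.lit 0)))))
    (.pair (.var 6) (.arith .sub (.var 2) (.var 0)))))
    (.pair (.var 2) (.lit 0))))))

/-- `⌊l χ(x, y)⌋`, for a query given by the fractions `pq`. -/
def qval {n : ℕ} (pq : Cube n → Bool → ℤ × ℤ) (l : ℕ) (x : Cube n) (y : Bool) : ℤ :=
  (pq x y).1 * l / (pq x y).2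

/-- The contribution of one sample to a statistical query. -/
def statVar {n : ℕ} (pq : Cube n → Bool → ℤ × ℤ) (l : ℕ) (g : Cube n → Bool)
    (ω : Cube n × Cube n) : ℤ × ℤ :=
  (qval pq l ω.1 false, if g ω.2 then qval pq l ω.2 true - qval pq l ω.2 false else 0)

theorem width_int_le {z : ℤ} {l L : ℕ} (h : |z| ≤ l) (hl : l < L) : (Val.int z).width ≤ L := by
  refine size_intCast_le (h.trans_lt ?_)
  exact_mod_cast hl.trans Nat.lt_two_pow_self

/-- No label is needed: the query is evaluated at `(x, -1)` for the generated point `x`, and at `(y,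
1)` and `(y, -1)` for the oracle sample `y` if `g y` holds. -/
theorem statStep_runs (O : Oracle) {Agen ev : Code} {L T B n a b l : ℕ} {r o χ : Val}
    {g : Cube n → Bool} {pq : Cube n → Bool → ℤ × ℤ} {D U : PMF (Cube n)} (hL : 2 ^ 30 ≤ L)
    (hw : (args n a b r).width ≤ L) (ho : o.width ≤ L) (hχ : χ.width ≤ L) (hl : l < L)
    (hT : T < L) (hB : B < L)
    (hD : CallRuns O (program (draw Agen)) (args n a b r) (L ^ 5) (D.map enc))
    (hU : CallRuns O o (.int 0) 1 (U.map enc))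
    (hg : ∀ x, exec noOracle T (program ev) (.pair (.int n) (.pair r (enc x)))
      = PMF.pure (some (Val.bit (g x))))
    (hpq : ∀ x y, 0 < (pq x y).2 ∧ |(pq x y).1| ≤ (pq x y).2 ∧ (encPair (pq x y)).width ≤ L ∧
      CallRuns O χ (.pair (enc x) (Val.bit y)) B (PMF.pure (encPair (pq x y)))) :
    CallRuns O (program (statStep Agen ev)) (.pair (args n a b r) (.pair o (.pair χ (.int l))))
      (L ^ 6) ((prodDist D U).map fun ω => encPair (statVar pq l g ω)) := by
  have w0 := width_program (A := statStep Agen ev) (show (Val.pair (args n a b r)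
    (.pair o (.pair χ (.int l)))).width ≤ L from
      max_le hw (max_le ho (max_le hχ (size_le_of_le hl.le))))
  have hx : ∀ x : Cube n, (enc x).width ≤ L := fun x => (width_enc x).trans (by omega)
  have hbit : ∀ b, (Val.bit b).width ≤ L := fun x => (width_bit x).trans (by omega)
  have hq : ∀ x y, CallRuns O (program quant) (.pair χ (.pair (.int l)
      (.pair (enc x) (Val.bit y)))) (L ^ 3) (PMF.pure (.int (qval pq l x y))) := fun x y =>
    quant_runs O hL hχ hl (max_le (hx x) (hbit y)) hB (hpq x y).2.2.1 (hpq x y).2.2.2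
  have hqw : ∀ x y, (Val.int (qval pq l x y)).width ≤ L := fun x y =>
    width_int_le (quant_bound (hpq x y).1 (hpq x y).2.1 l) hl
  rw [map_prodDist]
  have e3 := Nat.pow_le_pow_right (show 0 < L by omega) (show 3 ≤ 5 by norm_num)
  have e2 := Nat.pow_le_pow_right (show 0 < L by omega) (show 2 ≤ 5 by norm_num)
  have e1 := Nat.pow_le_pow_right (show 0 < L by omega) (show 1 ≤ 5 by norm_num)
  rw [pow_one] at e1
  have e6 : 100 * L ^ 5 ≤ L ^ 6 := by
    rw [pow_succ L 5, mul_comm]; exact Nat.mul_le_mul_left _ (by omega)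
  refine Runs.mono (B := (L ^ 5 + L ^ 2) + ((1 + L ^ 2) + ((L ^ 3 + L ^ 2) + ((T + 1 + L ^ 2) +
    (((L ^ 3 + L ^ 2) + ((L ^ 3 + L ^ 2) + L ^ 2 + 4) + 4) + L ^ 2) + 4) + 4) + 4) + 4) ?_
    (by omega)
  refine runs_let_map dec_enc (runs_call hL w0 rfl rfl rfl hD) fun x _ => ?_
  have w1 := fun t => width_let (t := t) (hx x) w0
  refine runs_let_map dec_enc (runs_call hL (w1 _) rfl rfl rfl hU) fun y _ => ?_
  have w2 := fun t t' => width_let (t := t) (hx y) (w1 t')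
  refine runs_let_pure (runs_call hL (w2 _ _) rfl rfl rfl (hq x false)) ?_
  have w3 := fun t t' t'' => width_let (t := t) (hqw x false) (w2 t' t'')
  have hgy := callRuns_of_noOracle' (μ := PMF.pure (Val.bit (g y)))
    (by rw [hg y, PMF.pure_map]) O
  refine runs_let_pure (runs_call hL (w3 _ _ _) rfl rfl rfl hgy) ?_
  have w4 := fun t t1 t2 t3 => width_let (t := t) (hbit (g y)) (w3 t1 t2 t3)
  cases hb : g y with
  | true =>
    rw [hb] at w4
    refine runs_then hL (w4 _ _ _ _) rfl rfl ?_
    refine runs_let_pure (runs_call hL (w4 _ _ _ _) rfl rfl rfl (hq y true)) ?_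
    have w5 := fun t t0 t1 t2 t3 => width_let (t := t) (hqw y true) (w4 t0 t1 t2 t3)
    refine runs_let_pure (runs_call hL (w5 _ _ _ _ _) rfl rfl rfl (hq y false)) ?_
    refine runs_short hL (width_let (hqw y false) (w5 _ _ _ _ _)) rfl ?_
    simp [den, Arith.apply, Val.toInt, Val.lookup, Val.fst, Val.snd, encPair, statVar, hb]
  | false =>
    rw [hb] at w4
    refine (runs_else hL (w4 _ _ _ _) rfl rfl (runs_short hL (w4 _ _ _ _) rfl ?_)).mono (by omega)
    simp [den, Val.lookup, Val.fst, Val.snd, encPair, statVar, hb]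

/-- Restrict `k` to the interval from `-s` to `s`. -/
def clampZ (s k : ℤ) : ℤ := if k ≤ -s then -s else if s ≤ k then s else k

theorem abs_clampZ_le {s : ℤ} (hs : 0 ≤ s) (k : ℤ) : |clampZ s k| ≤ s := by
  unfold clampZ
  rw [abs_le]
  split_ifs <;> omega

/-- The nearest integer to `s (u₁ + (j q / (N p)) u₂) / (m l)`. -/
def statRound (l m j N p q s : ℤ) (u : ℤ × ℤ) : ℤ :=
  (2 * (s * (u.1 * (N * p) + j * q * u.2)) + m * l * (N * p)) / (2 * (m * l * (N * p)))

/-- The term for `statRound`: variable `0` is `u`, and variable `2` is the argument of `stat`. -/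
def roundCode : Code :=
  let tl : Code := .snd (.snd (.fst (.var 2)))
  let Np : Code := .arith .mul (.fst (.snd (.snd (.snd tl)))) (.fst (.snd (.snd (.snd (.snd tl)))))
  let dn : Code := .arith .mul (.arith .mul (.fst (.snd tl)) (.fst tl)) Np
  .arith .div
    (.arith .add (.arith .mul (.lit 2) (.arith .mul (.fst (.snd (.var 2)))
      (.arith .add (.arith .mul (.fst (.var 0)) Np)
        (.arith .mul (.arith .mul (.fst (.snd (.snd tl))) (.snd (.snd (.snd (.snd (.snd tl))))))
          (.snd (.var 0)))))) dn)
    (.arith .mul (.lit 2) dn)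

/-- The term for `clampZ`: variable `0` is `k`, and variable `4` is the argument of `stat`. -/
def clampCode : Code :=
  .ite (.arith .le (.var 0) (.arith .sub (.lit 0) (.fst (.snd (.var 4)))))
    (.arith .sub (.lit 0) (.fst (.snd (.var 4))))
    (.ite (.arith .le (.fst (.snd (.var 4))) (.var 0)) (.fst (.snd (.var 4))) (.var 0))

theorem den_clampCode (s k : ℤ) (c χ u f f' e : Val) :
    den clampCode (.pair (.int k) (.pair f (.pair u (.pair f' (.pair (.pair c
      (.pair (.int s) χ)) e))))) = .int (clampZ s k) := by
  by_cases h1 : k ≤ -s <;> by_cases h2 : s ≤ k <;>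
    simp [clampCode, den, Arith.apply, Val.toInt, Val.lookup, Val.fst, Val.snd, Val.truthy, clampZ,
      h1, h2]

/-- `(ctx, (s, χ)) ↦` the answer to the query, where
`ctx = (A, (o, (l, (m, (j, (N, (p, q)))))))`. -/
def stat (Agen ev : Code) : Code :=
  let_ (.app (.proc sumLoop) (.pair (.fst (.snd (.snd (.snd (.fst (.var 0))))))
      (.pair (.pair (.proc (statStep Agen ev))
        (.pair (.fst (.fst (.var 0))) (.pair (.fst (.snd (.fst (.var 0))))
          (.pair (.snd (.snd (.var 0))) (.fst (.snd (.snd (.fst (.var 0)))))))))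
      (.pair (.lit 0) (.lit 0)))))
  (let_ roundCode clampCode)

theorem den_roundCode (l m j N p q s : ℤ) (u : ℤ × ℤ) (A o χ f e : Val) :
    den roundCode (.pair (encPair u) (.pair f (.pair (.pair (.pair A (.pair o
      (.pair (.int l) (.pair (.int m) (.pair (.int j) (.pair (.int N) (.pair (.int p)
        (.int q)))))))) (.pair (.int s) χ)) e))) = .int (statRound l m j N p q s u) := rfl

theorem width_short {t : Code} {env : Val} {L : ℕ} (hw : env.width ≤ L) (ht : short t = true) :
    (den t env).width ≤ 1024 * (L + 1) := by
  simp only [short, Bool.and_eq_true, decide_eq_true_eq] at ht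
  exact (runs_simple noOracle ht.1 hw).2.trans (Nat.mul_le_mul_right _ ht.2)

theorem stat_runs (O : Oracle) {Agen ev : Code} {L T B n a b l m : ℕ} {j N p q s : ℤ} {r o χ : Val}
    {g : Cube n → Bool} {pq : Cube n → Bool → ℤ × ℤ} {D U : PMF (Cube n)} (hL : 2 ^ 30 ≤ L)
    (hw : (args n a b r).width ≤ L) (ho : o.width ≤ L) (hχ : χ.width ≤ L) (hl : l < L)
    (hm : m < L) (hml : m * (2 * l) < L)
    (hj : (Val.int j).width ≤ L) (hN : (Val.int N).width ≤ L) (hp : (Val.int p).width ≤ L)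
    (hq : (Val.int q).width ≤ L) (hs : (Val.int s).width ≤ L)
    (hT : T < L) (hB : B < L)
    (hD : CallRuns O (program (draw Agen)) (args n a b r) (L ^ 5) (D.map enc))
    (hU : CallRuns O o (.int 0) 1 (U.map enc))
    (hg : ∀ x, exec noOracle T (program ev) (.pair (.int n) (.pair r (enc x)))
      = PMF.pure (some (Val.bit (g x))))
    (hpq : ∀ x y, 0 < (pq x y).2 ∧ |(pq x y).1| ≤ (pq x y).2 ∧ (encPair (pq x y)).width ≤ L ∧
      CallRuns O χ (.pair (enc x) (Val.bit y)) B (PMF.pure (encPair (pq x y)))) :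
    CallRuns O (program (stat Agen ev)) (.pair (.pair (args n a b r) (.pair o (.pair (.int l)
      (.pair (.int m) (.pair (.int j) (.pair (.int N) (.pair (.int p) (.int q))))))))
        (.pair (.int s) χ)) (L ^ 9)
      ((iidSum (prodDist D U) (statVar pq l g) m 0).map fun u =>
        .int (clampZ s (statRound l m j N p q s u))) := by
  have w0 := width_program (A := stat Agen ev) (show (Val.pair (.pair (args n a b r) (.pair o
    (.pair (.int l) (.pair (.int m) (.pair (.int j) (.pair (.int N) (.pair (.int p)
      (.int q)))))))) (.pair (.int s) χ)).width ≤ L from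
    max_le (max_le hw (max_le ho (max_le (size_le_of_le hl.le) (max_le (size_le_of_le hm.le)
      (max_le hj (max_le hN (max_le hp hq))))))) (max_le hs hχ))
  have hM : ∀ ω, |(statVar pq l g ω).1| ≤ ((2 * l : ℕ) : ℤ) ∧
      |(statVar pq l g ω).2| ≤ ((2 * l : ℕ) : ℤ) := by
    intro ω
    have h0 : ∀ x y, |qval pq l x y| ≤ l := fun x y => quant_bound (hpq x y).1 (hpq x y).2.1 l
    have h1 := abs_le.1 (h0 ω.1 false)
    have h2 := abs_le.1 (h0 ω.2 false)
    have h3 := abs_le.1 (h0 ω.2 true)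
    push_cast
    refine ⟨(h0 ω.1 false).trans (by omega), ?_⟩
    simp only [statVar]
    split
    · rw [abs_le]; constructor <;> omega
    · simp
  have hML : (m : ℤ) * ((2 * l : ℕ) : ℤ) < 2 ^ L := by
    exact_mod_cast hml.trans Nat.lt_two_pow_self
  have hstep := statStep_runs O hL hw ho hχ hl hT hB hD hU hg hpq
  have hsum := sumLoop_runs O (F := program (statStep Agen ev))
    (c := .pair (args n a b r) (.pair o (.pair χ (.int l)))) hL (by simp [program, Val.width])
    (max_le hw (max_le ho (max_le hχ (size_le_of_le hl.le)))) hM (by positivity) hstep m hm hML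
  rw [← PMF.bind_pure_comp]
  have e1 : 1024 * (L + 1) ≤ L ^ 2 := by nlinarith
  have e2 : 2 ^ 30 ≤ L ^ 2 := by nlinarith
  have e3 : L ≤ L ^ 2 := by nlinarith
  have e4 : (L ^ 2) ^ 2 ≤ L ^ 8 := by
    rw [← pow_mul]; exact Nat.pow_le_pow_right (by omega) (by norm_num)
  have e5 := Nat.pow_le_pow_right (show 0 < L by omega) (show 2 ≤ 8 by norm_num)
  have e9 : 100 * L ^ 8 ≤ L ^ 9 := by
    rw [pow_succ L 8, mul_comm]; exact Nat.mul_le_mul_left _ (by omega)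
  refine Runs.mono (B := (L ^ 8 + L ^ 2) + (L ^ 2 + (L ^ 2) ^ 2 + 4) + 4) ?_ (by omega)
  refine runs_let_map decPair_encPair (runs_call hL w0 rfl rfl rfl hsum) fun u hu => ?_
  have hu' := iidSum_support hM m 0 u hu
  simp only [Prod.fst_zero, Prod.snd_zero, abs_zero, zero_add] at hu'
  have w1 := fun t => width_let (t := t)
    (width_encPair (hu'.1.trans_lt hML) (hu'.2.trans_lt hML)) w0
  have hk := den_roundCode l m j N p q s u (args n a b r) o χ
  -- The numerator and denominator are products of several `L`-bit numbers. The generic bound for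
  -- short terms gives `1024 * (L + 1)` bits, so the last step is measured with `L ^ 2` in place of
  -- `L`.
  have wk : (Val.int (statRound l m j N p q s u)).width ≤ L ^ 2 := by
    have := width_short (t := roundCode) (w1 (.lit 0)) rfl
    rw [hk] at this
    exact this.trans e1
  refine runs_let_pure (runs_short hL (w1 _) rfl (hk _ _)) ?_
  have w2 := fun t t' => width_let (t := t) wk ((w1 t').trans e3)
  exact runs_short e2 (w2 _ _) rfl (den_clampCode _ _ _ _ _ _ _ _)

/-! ### Testing a candidate -/

/-- One sample for the test of a candidate; the context is `(A, (o, h))`. -/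
def testStep (Agen ev : Code) : Code :=
  let_ (.app (.proc (draw Agen)) (.fst (.var 0)))
  (let_ (.app (.proc (acc ev)) (.pair (.fst (.var 2)) (.pair (.snd (.snd (.var 2))) (.var 0))))
  (let_ (.app (.fst (.snd (.var 4))) (.lit 0))
  (let_ (.app (.proc (acc ev)) (.pair (.fst (.var 6)) (.pair (.snd (.snd (.var 6))) (.var 0))))
  (.pair (.var 0) (.var 4)))))

/-- The indicators of the event `A` at two points. -/
def testVar {n : ℕ} (A : Cube n → Bool) (ω : Cube n × Cube n) : ℤ × ℤ :=
  (if A ω.2 then 1 else 0, if A ω.1 then 1 else 0)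

theorem testStep_runs (O : Oracle) {Agen ev : Code} {L n a b : ℕ} {r o h : Val}
    {A : Cube n → Bool} {D U : PMF (Cube n)} (hL : 2 ^ 30 ≤ L)
    (hw : (args n a b r).width ≤ L) (ho : o.width ≤ L) (hh : h.width ≤ L)
    (hD : CallRuns O (program (draw Agen)) (args n a b r) (L ^ 5) (D.map enc))
    (hU : CallRuns O o (.int 0) 1 (U.map enc))
    (hA : ∀ x, CallRuns O (program (acc ev)) (.pair (args n a b r) (.pair h (enc x))) (L ^ 3)
      (PMF.pure (Val.bit (A x)))) :
    CallRuns O (program (testStep Agen ev)) (.pair (args n a b r) (.pair o h))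
      (L ^ 6) ((prodDist D U).map fun ω => encPair (testVar A ω)) := by
  have w0 := width_program (A := testStep Agen ev) (show (Val.pair (args n a b r)
    (.pair o h)).width ≤ L from max_le hw (max_le ho hh))
  have hx : ∀ x : Cube n, (enc x).width ≤ L := fun x => (width_enc x).trans (by omega)
  have hbit : ∀ b, (Val.bit b).width ≤ L := fun x => (width_bit x).trans (by omega)
  rw [map_prodDist]
  have e3 := Nat.pow_le_pow_right (show 0 < L by omega) (show 3 ≤ 5 by norm_num)
  have e2 := Nat.pow_le_pow_right (show 0 < L by omega) (show 2 ≤ 5 by norm_num)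
  have e1 := Nat.pow_le_pow_right (show 0 < L by omega) (show 1 ≤ 5 by norm_num)
  rw [pow_one] at e1
  have e6 : 100 * L ^ 5 ≤ L ^ 6 := by
    rw [pow_succ L 5, mul_comm]; exact Nat.mul_le_mul_left _ (by omega)
  refine Runs.mono (B := (L ^ 5 + L ^ 2) + ((L ^ 3 + L ^ 2) + ((1 + L ^ 2) + ((L ^ 3 + L ^ 2) +
    L ^ 2 + 4) + 4) + 4) + 4) ?_ (by omega)
  refine runs_let_map dec_enc (runs_call hL w0 rfl rfl rfl hD) fun x _ => ?_
  have w1 := fun t => width_let (t := t) (hx x) w0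
  refine runs_let_pure (runs_call hL (w1 _) rfl rfl rfl (hA x)) ?_
  have w2 := fun t t' => width_let (t := t) (hbit (A x)) (w1 t')
  refine runs_let_map dec_enc (runs_call hL (w2 _ _) rfl rfl rfl hU) fun y _ => ?_
  have w3 := fun t t' t'' => width_let (t := t) (hx y) (w2 t' t'')
  refine runs_let_pure (runs_call hL (w3 _ _ _) rfl rfl rfl (hA y)) ?_
  refine runs_short hL (width_let (hbit (A y)) (w3 _ _ _)) rfl ?_
  rfl

/-! ### Accuracy of the simulated statistical queries -/

theorem abs_expect_le {n : ℕ} (D : PMF (Cube n)) (φ : Cube n → ℝ) {M : ℝ} (h : ∀ x, |φ x| ≤ M) :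
    |∑ x, (D x).toReal * φ x| ≤ M := by
  calc |∑ x, (D x).toReal * φ x| ≤ ∑ x, (D x).toReal * M := by
        refine (Finset.abs_sum_le_sum_abs _ _).trans (Finset.sum_le_sum fun x _ => ?_)
        rw [abs_mul, abs_of_nonneg ENNReal.toReal_nonneg]
        exact mul_le_mul_of_nonneg_left (h x) ENNReal.toReal_nonneg
    _ = M := by rw [← Finset.sum_mul, sum_toReal, one_mul]

/-- Both sides are the sum of `ψ` over the common satisfying points, divided by the number of
satisfying points of `g`. This expresses an average that needs the labels of `f` by positive samples
and tests of `g`. -/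
theorem sum_unifSat_swap {n : ℕ} (f g : Cube n → Bool) (hf : (sat f).Nonempty)
    (hg : (sat g).Nonempty) (ψ : Cube n → ℝ) :
    ∑ x, (unifSat g hg x).toReal * (if f x then ψ x else 0) =
      ((sat f).card : ℝ) / (sat g).card *
        ∑ x, (unifSat f hf x).toReal * (if g x then ψ x else 0) := by
  have hF : ((sat f).card : ℝ) ≠ 0 := by exact_mod_cast hf.card_pos.ne'
  rw [Finset.mul_sum]
  refine Finset.sum_congr rfl fun x _ => ?_
  rw [unifSat_apply, unifSat_apply]
  by_cases h1 : f x = true <;> by_cases h2 : g x = true <;> simp [h1, h2]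
  field_simp

theorem quant_error {w : ℤ × ℤ} (h0 : 0 < w.2) (l : ℕ) :
    |(w.1 : ℝ) / w.2 * l - ((w.1 * l / w.2 : ℤ) : ℝ) - 1 / 2| ≤ 1 / 2 := by
  have h0' : (0 : ℝ) < w.2 := by exact_mod_cast h0
  have h1 := Int.mul_ediv_add_emod (w.1 * l) w.2
  have h2 := Int.emod_nonneg (w.1 * l) h0.ne'
  have h3 := Int.emod_lt_of_pos (w.1 * l) h0
  set d := w.1 * l / w.2
  set e := w.1 * l % w.2
  have h1' : (w.2 : ℝ) * d + e = w.1 * l := by exact_mod_cast h1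
  have h4 : (w.1 : ℝ) / w.2 * l - d = e / w.2 := by
    field_simp
    linarith
  rw [h4]
  have h5 : (0 : ℝ) ≤ e / w.2 := div_nonneg (by exact_mod_cast h2) h0'.le
  have h6 : (e : ℝ) / w.2 ≤ 1 := by
    rw [div_le_one h0']
    exact_mod_cast h3.le
  rw [abs_le]
  constructor <;> linarith

/-- The expectation that the simulation of a query estimates. -/
theorem stat_expect_error {n : ℕ} {f g : Cube n → Bool} (hf : (sat f).Nonempty)
    (hg : (sat g).Nonempty) {D : PMF (Cube n)} {φ : Cube n → Bool → ℝ}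
    {pq : Cube n → Bool → ℤ × ℤ} {l : ℕ} {ρ K : ℝ} (hl : 0 < l) (hK : 0 < K)
    (hpq : ∀ x y, 0 < (pq x y).2 ∧ |(pq x y).1| ≤ (pq x y).2 ∧
      φ x y = ((pq x y).1 : ℝ) / (pq x y).2)
    (hD : l1 D (unifSat g hg) ≤ 2 / K)
    (hρ : |ρ - ((sat f).card : ℝ) / (sat g).card| ≤ 3 / K * (((sat f).card : ℝ) / (sat g).card))
    (hρ0 : 0 ≤ ρ) (hρ4 : ρ ≤ 4) :
    |∑ x, (D x).toReal * φ x (f x) - (∑ x, (D x).toReal * (qval pq l x false : ℝ) +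
      ∑ y, (unifSat f hf y).toReal *
        (ρ * (if g y then (qval pq l y true : ℝ) - qval pq l y false else 0))) / l| ≤
      10 / K + 5 / l := by
  have hl' : (0 : ℝ) < l := by exact_mod_cast hl
  have hφ1 : ∀ x y, |φ x y| ≤ 1 := by
    intro x y
    obtain ⟨h1, h2, h3⟩ := hpq x y
    have h1' : (0 : ℝ) < (pq x y).2 := by exact_mod_cast h1
    rw [h3, abs_div, abs_of_pos h1', div_le_one h1']
    exact_mod_cast h2
  set ψ : Cube n → ℝ := fun x => φ x true - φ x false with hψ
  have hψ2 : ∀ x, |ψ x| ≤ 2 := by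
    intro x
    have h1 := abs_le.1 (hφ1 x true)
    have h2 := abs_le.1 (hφ1 x false)
    rw [hψ, abs_le]
    constructor <;> linarith
  have hψf : ∀ f : Cube n → Bool, ∀ x, |if f x then ψ x else 0| ≤ 2 := by
    intro f x
    split
    · exact hψ2 x
    · simp
  set v := ∑ x, (unifSat f hf x).toReal * (if g x then ψ x else 0) with hv
  set R := ((sat f).card : ℝ) / (sat g).card with hR
  -- The query value is split by label: the value at label `-1`, plus the jump `ψ` where `f` holds.
  have e1 : ∑ x, (D x).toReal * φ x (f x) = ∑ x, (D x).toReal * φ x false +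
      ∑ x, (D x).toReal * (if f x then ψ x else 0) := by
    rw [← Finset.sum_add_distrib]
    refine Finset.sum_congr rfl fun x _ => ?_
    cases f x <;> simp [hψ]
    ring
  -- Only the term that involves `f` is transferred from `D` to the uniform distribution; the other
  -- one is sampled from `D` directly. As `|ψ| ≤ 2`, this costs at most `4 / K`.
  have e2 := abs_expect_sub_le D (unifSat g hg) _ (hψf f)
  rw [sum_unifSat_swap f g hf hg ψ] at e2
  have e3 : |R * v| ≤ 2 := by
    rw [← sum_unifSat_swap f g hf hg ψ]
    exact abs_expect_le _ _ (hψf f)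
  -- The error of `ρ` is relative, and `R * v` is itself an expectation of a function bounded by 2.
  have e4 : |ρ * v - R * v| ≤ 6 / K := by
    have hR0 : 0 ≤ R := by positivity
    calc |ρ * v - R * v| = |ρ - R| * |v| := by rw [← sub_mul, abs_mul]
      _ ≤ (3 / K * R) * |v| := mul_le_mul_of_nonneg_right hρ (abs_nonneg _)
      _ = 3 / K * |R * v| := by rw [abs_mul, abs_of_nonneg hR0]; ring
      _ ≤ 3 / K * 2 := mul_le_mul_of_nonneg_left e3 (by positivity)
      _ = 6 / K := by ring
  have hq : ∀ x y, |φ x y - (qval pq l x y : ℝ) / l - 1 / (2 * l)| ≤ 1 / (2 * l) := by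
    intro x y
    obtain ⟨h1, h2, h3⟩ := hpq x y
    have h4 := quant_error h1 l
    have h5 : φ x y - (qval pq l x y : ℝ) / l - 1 / (2 * l) =
        (((pq x y).1 : ℝ) / (pq x y).2 * l - (qval pq l x y : ℝ) - 1 / 2) / l := by
      rw [h3]
      field_simp
    rw [h5, abs_div, abs_of_pos hl', div_le_div_iff₀ hl' (by positivity)]
    unfold qval
    nlinarith
  have e5 : |∑ x, (D x).toReal * (φ x false - (qval pq l x false : ℝ) / l)| ≤ 1 / l := by
    refine abs_expect_le _ _ fun x => ?_
    have h1 := abs_le.1 (hq x false)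
    have h2 : (1 : ℝ) / l = 1 / (2 * l) + 1 / (2 * l) := by field_simp; norm_num
    rw [abs_le, h2]
    have : (0 : ℝ) < 1 / (2 * l) := by positivity
    constructor <;> linarith
  have e6 : |∑ y, (unifSat f hf y).toReal * ((if g y then ψ y else 0) -
      (if g y then (qval pq l y true : ℝ) - qval pq l y false else 0) / l)| ≤ 1 / l := by
    refine abs_expect_le _ _ fun x => ?_
    have h2 : (1 : ℝ) / l = 1 / (2 * l) + 1 / (2 * l) := by field_simp; norm_num
    by_cases hgx : g x = true
    · have h1 := abs_le.1 (hq x false)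
      have h3 := abs_le.1 (hq x true)
      simp only [hgx, if_true, hψ, sub_div]
      rw [abs_le, h2]
      constructor <;> linarith
    · simp [hgx]
  have e7 : (∑ x, (D x).toReal * (qval pq l x false : ℝ) + ∑ y, (unifSat f hf y).toReal *
        (ρ * (if g y then (qval pq l y true : ℝ) - qval pq l y false else 0))) / l =
      (∑ x, (D x).toReal * φ x false -
        ∑ x, (D x).toReal * (φ x false - (qval pq l x false : ℝ) / l)) +
      ρ * (v - ∑ y, (unifSat f hf y).toReal * ((if g y then ψ y else 0) -
        (if g y then (qval pq l y true : ℝ) - qval pq l y false else 0) / l)) := by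
    rw [hv, ← Finset.sum_sub_distrib, ← Finset.sum_sub_distrib, add_div, Finset.sum_div,
      Finset.sum_div, Finset.mul_sum]
    congr 1 <;> refine Finset.sum_congr rfl fun x _ => ?_ <;> ring
  rw [e7, e1]
  set Q := ∑ y, (unifSat f hf y).toReal * ((if g y then ψ y else 0) -
    (if g y then (qval pq l y true : ℝ) - qval pq l y false else 0) / l)
  set Q' := ∑ x, (D x).toReal * (φ x false - (qval pq l x false : ℝ) / l)
  have e8 : |ρ * Q| ≤ 4 / l := by
    rw [abs_mul, abs_of_nonneg hρ0]
    calc ρ * |Q| ≤ 4 * (1 / l) := mul_le_mul hρ4 e6 (abs_nonneg _) (by norm_num)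
      _ = 4 / l := by ring
  have e9 : (2 : ℝ) * l1 D (unifSat g hg) ≤ 4 / K := by
    have : (4 : ℝ) / K = 2 * (2 / K) := by ring
    linarith
  have h1 := abs_le.1 (e2.trans e9)
  have h2 := abs_le.1 e4
  have h3 := abs_le.1 e5
  have h4 := abs_le.1 e8
  have s1 : (10 : ℝ) / K = 4 / K + 6 / K := by ring
  have s2 : (5 : ℝ) / l = 1 / l + 4 / l := by ring
  rw [abs_le, s1, s2, mul_sub]
  constructor <;> linarith [h1.1, h1.2, h2.1, h2.2, h3.1, h3.2, h4.1, h4.2]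

/-- The quotient on the left is the integer part of `x / y + 1 / 2`; the case `l = 1` of
`quant_error` measures its error about the midpoint. -/
theorem abs_div_sub_half (x y : ℤ) (hy : 0 < y) :
    |(((2 * x + y) / (2 * y) : ℤ) : ℝ) - (x : ℝ) / y| ≤ 1 / 2 := by
  have hy' : (0 : ℝ) < y := by exact_mod_cast hy
  have h := quant_error (w := (2 * x + y, 2 * y)) (by simpa using hy) 1
  simp only [Nat.cast_one, mul_one] at h
  push_cast at h
  have e : (2 * (x : ℝ) + y) / (2 * y) = x / y + 1 / 2 := by field_simp
  rw [e] at h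
  have h' := abs_le.1 h
  rw [abs_le]
  constructor <;> linarith

/-- Projecting to `[-1, 1]` cannot move a number away from the point `E` of that interval. -/
theorem clampZ_close {s k : ℤ} (hs : 0 < s) {E δ : ℝ} (hE : |E| ≤ 1)
    (h : |E - (k : ℝ) / s| ≤ δ) : |E - (clampZ s k : ℝ) / s| ≤ δ := by
  have hs' : (0 : ℝ) < s := by exact_mod_cast hs
  have h1 := abs_le.1 hE
  have h2 := abs_le.1 h
  have hδ : 0 ≤ δ := (abs_nonneg _).trans h
  unfold clampZ
  split_ifs with c1 c2
  · have : (k : ℝ) / s ≤ -1 := by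
      rw [div_le_iff₀ hs']
      have : (k : ℝ) ≤ -s := by exact_mod_cast c1
      linarith
    have e : ((-s : ℤ) : ℝ) / s = -1 := by push_cast; field_simp
    rw [e, abs_le]
    constructor <;> linarith
  · have : 1 ≤ (k : ℝ) / s := by
      rw [le_div_iff₀ hs']
      have : (s : ℝ) ≤ k := by exact_mod_cast c2
      linarith
    have e : (s : ℝ) / s = 1 := by field_simp
    rw [e, abs_le]
    constructor <;> linarith
  · exact h

theorem statRound_close {l m s : ℕ} {j N p q : ℤ} (u : ℤ × ℤ) (hl : 0 < l) (hm : 0 < m)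
    (hN : 0 < N) (hp : 0 < p) :
    |(statRound l m j N p q s u : ℝ) -
      s * ((u.1 + (j * q / (N * p) : ℝ) * u.2) / (m * l))| ≤ 1 / 2 := by
  have h := abs_div_sub_half (s * (u.1 * (N * p) + j * q * u.2)) (m * l * (N * p)) (by positivity)
  have hl' : (0 : ℝ) < l := by exact_mod_cast hl
  have hm' : (0 : ℝ) < m := by exact_mod_cast hm
  have hN' : (0 : ℝ) < N := by exact_mod_cast hN
  have hp' : (0 : ℝ) < p := by exact_mod_cast hp
  unfold statRound
  convert h using 3
  push_cast
  field_simp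

/-- The simulated answer to a query is accurate, except with exponentially small probability. -/
theorem stat_correct {n : ℕ} {f g : Cube n → Bool} (hf : (sat f).Nonempty)
    (hg : (sat g).Nonempty) {D : PMF (Cube n)} {φ : Cube n → Bool → ℝ}
    {pq : Cube n → Bool → ℤ × ℤ} {K S s m : ℕ} {j p q : ℤ} (hK : 1024 * (S + 1) ≤ K)
    (hs1 : 1 ≤ s) (hs : s ≤ S) (hm : 0 < m)
    (hpq : ∀ x y, 0 < (pq x y).2 ∧ |(pq x y).1| ≤ (pq x y).2 ∧
      φ x y = ((pq x y).1 : ℝ) / (pq x y).2)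
    (hD : l1 D (unifSat g hg) ≤ 2 / K) (hp : 0 < p)
    (hρ : |(j * q / ((2 ^ n : ℤ) * p) : ℝ) - ((sat f).card : ℝ) / (sat g).card| ≤
      3 / K * (((sat f).card : ℝ) / (sat g).card))
    (hρ0 : 0 ≤ (j * q / ((2 ^ n : ℤ) * p) : ℝ)) (hρ4 : (j * q / ((2 ^ n : ℤ) * p) : ℝ) ≤ 4) :
    prob (iidSum (prodDist D (unifSat f hf)) (statVar pq K g) m 0)
      {u | ¬ |∑ x, (D x).toReal * φ x (f x) -
        (clampZ s (statRound K m j (2 ^ n) p q s u) : ℝ) / s| ≤ 1 / (s : ℝ)} ≤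
      2 * Real.exp (-(m / (20736 * (S + 1) ^ 2))) := by
  have hK0 : 0 < K := by omega
  have hK' : (0 : ℝ) < K := by exact_mod_cast hK0
  have hs' : (0 : ℝ) < s := by exact_mod_cast hs1
  have hm' : (0 : ℝ) < m := by exact_mod_cast hm
  set ρ : ℝ := (j * q / ((2 ^ n : ℤ) * p) : ℝ) with hρd
  -- The rational factor `ρ` is applied only after summation, so that the program adds up integers.
  set fu : ℤ × ℤ → ℝ := fun u => u.1 + ρ * u.2 with hfu
  set e := ∑ ω, (prodDist D (unifSat f hf) ω).toReal * fu (statVar pq K g ω) with he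
  have hq1 : ∀ x y, |(qval pq K x y : ℝ)| ≤ K := by
    intro x y
    exact_mod_cast quant_bound (hpq x y).1 (hpq x y).2.1 K
  -- `K` from the first component, and at most 4 times `2 K` from the second. The deviation from the
  -- mean is then at most `18 K`.
  have hb : ∀ ω, |fu (statVar pq K g ω)| ≤ 9 * K := by
    intro ω
    have h1 := abs_le.1 (hq1 ω.1 false)
    have h2 := abs_le.1 (hq1 ω.2 false)
    have h3 := abs_le.1 (hq1 ω.2 true)
    have h4 : |((statVar pq K g ω).2 : ℝ)| ≤ 2 * K := by
      simp only [statVar]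
      split
      · push_cast
        rw [abs_le]
        constructor <;> linarith
      · simp
    have h5 : |ρ * ((statVar pq K g ω).2 : ℝ)| ≤ 4 * (2 * K) := by
      rw [abs_mul, abs_of_nonneg hρ0]
      exact mul_le_mul hρ4 h4 (abs_nonneg _) (by norm_num)
    have h6 := abs_le.1 h5
    have h7 : (statVar pq K g ω).1 = qval pq K ω.1 false := rfl
    simp only [hfu, h7]
    rw [abs_le]
    constructor <;> linarith
  have heb : |e| ≤ 9 * K := by
    rw [he]
    calc _ ≤ ∑ ω, (prodDist D (unifSat f hf) ω).toReal * (9 * (K : ℝ)) := by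
          refine (Finset.abs_sum_le_sum_abs _ _).trans (Finset.sum_le_sum fun x _ => ?_)
          rw [abs_mul, abs_of_nonneg ENNReal.toReal_nonneg]
          exact mul_le_mul_of_nonneg_left (hb x) ENNReal.toReal_nonneg
      _ = 9 * K := by rw [← Finset.sum_mul, sum_toReal, one_mul]
  have hsplit : e = ∑ x, (D x).toReal * (qval pq K x false : ℝ) +
      ∑ y, (unifSat f hf y).toReal *
        (ρ * (if g y then (qval pq K y true : ℝ) - qval pq K y false else 0)) := by
    rw [← sum_prodDist, he]
    refine Finset.sum_congr rfl fun ω _ => ?_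
    simp only [hfu, statVar]
    push_cast
    rfl
  have hmean := stat_expect_error hf hg (φ := φ) hK0 hK' hpq hD hρ hρ0 hρ4
  rw [← hsplit] at hmean
  set E := ∑ x, (D x).toReal * φ x (f x) with hE
  have hE1 : |E| ≤ 1 := by
    refine abs_expect_le _ _ fun x => ?_
    obtain ⟨h1, h2, h3⟩ := hpq x (f x)
    have h1' : (0 : ℝ) < (pq x (f x)).2 := by exact_mod_cast h1
    rw [h3, abs_div, abs_of_pos h1', div_le_one h1']
    exact_mod_cast h2
  -- The sums are in units of `1 / K`, so this allows the sampled mean a deviation of `1 / (4 (S +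
  -- 1))`.
  set t : ℝ := K / (4 * (S + 1)) with ht
  have htail := iidSum_tail (prodDist D (unifSat f hf)) (statVar pq K g) fu
    (fun u v => by simp only [hfu, Prod.fst_add, Prod.snd_add]; push_cast; ring)
    (c := 18 * K) (t := t) he.symm (fun ω => by
      have h1 := abs_le.1 (hb ω)
      have h2 := abs_le.1 heb
      rw [abs_le]
      constructor <;> linarith) (by positivity) (by positivity) (by
        rw [ht, div_le_iff₀ (by positivity)]
        have : (0 : ℝ) ≤ S := by positivity
        nlinarith) m
  have hexp : (m : ℝ) * t ^ 2 / (4 * (18 * (K : ℝ)) ^ 2) = m / (20736 * ((S : ℝ) + 1) ^ 2) := by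
    rw [ht]
    field_simp
    norm_num
  rw [hexp] at htail
  refine (prob_mono _ ?_).trans htail
  intro u hu
  simp only [Set.mem_ofPred_eq] at hu ⊢
  intro hlt
  apply hu
  refine clampZ_close (by exact_mod_cast hs1) hE1 ?_
  have h1 := statRound_close (s := s) (j := j) (q := q) (N := 2 ^ n) u hK0 hm (by positivity) hp
  have h1' : |(statRound K m j (2 ^ n) p q s u : ℝ) - s * (fu u / (m * K))| ≤ 1 / 2 := by
    convert h1 using 2
  have hround : |fu u / (m * K) - (statRound K m j (2 ^ n) p q s u : ℝ) / s| ≤ 1 / (2 * s) := by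
    have : fu u / (m * K) - (statRound K m j (2 ^ n) p q s u : ℝ) / s =
        -((statRound K m j (2 ^ n) p q s u : ℝ) - s * (fu u / (m * K))) / s := by
      field_simp
      ring
    rw [this, abs_div, abs_neg, abs_of_pos hs', div_le_div_iff₀ hs' (by positivity)]
    nlinarith
  have hsamp : |fu u / (m * K) - e / K| ≤ 1 / (4 * (S + 1)) := by
    have : fu u / (m * K) - e / K = (fu u - m * e) / (m * K) := by
      field_simp
    rw [this, abs_div, abs_of_pos (mul_pos hm' hK'), div_le_iff₀ (mul_pos hm' hK')]
    refine hlt.le.trans (le_of_eq ?_)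
    rw [ht]
    field_simp
  -- One half of the tolerance `1 / s` pays for the bias, the quantisation and the sampling, and the
  -- other half for rounding to a multiple of `1 / s`.
  have hbudget : (10 : ℝ) / K + 5 / K + 1 / (4 * (S + 1)) ≤ 1 / (2 * s) := by
    have hS1 : (0 : ℝ) < (S : ℝ) + 1 := by positivity
    have h2 : (10 : ℝ) / K + 5 / K ≤ 1 / (4 * (S + 1)) := by
      rw [← add_div, div_le_div_iff₀ hK' (by positivity)]
      have : (1024 * ((S : ℝ) + 1)) ≤ K := by exact_mod_cast hK
      nlinarith
    have h3 : (1 : ℝ) / (4 * (S + 1)) + 1 / (4 * (S + 1)) = 1 / (2 * (S + 1)) := by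
      field_simp
      norm_num
    have h4 : (1 : ℝ) / (2 * (S + 1)) ≤ 1 / (2 * s) := by
      apply one_div_le_one_div_of_le (by positivity)
      have : (s : ℝ) ≤ S := by exact_mod_cast hs
      linarith
    linarith
  have h5 : (1 : ℝ) / s = 1 / (2 * s) + 1 / (2 * s) := by field_simp; norm_num
  have a1 := abs_le.1 hmean
  have a2 := abs_le.1 hsamp
  have a3 := abs_le.1 hround
  push_cast
  rw [h5, abs_le]
  constructor <;> linarith

/-! ### Soundness and completeness of the test -/

/-- The estimate of `|f⁻¹(1)| / |g⁻¹(1)|` from a guess and an approximate count. -/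
theorem ratio_error {n : ℕ} {F G K p q : ℝ} {j : ℝ} (hF : 0 < F) (hG : 0 < G) (hK : 1 ≤ K)
    (hq : 0 < q) (hp : 0 < p) (hj1 : F ≤ j) (hj2 : j ≤ (1 + 1 / K) * F)
    (hc1 : 1 / (1 + 1 / K) * (G / 2 ^ n) ≤ p / q) (hc2 : p / q ≤ (1 + 1 / K) * (G / 2 ^ n)) :
    |j * q / (2 ^ n * p) - F / G| ≤ 3 / K * (F / G) := by
  have hN : (0 : ℝ) < 2 ^ n := by positivity
  have hK0 : 0 < K := by linarith
  have hk : 0 < 1 / K := by positivity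
  have hk1 : 1 / K ≤ 1 := by rw [div_le_one hK0]; exact hK
  set κ := 1 / K with hκ
  have e : 3 / K = 3 * κ := by rw [hκ]; ring
  set w := G / 2 ^ n with hw
  have hw0 : 0 < w := by positivity
  set z := p / q with hz
  have hz0 : 0 < z := by positivity
  -- The relative error factors into that of the guess, `j / F`, and that of the count, `w / z`.
  have e1 : j * q / (2 ^ n * p) = (F / G) * ((j / F) * (w / z)) := by
    rw [hw, hz]; field_simp
  have h1 : 1 ≤ j / F := by rw [le_div_iff₀ hF]; linarith
  have h2 : j / F ≤ 1 + κ := by rw [div_le_iff₀ hF]; exact hj2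
  have h3 : w / z ≤ 1 + κ := by
    rw [div_le_iff₀ hz0]
    rw [one_div, inv_mul_le_iff₀ (by positivity)] at hc1
    linarith
  have h4 : 1 - κ ≤ w / z := by
    rw [le_div_iff₀ hz0]
    nlinarith [mul_nonneg hk.le hk.le, mul_pos hk hw0]
  have h5 : |(j / F) * (w / z) - 1| ≤ 3 * κ := by
    rw [abs_le]
    have hpos : 0 < w / z := by positivity
    constructor <;> nlinarith
  have hFG : 0 < F / G := by positivity
  rw [e1, e]
  calc |F / G * (j / F * (w / z)) - F / G| = F / G * |(j / F) * (w / z) - 1| := by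
        rw [← abs_of_pos hFG, ← abs_mul, abs_of_pos hFG]; congr 1; ring
    _ ≤ F / G * (3 * κ) := mul_le_mul_of_nonneg_left h5 hFG.le
    _ = _ := by ring

theorem sum_indicator_unifSat {n : ℕ} (g A : Cube n → Bool) (hg : (sat g).Nonempty) :
    ∑ x, (unifSat g hg x).toReal * (if A x then 1 else 0) =
      ((sat A ∩ sat g).card : ℝ) / (sat g).card := by
  rw [sum_unifSat]
  congr 1
  rw [Finset.sum_ite, Finset.sum_const_zero, add_zero, Finset.sum_const, nsmul_eq_mul, mul_one]
  congr 2
  ext x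
  simp [sat, and_comm]

/-- The exponential decay in `R` is given away for the rate `1 / (p R)`, as the number of rounds may
be polynomial in `1 / ε`. -/
theorem one_sub_pow_le {p : ℝ} (hp : 0 < p) (hp1 : p ≤ 1) {R : ℕ} (hR : 0 < R) :
    (1 - p) ^ R ≤ 1 / (p * R) := by
  have hR' : (0 : ℝ) < R := by exact_mod_cast hR
  calc (1 - p) ^ R ≤ Real.exp (-p) ^ R :=
        pow_le_pow_left₀ (by linarith) (by linarith [Real.add_one_le_exp (-p)]) R
    _ = Real.exp (-(p * R)) := by rw [← Real.exp_nat_mul]; congr 1; ring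
    _ = 1 / Real.exp (p * R) := by rw [Real.exp_neg, one_div]
    _ ≤ 1 / (p * R) := one_div_le_one_div_of_le (by positivity)
        (by linarith [Real.add_one_le_exp (p * R)])

/-- Rejection sampling from an almost uniform distribution on `g⁻¹(1) ⊇ A`, for a set `A` that
is close to `f⁻¹(1)`. -/
theorem rejDist_close {n : ℕ} {f g A : Cube n → Bool} (hf : (sat f).Nonempty)
    (hg : (sat g).Nonempty) (hAg : ∀ x, A x = true → g x = true) {D : PMF (Cube n)}
    {κ : ℝ} {Γ R : ℕ} (x₀ : Cube n) (hκ : 0 < κ) (hκ1 : κ ≤ 1 / 64) (hΓ : 1 ≤ Γ)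
    (hD : l1 D (unifSat g hg) ≤ κ / (8 * Γ))
    (h1 : 1 - 5 * κ ≤ ((sat A ∩ sat f).card : ℝ) / (sat f).card)
    (h2 : 1 / (8 * Γ) ≤ ((sat A).card : ℝ) / (sat g).card)
    (h3 : ((sat A).card : ℝ) ≤ (1 + 16 * κ) * (sat f).card) (hR : 16 * Γ ≤ κ * R) :
    l1 (rejDist D A x₀ R) (unifSat f hf) ≤ 64 * κ := by
  have hF : (0 : ℝ) < (sat f).card := by exact_mod_cast hf.card_pos
  have hG : (0 : ℝ) < (sat g).card := by exact_mod_cast hg.card_pos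
  have hΓ' : (1 : ℝ) ≤ Γ := by exact_mod_cast hΓ
  have hp'0 : 0 < ((sat A).card : ℝ) / (sat g).card := lt_of_lt_of_le (by positivity) h2
  have hA0 : (0 : ℝ) < (sat A).card := by
    by_contra hc
    have : ((sat A).card : ℝ) = 0 := le_antisymm (not_lt.1 hc) (by positivity)
    rw [this, zero_div] at hp'0
    exact lt_irrefl _ hp'0
  have hA : (sat A).Nonempty := Finset.card_pos.1 (by exact_mod_cast hA0)
  set p' := ((sat A).card : ℝ) / (sat g).card with hp'
  set p := ∑ y, (D y).toReal * (if A y then (1 : ℝ) else 0) with hp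
  have hsub : sat A ∩ sat g = sat A := by
    ext x
    simp only [sat, Finset.mem_inter, Finset.mem_filter, Finset.mem_univ, true_and]
    exact ⟨fun h => h.1, fun h => ⟨h, hAg x h⟩⟩
  have hη : l1 D (unifSat g hg) ≤ κ * p' := by
    refine hD.trans ?_
    calc κ / (8 * Γ) = κ * (1 / (8 * Γ)) := by ring
      _ ≤ _ := mul_le_mul_of_nonneg_left h2 hκ.le
  have hpp : |p - p'| ≤ κ * p' := by
    have h := abs_expect_sub_le D (unifSat g hg) (fun x => if A x then (1 : ℝ) else 0) (M := 1)
      (fun x => by split <;> simp)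
    rw [sum_indicator_unifSat, hsub, one_mul] at h
    exact h.trans hη
  have hpp' := abs_le.1 hpp
  have hp0 : 63 / 64 * p' ≤ p := by nlinarith
  have hp00 : 0 < p := by linarith
  have hp1 : p ≤ 1 := by
    have := abs_expect_le D (fun x => if A x then (1 : ℝ) else 0) (M := 1)
      (fun x => by split <;> simp)
    exact (abs_le.1 this).2
  -- The common part has relative size at least `(1 - 5 κ) / (1 + 16 κ) ≥ 1 - 21 κ`; the `ℓ¹`
  -- distance doubles the loss.
  have hAf : l1 (unifSat A hA) (unifSat f hf) ≤ 42 * κ := by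
    have h := l1_unifSat_unifSat A f hA hf (m := (1 + 16 * κ) * (sat f).card) h3 (by nlinarith)
    refine h.trans ?_
    have h4 : (1 - 5 * κ) / (1 + 16 * κ) ≤
        ((sat A ∩ sat f).card : ℝ) / ((1 + 16 * κ) * (sat f).card) := by
      rw [mul_comm (1 + 16 * κ), ← div_div]
      exact div_le_div_of_nonneg_right h1 (by positivity)
    have h5 : 1 - 21 * κ ≤ (1 - 5 * κ) / (1 + 16 * κ) := by
      rw [le_div_iff₀ (by positivity)]
      nlinarith
    linarith
  have he : ∑ x, |(if A x then (D x).toReal else 0) - p * (unifSat f hf x).toReal| ≤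
      44 * κ * p' := by
    -- Three replacements: `D` by the uniform distribution on `g`, whose part on `A` is `p'` times
    -- uniform on `A`; then `A` by `f`; then `p'` by `p`. Summed up they cost `κ p'`, `42 κ p'` and
    -- `κ p'`.
    have hx : ∀ x, |(if A x then (D x).toReal else 0) - p * (unifSat f hf x).toReal| ≤
        |(D x).toReal - (unifSat g hg x).toReal| +
        p' * |(unifSat A hA x).toReal - (unifSat f hf x).toReal| +
        κ * p' * (unifSat f hf x).toReal := by
      intro x
      have hU : 0 ≤ (unifSat f hf x).toReal := ENNReal.toReal_nonneg
      have hgA : p' * (unifSat A hA x).toReal = if A x then (unifSat g hg x).toReal else 0 := by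
        rw [unifSat_apply, unifSat_apply, hp']
        by_cases hax : A x = true
        · simp only [hax, hAg x hax, if_true]
          field_simp
        · simp [hax]
      have h6 : |(if A x then (D x).toReal else 0) - p' * (unifSat A hA x).toReal| ≤
          |(D x).toReal - (unifSat g hg x).toReal| := by
        rw [hgA]
        split
        · exact le_rfl
        · simp
      have h7 : (if A x then (D x).toReal else 0) - p * (unifSat f hf x).toReal =
          ((if A x then (D x).toReal else 0) - p' * (unifSat A hA x).toReal) +
          (p' * ((unifSat A hA x).toReal - (unifSat f hf x).toReal) +
          (p' - p) * (unifSat f hf x).toReal) := by ring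
      rw [h7]
      refine (abs_add_le _ _).trans ?_
      refine (add_le_add h6 (abs_add_le _ _)).trans ?_
      rw [abs_mul, abs_of_pos hp'0, abs_mul, abs_of_nonneg hU, abs_sub_comm p' p, ← add_assoc]
      exact add_le_add le_rfl (mul_le_mul_of_nonneg_right hpp hU)
    refine (Finset.sum_le_sum fun x _ => hx x).trans ?_
    rw [Finset.sum_add_distrib, Finset.sum_add_distrib, ← Finset.mul_sum, ← Finset.mul_sum,
      sum_toReal]
    have h8 : p' * ∑ x, |(unifSat A hA x).toReal - (unifSat f hf x).toReal| ≤ p' * (42 * κ) :=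
      mul_le_mul_of_nonneg_left hAf hp'0.le
    have h9 : ∑ x, |(D x).toReal - (unifSat g hg x).toReal| ≤ κ * p' := hη
    linarith
  have hR0 : 0 < R := by
    rcases Nat.eq_zero_or_pos R with h | h
    · subst h
      simp at hR
      linarith
    · exact h
  have hmain := rejDist_l1_le D (unifSat f hf) A x₀ hp.symm hp00 R
  -- Dividing by `p ≥ 63 / 64 * p'` raises 44 to at most 45. With `2 κ` for the event that all
  -- rounds fail, the total stays below `64 κ`.
  have q1 : (∑ x, |(if A x then (D x).toReal else 0) - p * (unifSat f hf x).toReal|) / p ≤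
      45 * κ := by
    rw [div_le_iff₀ hp00]
    nlinarith
  have q2 : (1 - p) ^ R ≤ κ := by
    refine (one_sub_pow_le hp00 hp1 hR0).trans ?_
    have hR0' : (0 : ℝ) < R := by exact_mod_cast hR0
    rw [div_le_iff₀ (by positivity)]
    have h10 : 1 / (16 * Γ) ≤ p := by
      have : (1 : ℝ) / (16 * Γ) = 1 / 2 * (1 / (8 * Γ)) := by field_simp; norm_num
      rw [this]
      linarith
    have h11 : 1 / (16 * Γ : ℝ) * (16 * Γ) = 1 := by field_simp
    calc (1 : ℝ) = 1 / (16 * Γ : ℝ) * (16 * Γ) := h11.symm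
      _ ≤ p * (κ * R) := mul_le_mul h10 hR (by positivity) hp00.le
      _ = _ := by ring
  linarith

/-- The estimates of a test are accurate. -/
structure Accurate {n : ℕ} (f A : Cube n → Bool) (D : PMF (Cube n)) (κ : ℝ) (Γ m : ℕ)
    (u : ℤ × ℤ) : Prop where
  fst : |(u.1 : ℝ) - m * (((sat A ∩ sat f).card : ℝ) / (sat f).card)| < m * κ
  snd : |(u.2 : ℝ) - m * ∑ x, (D x).toReal * (if A x then 1 else 0)| < m * (κ / (8 * Γ))

/-- The checks that a candidate has to pass, `ca` being `1 / κ`. -/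
def Passes (ca Γ m : ℕ) (N j p q : ℤ) (u : ℤ × ℤ) : Prop :=
  0 < q ∧ (ca - 4) * m ≤ ca * u.1 ∧ m ≤ 4 * Γ * u.2 ∧
    u.2 * p * N * ca ≤ (ca + 5) * j * m * q

/-- Here `p'` is the fraction of `g` occupied by `A`, `w` is the bias of `g`, and `β`, `z` are their
estimates. Each estimate and the guess loses a factor near 1, and the constant 16 comes from `(1 +
κ) ^ 2 * (1 + 5 κ) ≤ (1 - κ) * (1 + 16 κ)` for `κ ≤ 1 / 64`. -/
theorem card_le_of_estimates {κ β p' z w j N F Ac : ℝ} (hκ0 : 0 < κ) (hκ1 : κ ≤ 1 / 64)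
    (hN : 0 < N) (hF : 0 < F) (hw : 0 < w) (hp'0 : 0 ≤ p') (hp'β : p' * (1 - κ) ≤ β)
    (hz : β * z ≤ (1 + 5 * κ) * (j / N)) (hc : w ≤ (1 + κ) * z) (hA : Ac / N = p' * w)
    (hj : j ≤ (1 + κ) * F) : Ac ≤ (1 + 16 * κ) * F := by
  have hκ2 : 0 < 1 - κ := by linarith
  have hz0 : 0 ≤ z := by
    by_contra h
    have : (1 + κ) * z ≤ 0 := mul_nonpos_of_nonneg_of_nonpos (by linarith) (not_le.1 h).le
    linarith
  have k1 : (1 - κ) * (Ac / N) ≤ (1 + κ) * ((1 + 5 * κ) * (j / N)) := by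
    rw [hA]
    calc (1 - κ) * (p' * w) = (p' * (1 - κ)) * w := by ring
      _ ≤ (p' * (1 - κ)) * ((1 + κ) * z) := mul_le_mul_of_nonneg_left hc (by positivity)
      _ ≤ β * ((1 + κ) * z) := mul_le_mul_of_nonneg_right hp'β (by positivity)
      _ = (1 + κ) * (β * z) := by ring
      _ ≤ _ := mul_le_mul_of_nonneg_left hz (by positivity)
  have k2 : (1 - κ) * Ac ≤ (1 + κ) * ((1 + 5 * κ) * j) := by
    have := mul_le_mul_of_nonneg_right k1 hN.le
    have e1 : (1 - κ) * (Ac / N) * N = (1 - κ) * Ac := by field_simp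
    have e2 : (1 + κ) * ((1 + 5 * κ) * (j / N)) * N = (1 + κ) * ((1 + 5 * κ) * j) := by
      field_simp
    rwa [e1, e2] at this
  have k3 : (1 + κ) * ((1 + 5 * κ) * j) ≤ (1 + κ) * ((1 + 5 * κ) * ((1 + κ) * F)) := by gcongr
  have k4 : (1 + κ) * ((1 + 5 * κ) * (1 + κ)) ≤ (1 - κ) * (1 + 16 * κ) := by
    have a1 : κ * κ ≤ 1 / 64 * κ := mul_le_mul_of_nonneg_right hκ1 hκ0.le
    have a2 : κ * κ * κ ≤ 1 / 64 * κ :=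
      mul_le_mul_of_nonneg_right (by linarith) hκ0.le
    have e : (1 - κ) * (1 + 16 * κ) - (1 + κ) * ((1 + 5 * κ) * (1 + κ)) =
      8 * κ - 27 * (κ * κ) - 5 * (κ * κ * κ) := by ring
    linarith
  have k5 : (1 - κ) * Ac ≤ (1 - κ) * ((1 + 16 * κ) * F) := by
    calc (1 - κ) * Ac ≤ (1 + κ) * ((1 + 5 * κ) * (1 + κ)) * F := by linarith
      _ ≤ (1 - κ) * (1 + 16 * κ) * F := mul_le_mul_of_nonneg_right k4 hF.le
      _ = _ := by ring
  exact le_of_mul_le_mul_left k5 hκ2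

theorem abs_mean_sub_le {U m pD p' ξ : ℝ} (hm : 0 < m) (h1 : |U - m * pD| < m * ξ)
    (h2 : |pD - p'| ≤ ξ) : |U / m - p'| ≤ 2 * ξ := by
  have e : U / m = (U - m * pD) / m + pD := by field_simp; ring
  have e1 : |(U - m * pD) / m| ≤ ξ := by
    rw [abs_div, abs_of_pos hm, div_le_iff₀ hm, mul_comm ξ]
    exact h1.le
  have e2 := abs_le.1 e1
  have e3 := abs_le.1 h2
  rw [e, abs_le]
  constructor <;> linarith

theorem check_fst_iff {c m U : ℝ} (hc : 0 < c) :
    (c - 4) * m ≤ c * U ↔ (1 - 4 * (1 / c)) * m ≤ U := by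
  have e : (c - 4) * m = c * ((1 - 4 * (1 / c)) * m) := by field_simp
  rw [e, mul_le_mul_iff_right₀ hc]

theorem check_snd_iff {m U Γ : ℝ} (hm : 0 < m) (hΓ : 0 < Γ) :
    m ≤ 4 * Γ * U ↔ 1 / (4 * Γ) ≤ U / m := by
  rw [div_le_div_iff₀ (by positivity) hm, one_mul, mul_comm U]

theorem check_card_iff {c m U p q N j : ℝ} (hc : 0 < c) (hm : 0 < m) (hq : 0 < q) (hN : 0 < N) :
    U * p * N * c ≤ (c + 5) * j * m * q ↔ U / m * (p / q) ≤ (1 + 5 * (1 / c)) * (j / N) := by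
  have e1 : U / m * (p / q) = (U * p * N * c) / (m * q * N * c) := by field_simp
  have e2 : (1 + 5 * (1 / c)) * (j / N) = ((c + 5) * j * m * q) / (m * q * N * c) := by
    field_simp
  rw [e1, e2, div_le_div_iff_of_pos_right (by positivity)]

/-- The program checks integer inequalities with denominators cleared. The real form compares
empirical frequencies with thresholds; the last check bounds the estimated size of `A` by the guess.
-/
theorem passes_iff {ca Γ m N j : ℕ} {p q : ℤ} {u : ℤ × ℤ} (hca : 64 ≤ ca) (hΓ : 1 ≤ Γ)
    (hm : 0 < m) (hN : 0 < N) : Passes ca Γ m N j p q u ↔ 0 < q ∧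
      (1 - 4 * (1 / ca : ℝ)) * m ≤ u.1 ∧ 1 / (4 * (Γ : ℝ)) ≤ (u.2 : ℝ) / m ∧
      (u.2 : ℝ) / m * (p / q) ≤ (1 + 5 * (1 / ca : ℝ)) * (j / N) := by
  have hca' : (0 : ℝ) < ca := by exact_mod_cast (by omega : 0 < ca)
  have hm' : (0 : ℝ) < m := by exact_mod_cast hm
  have hΓ' : (0 : ℝ) < Γ := by exact_mod_cast hΓ
  have hN' : (0 : ℝ) < N := by exact_mod_cast hN
  unfold Passes
  refine and_congr_right fun hq => ?_
  have hq' : (0 : ℝ) < q := by exact_mod_cast hq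
  rw [← check_fst_iff hca', ← check_snd_iff hm' hΓ', ← check_card_iff hca' hm' hq' hN']
  norm_cast

theorem inter_eq_left_of_imp {n : ℕ} {A g : Cube n → Bool} (h : ∀ x, A x = true → g x = true) :
    sat A ∩ sat g = sat A := by
  ext x
  simp only [sat, Finset.mem_inter, Finset.mem_filter, Finset.mem_univ, true_and]
  exact ⟨fun h => h.1, fun h' => ⟨h', h x h'⟩⟩

theorem abs_expect_indicator_sub_le {n : ℕ} {g A : Cube n → Bool} (hg : (sat g).Nonempty)
    (hAg : ∀ x, A x = true → g x = true) (D : PMF (Cube n)) :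
    |∑ x, (D x).toReal * (if A x then (1 : ℝ) else 0) - ((sat A).card : ℝ) / (sat g).card| ≤
      l1 D (unifSat g hg) := by
  have hpp := abs_expect_sub_le D (unifSat g hg) (fun x => if A x then (1 : ℝ) else 0) (M := 1)
    (fun x => by split <;> simp)
  rwa [sum_indicator_unifSat, inter_eq_left_of_imp hAg, one_mul] at hpp

/-- Neither the densifier nor the learner enters: accurate estimates alone certify that `A` covers
`f`, is not rare in `g`, and is hardly larger than `f`. The last point needs a guess that is not
much too large, which is why the guesses are tried in increasing order. -/
theorem passes_sound {n : ℕ} {f g A : Cube n → Bool} (hf : (sat f).Nonempty)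
    (hg : (sat g).Nonempty) (hAg : ∀ x, A x = true → g x = true) {D : PMF (Cube n)}
    {ca Γ m j : ℕ} {p q : ℤ} {u : ℤ × ℤ} (hca : 64 ≤ ca) (hΓ : 1 ≤ Γ) (hm : 0 < m)
    (hD : l1 D (unifSat g hg) ≤ 1 / ca / (8 * Γ))
    (hacc : Accurate f A D (1 / ca) Γ m u)
    (hc1 : 1 / (1 + 1 / (ca : ℝ)) * bias g ≤ (p : ℝ) / q)
    (hj : (j : ℝ) ≤ (1 + 1 / ca) * (sat f).card)
    (h : Passes ca Γ m (2 ^ n : ℕ) j p q u) :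
    1 - 5 * (1 / ca : ℝ) ≤ ((sat A ∩ sat f).card : ℝ) / (sat f).card ∧
    (1 : ℝ) / (8 * Γ) ≤ ((sat A).card : ℝ) / (sat g).card ∧
    ((sat A).card : ℝ) ≤ (1 + 16 * (1 / ca)) * (sat f).card := by
  have hca' : (64 : ℝ) ≤ ca := by exact_mod_cast hca
  have hm' : (0 : ℝ) < m := by exact_mod_cast hm
  have hF : (0 : ℝ) < (sat f).card := by exact_mod_cast hf.card_pos
  have hG : (0 : ℝ) < (sat g).card := by exact_mod_cast hg.card_pos
  have hΓ' : (1 : ℝ) ≤ Γ := by exact_mod_cast hΓ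
  have hca0 : (0 : ℝ) < ca := by linarith
  obtain ⟨hq, c1, c2, c3⟩ := (passes_iff hca hΓ hm (by positivity)).1 h
  have hbu := abs_mean_sub_le hm' hacc.snd ((abs_expect_indicator_sub_le hg hAg D).trans hD)
  have hα := hacc.fst
  have hκ0 : (0 : ℝ) < 1 / ca := by positivity
  have hκ1 : (1 : ℝ) / ca ≤ 1 / 64 := one_div_le_one_div_of_le (by norm_num) hca'
  have hξ : 2 * ((1 : ℝ) / ca / (8 * Γ)) = 1 / ca * (1 / (4 * Γ)) := by field_simp; norm_num
  have hA : ((sat A).card : ℝ) / (2 ^ n : ℕ) =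
      ((sat A).card : ℝ) / (sat g).card * ((sat g).card / (2 ^ n : ℕ)) := by field_simp
  have hw : (0 : ℝ) < (sat g).card / (2 ^ n : ℕ) := by positivity
  have hc1' : (sat g).card / (2 ^ n : ℕ) ≤ (1 + 1 / ca) * (p / q : ℝ) := by
    rw [bias, one_div, inv_mul_le_iff₀ (by positivity)] at hc1
    exact_mod_cast hc1
  have hN : (0 : ℝ) < (2 ^ n : ℕ) := by positivity
  have hp'0 : 0 ≤ ((sat A).card : ℝ) / (sat g).card := by positivity
  have h4 : (0 : ℝ) < 1 / (4 * Γ) := by positivity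
  have h8 : (1 : ℝ) / (8 * Γ) = 1 / 2 * (1 / (4 * Γ)) := by field_simp; norm_num
  rw [hξ] at hbu
  rw [h8]
  generalize (1 : ℝ) / (4 * Γ) = ζ at *
  generalize ((sat A ∩ sat f).card : ℝ) / (sat f).card = α at *
  generalize ((sat A).card : ℝ) / (sat g).card = p' at *
  generalize (u.2 : ℝ) / m = β at *
  generalize (1 : ℝ) / ca = κ at *
  have hbu' := abs_le.1 hbu
  have hκζ : κ * ζ ≤ 1 / 64 * ζ := mul_le_mul_of_nonneg_right hκ1 h4.le
  have hκβ : κ * ζ ≤ κ * β := mul_le_mul_of_nonneg_left c2 hκ0.le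
  -- The sampling error `κ ζ` is relative to `β`, because the second check guarantees `ζ ≤ β`.
  have hp'β : p' * (1 - κ) ≤ β := by
    have h1 : p' * (1 - κ) ≤ (β * (1 + κ)) * (1 - κ) :=
      mul_le_mul_of_nonneg_right (by linarith) (by linarith)
    have h2 : (β * (1 + κ)) * (1 - κ) = β - β * (κ * κ) := by ring
    have h3 : 0 ≤ β * (κ * κ) := mul_nonneg (by linarith) (by positivity)
    linarith
  refine ⟨?_, by linarith, ?_⟩
  · have h2 : m * (1 - 5 * κ) ≤ m * α := by
      have := abs_lt.1 hα
      linarith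
    exact le_of_mul_le_mul_left h2 hm'
  · exact card_le_of_estimates hκ0 hκ1 hN hF hw hp'0 hp'β c3 hc1' hA hj

/-- The agreement of an accurate hypothesis with `f` on the satisfying set of `g`. -/
theorem card_disagree_le {n : ℕ} {f g φ : Cube n → Bool} (hg : (sat g).Nonempty)
    {D : PMF (Cube n)} {ca Γ : ℕ} (hca : 64 ≤ ca) (hΓ : 1 ≤ Γ)
    (hD : l1 D (unifSat g hg) ≤ 1 / ca / (8 * Γ)) (hgf : 1 / (Γ : ℝ) ≤ condProb g f)
    (herr : err D φ f ≤ 1 / ((ca * Γ : ℕ) : ℝ)) :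
    (((sat g).filter fun x => φ x ≠ f x).card : ℝ) ≤
      2 * (1 / ca) * ((sat f ∩ sat g).card : ℝ) := by
  have hca0 : (0 : ℝ) < ca := by exact_mod_cast (by omega : 0 < ca)
  have hG : (0 : ℝ) < (sat g).card := by exact_mod_cast hg.card_pos
  have hΓ0 : (0 : ℝ) < Γ := by exact_mod_cast hΓ
  have hcond2 : ((sat g).card : ℝ) ≤ Γ * ((sat f ∩ sat g).card : ℝ) := by
    rw [condProb, div_le_div_iff₀ (by positivity) hG, Finset.inter_comm] at hgf
    linarith
  have e1 : ∑ x, (unifSat g hg x).toReal * (if φ x = f x then (0 : ℝ) else 1) =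
      (((sat g).filter fun x => φ x ≠ f x).card : ℝ) / (sat g).card := by
    rw [sum_unifSat]
    congr 1
    rw [Finset.sum_ite, Finset.sum_const_zero, zero_add, Finset.sum_const, nsmul_eq_mul, mul_one]
  have e2 := abs_expect_sub_le D (unifSat g hg) (fun x => if φ x = f x then (0 : ℝ) else 1)
    (M := 1) (fun x => by split <;> simp)
  have e3 : ∑ x, (D x).toReal * (if φ x = f x then (0 : ℝ) else 1) = err D φ f := by
    rw [err]
    refine Finset.sum_congr rfl fun x _ => ?_
    split <;> simp
  rw [e1, e3, one_mul] at e2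
  have e4 := (abs_le.1 (e2.trans hD)).1
  have e5 : (1 : ℝ) / ((ca * Γ : ℕ) : ℝ) = 1 / ca / Γ := by push_cast; field_simp
  rw [e5] at herr
  -- The learner's error contributes `1 / ca / Γ`, and the passage from `D` to the uniform
  -- distribution an eighth of that.
  have e6 : (((sat g).filter fun x => φ x ≠ f x).card : ℝ) / (sat g).card ≤ 2 * (1 / ca / Γ) := by
    have : (1 : ℝ) / ca / (8 * Γ) = 1 / 8 * (1 / ca / Γ) := by field_simp
    have h0 : (0 : ℝ) < 1 / ca / Γ := by positivity
    linarith
  rw [div_le_iff₀ hG] at e6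
  refine e6.trans ?_
  calc 2 * (1 / (ca : ℝ) / Γ) * (sat g).card ≤
        2 * (1 / ca / Γ) * (Γ * ((sat f ∩ sat g).card : ℝ)) := by gcongr
    _ = _ := by field_simp

/-- Inside `g` the hypothesis differs from `f` on at most `2 κ` times the common part of `f` and
`g`, so `A` nearly equals that common part. The thresholds of the checks leave room for this and for
the estimation errors. -/
theorem passes_complete {n : ℕ} {f g φ : Cube n → Bool} (hf : (sat f).Nonempty)
    (hg : (sat g).Nonempty) {D : PMF (Cube n)}
    {ca Γ m j : ℕ} {p q : ℤ} {u : ℤ × ℤ} (hca : 64 ≤ ca) (hΓ : 1 ≤ Γ) (hm : 0 < m)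
    (hD : l1 D (unifSat g hg) ≤ 1 / ca / (8 * Γ))
    (hacc : Accurate f (fun x => g x && φ x) D (1 / ca) Γ m u) (hq : 0 < q)
    (hc2 : (p : ℝ) / q ≤ (1 + 1 / (ca : ℝ)) * bias g)
    (hp : 0 < p) (hj : ((sat f).card : ℝ) ≤ j)
    (hfg : 1 - 1 / (ca : ℝ) ≤ condProb f g) (hgf : 1 / (Γ : ℝ) ≤ condProb g f)
    (herr : err D φ f ≤ 1 / ((ca * Γ : ℕ) : ℝ)) :
    Passes ca Γ m (2 ^ n : ℕ) j p q u := by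
  classical
  have hca' : (64 : ℝ) ≤ ca := by exact_mod_cast hca
  have hm' : (0 : ℝ) < m := by exact_mod_cast hm
  have hF : (0 : ℝ) < (sat f).card := by exact_mod_cast hf.card_pos
  have hG : (0 : ℝ) < (sat g).card := by exact_mod_cast hg.card_pos
  have hΓ' : (1 : ℝ) ≤ Γ := by exact_mod_cast hΓ
  have hca0 : (0 : ℝ) < ca := by linarith
  have hq' : (0 : ℝ) < q := by exact_mod_cast hq
  have hp' : (0 : ℝ) < p := by exact_mod_cast hp
  have hcond1 : (1 - 1 / ca) * (sat f).card ≤ ((sat f ∩ sat g).card : ℝ) := by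
    rwa [condProb, le_div_iff₀ hF] at hfg
  have hcond2 : 1 / Γ * ((sat g).card : ℝ) ≤ ((sat f ∩ sat g).card : ℝ) := by
    rwa [condProb, le_div_iff₀ hG, Finset.inter_comm] at hgf
  have hbad := card_disagree_le hg hca hΓ hD hgf herr
  have hAsub : (sat fun x => g x && φ x).card ≤
      (sat f ∩ sat g).card + ((sat g).filter fun x => φ x ≠ f x).card := by
    refine (Finset.card_le_card ?_).trans (Finset.card_union_le _ _)
    intro x hx
    simp only [sat, Finset.mem_union, Finset.mem_inter, Finset.mem_filter,
      Finset.mem_univ, true_and, Bool.and_eq_true] at hx ⊢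
    by_cases h : φ x = f x
    · exact Or.inl ⟨h ▸ hx.2, hx.1⟩
    · exact Or.inr ⟨hx.1, h⟩
  have hfsub : (sat f ∩ sat g).card ≤ ((sat fun x => g x && φ x) ∩ sat f).card +
      ((sat g).filter fun x => φ x ≠ f x).card := by
    refine (Finset.card_le_card ?_).trans (Finset.card_union_le _ _)
    intro x hx
    simp only [sat, Finset.mem_union, Finset.mem_inter, Finset.mem_filter,
      Finset.mem_univ, true_and, Bool.and_eq_true] at hx ⊢
    by_cases h : φ x = f x
    · exact Or.inl ⟨⟨hx.2, h ▸ hx.1⟩, hx.1⟩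
    · exact Or.inr ⟨hx.2, h⟩
  have hAf : ((sat fun x => g x && φ x) ∩ sat f).card ≤ (sat fun x => g x && φ x).card :=
    Finset.card_le_card Finset.inter_subset_left
  have hfgF : (sat f ∩ sat g).card ≤ (sat f).card := Finset.card_le_card Finset.inter_subset_left
  have hAg : ∀ x, (g x && φ x) = true → g x = true := fun x h => (Bool.and_eq_true _ _ ▸ h).1
  have hbu := abs_mean_sub_le hm' hacc.snd ((abs_expect_indicator_sub_le hg hAg D).trans hD)
  have hα := hacc.fst
  rw [passes_iff hca hΓ hm (by positivity)]
  generalize (sat fun x => g x && φ x) = A at *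
  generalize ((sat g).filter fun x => φ x ≠ f x) = bad at *
  have hAsub' : (A.card : ℝ) ≤ ((sat f ∩ sat g).card : ℝ) + bad.card := by exact_mod_cast hAsub
  have hfsub' : ((sat f ∩ sat g).card : ℝ) ≤ ((A ∩ sat f).card : ℝ) + bad.card := by
    exact_mod_cast hfsub
  have hAf' : ((A ∩ sat f).card : ℝ) ≤ A.card := by exact_mod_cast hAf
  have hfgF' : ((sat f ∩ sat g).card : ℝ) ≤ (sat f).card := by exact_mod_cast hfgF
  have hN : (0 : ℝ) < (2 ^ n : ℕ) := by positivity
  have hc2' : (p : ℝ) / q ≤ (1 + 1 / (ca : ℝ)) * ((sat g).card / (2 ^ n : ℕ)) := by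
    rw [bias] at hc2
    exact_mod_cast hc2
  have hκ0 : (0 : ℝ) < 1 / ca := by positivity
  have hκ1 : (1 : ℝ) / ca ≤ 1 / 64 := one_div_le_one_div_of_le (by norm_num) hca'
  have hξ : 2 * ((1 : ℝ) / ca / (8 * Γ)) = 1 / 4 * (1 / ca * (1 / Γ)) := by ring
  have h4 : (1 : ℝ) / (4 * Γ) = 1 / 4 * (1 / Γ) := by ring
  have hΓ0 : (0 : ℝ) < 1 / Γ := by positivity
  have hpq : (0 : ℝ) < p / q := by positivity
  have hfg0 : (0 : ℝ) ≤ (sat f ∩ sat g).card := by positivity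
  have hαd : ((A ∩ sat f).card : ℝ) = ((A ∩ sat f).card : ℝ) / (sat f).card * (sat f).card :=
    (div_mul_cancel₀ _ hF.ne').symm
  have hpd : (A.card : ℝ) = (A.card : ℝ) / (sat g).card * (sat g).card :=
    (div_mul_cancel₀ _ hG.ne').symm
  have hp'0 : (0 : ℝ) ≤ (A.card : ℝ) / (sat g).card :=
    div_nonneg (Nat.cast_nonneg _) (Nat.cast_nonneg _)
  rw [hξ] at hbu
  rw [h4]
  clear hc2 hD hacc hfg hgf herr hAsub hfsub hAf hfgF hξ h4 hp hq hAg
  generalize ((A ∩ sat f).card : ℝ) / (sat f).card = α at *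
  generalize (A.card : ℝ) / (sat g).card = p' at *
  generalize (u.2 : ℝ) / m = β at *
  generalize (1 : ℝ) / ca = κ at *
  generalize (1 : ℝ) / Γ = ζ at *
  generalize ((A ∩ sat f).card : ℝ) = Af at *
  generalize (A.card : ℝ) = Ac at *
  generalize ((sat f ∩ sat g).card : ℝ) = fg at *
  generalize (bad.card : ℝ) = bd at *
  generalize ((sat f).card : ℝ) = F at *
  generalize ((sat g).card : ℝ) = G at *
  generalize ((2 ^ n : ℕ) : ℝ) = N at *
  generalize (p / q : ℝ) = z at *
  have hbu' := abs_le.1 hbu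
  have hα' := abs_lt.1 hα
  have hκF : κ * fg ≤ κ * F := mul_le_mul_of_nonneg_left hfgF' hκ0.le
  have hκκ : κ * κ ≤ 1 / 64 * κ := mul_le_mul_of_nonneg_right hκ1 hκ0.le
  have hα1 : 1 - 3 * κ ≤ α := by
    have : (1 - 3 * κ) * F ≤ α * F := by linarith
    exact le_of_mul_le_mul_right this hF
  have hp'1 : (1 - 2 * κ) * ζ ≤ p' := by
    have h1 : (1 - 2 * κ) * (ζ * G) ≤ (1 - 2 * κ) * fg :=
      mul_le_mul_of_nonneg_left hcond2 (by linarith)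
    have : (1 - 2 * κ) * ζ * G ≤ p' * G := by linarith
    exact le_of_mul_le_mul_right this hG
  have hκζ : κ * ζ ≤ 1 / 64 * ζ := mul_le_mul_of_nonneg_right hκ1 hΓ0.le
  have hζp : ζ ≤ 2 * p' := by linarith
  have hκp : κ * ζ ≤ κ * (2 * p') := mul_le_mul_of_nonneg_left hζp hκ0.le
  have hβ : β ≤ (1 + κ) * p' := by linarith
  refine ⟨by exact_mod_cast hq', ?_, by linarith, ?_⟩
  · have : m * (1 - 3 * κ) ≤ m * α := mul_le_mul_of_nonneg_left hα1 hm'.le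
    linarith
  · have hA2 : Ac ≤ (1 + 2 * κ) * j := by
      have : (1 + 2 * κ) * fg ≤ (1 + 2 * κ) * j :=
        mul_le_mul_of_nonneg_left (hfgF'.trans hj) (by linarith)
      linarith
    have hj0 : 0 ≤ (j : ℝ) / N := by positivity
    calc β * z ≤ (1 + κ) * p' * ((1 + κ) * (G / N)) :=
          mul_le_mul hβ hc2' hpq.le (by positivity)
      _ = (1 + κ) * (1 + κ) * (p' * G / N) := by ring
      _ = (1 + κ) * (1 + κ) * (Ac / N) := by rw [← hpd]
      _ ≤ (1 + κ) * (1 + κ) * (((1 + 2 * κ) * j) / N) := by gcongr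
      _ = (1 + κ) * (1 + κ) * (1 + 2 * κ) * (j / N) := by ring
      -- `(1 + κ) ^ 2 * (1 + 2 κ) ≤ 1 + 5 κ`, because `κ ≤ 1 / 64`.
      _ ≤ _ := by
          refine mul_le_mul_of_nonneg_right ?_ hj0
          have a2 : κ * κ * κ ≤ 1 / 64 * κ :=
            mul_le_mul_of_nonneg_right (by linarith) hκ0.le
          linarith

/-! ### Learning from simulated statistical queries -/

/-- Condition a distribution on a likely event. -/
theorem exists_restrict {α : Type} (P : PMF α) (E : Set α) {η : ℝ} (h : prob P Eᶜ ≤ η)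
    (hη : η < 1) : ∃ Q : PMF α, (∀ a ∈ Q.support, a ∈ E ∧ a ∈ P.support) ∧
      ∀ a, ENNReal.ofReal (1 - η) * Q a ≤ P a := by
  have hE : 1 - η ≤ prob P E := by rw [prob_compl] at h; linarith
  have h1 : ENNReal.ofReal (1 - η) ≤ P.toOuterMeasure E := ENNReal.ofReal_le_of_le_toReal hE
  have hs : ∃ a ∈ E, a ∈ P.support := by
    by_contra hc
    have h0 : P.toOuterMeasure E = 0 := by
      rw [PMF.toOuterMeasure_apply_eq_zero_iff, Set.disjoint_left]
      exact fun a ha hE => hc ⟨a, hE, ha⟩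
    rw [prob, h0, ENNReal.toReal_zero] at hE
    linarith
  refine ⟨P.filter E hs, fun a ha => (PMF.mem_support_filter_iff hs).1 ha, fun a => ?_⟩
  rw [PMF.filter_apply, ← PMF.toOuterMeasure_apply]
  have h2 : P.toOuterMeasure E ≠ 0 := by
    intro h0
    rw [prob, h0, ENNReal.toReal_zero] at hE
    linarith
  calc ENNReal.ofReal (1 - η) * (E.indicator P a * (P.toOuterMeasure E)⁻¹)
      ≤ P.toOuterMeasure E * (E.indicator P a * (P.toOuterMeasure E)⁻¹) := mul_le_mul_left h1 _
    _ = E.indicator P a := by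
        rw [mul_comm (E.indicator P a), ← mul_assoc, ENNReal.mul_inv_cancel h2 (outer_ne_top P E),
          one_mul]
    _ ≤ P a := Set.indicator_le_self _ _ _

theorem prob_ge_of_dom {p p' : PMF (Option Val)} {θ : ℝ} (hθ : 0 ≤ θ)
    (h : ∀ v, ENNReal.ofReal θ * p (some v) ≤ p' (some v)) {E : Set (Option Val)}
    (hE : none ∉ E) : θ * prob p E ≤ prob p' E := by
  have : ENNReal.ofReal θ * p.toOuterMeasure E ≤ p'.toOuterMeasure E := by
    rw [PMF.toOuterMeasure_apply, PMF.toOuterMeasure_apply, ← ENNReal.tsum_mul_left]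
    refine ENNReal.tsum_le_tsum fun o => ?_
    by_cases ho : o ∈ E
    · rw [Set.indicator_of_mem ho, Set.indicator_of_mem ho]
      cases o with
      | none => exact absurd ho hE
      | some v => exact h v
    · rw [Set.indicator_of_notMem ho, mul_zero]
      exact zero_le
  have h2 := ENNReal.toReal_mono (outer_ne_top p' E) this
  rwa [ENNReal.toReal_mul, ENNReal.toReal_ofReal hθ] at h2

/-- The program of a query determines its function, so the accuracy of an answer does not depend on
the witness chosen for admissibility. -/
theorem QueryComputes.unique {n t : ℕ} {χ : Val} {φ φ' : Cube n → Bool → ℝ}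
    (h : QueryComputes t χ φ) (h' : QueryComputes t χ φ') : φ = φ' := by
  funext x y
  obtain ⟨p, q, -, -, h1, h2⟩ := h x y
  obtain ⟨p', q', -, -, h1', h2'⟩ := h' x y
  rw [h1'] at h1
  have h3 : (some (Val.pair (.int p') (.int q'))) = some (.pair (.int p) (.int q)) := by
    have : some (Val.pair (.int p') (.int q')) ∈
        (PMF.pure (some (Val.pair (.int p) (.int q)))).support := by rw [← h1]; simp
    simpa using this
  simp only [Option.some.injEq, Val.pair.injEq, Val.int.injEq] at h3
  rw [h2, h2', h3.1, h3.2]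

/-- An SQ learner tolerates an oracle whose answers are accurate with high probability only. -/
theorem IsSQLearner.learns_of_prob {C : ConceptClass} {A : Code} {t₁ : ℕ → ℕ → ℕ → ℕ}
    {t₂ : ℕ → ℕ} {tauInv : ℕ → ℕ → ℕ} (hA : IsSQLearner C A t₁ t₂ tauInv) {n a b : ℕ}
    (ha : 1 ≤ a) (hb : 1 ≤ b) {f : Cube n → Bool} (hf : f ∈ C n) {D : PMF (Cube n)}
    {R : Val → PMF (Option Val)} (hR : Answers n (t₂ n) (tauInv n a) R) {η : ℝ} (hη0 : 0 ≤ η)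
    (hη : η < 1)
    (hgood : ∀ (s : ℕ) (χ : Val) (φ : Cube n → Bool → ℝ), 1 ≤ s → s ≤ tauInv n a →
      QueryComputes (t₂ n) χ φ → prob (R (.pair (.int s) χ))
        {w | ∃ k : ℤ, w = some (.int k) ∧
          |∑ x, (D x).toReal * φ x (f x) - (k : ℝ) / s| ≤ 1 / (s : ℝ)}ᶜ ≤ η) :
    1 - 1 / (b : ℝ) - t₁ n a b * η ≤ prob (exec (sqOracle R D) (t₁ n a b) (program A)
        (args n a b (.pair (.orc 0) (.orc 1))))
      {w | ∃ (h : Val) (φ : Cube n → Bool), w = some h ∧ Computes (t₁ n a b) h φ ∧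
        err D φ f ≤ 1 / (a : ℝ)} := by
  -- The answer to an admissible query is conditioned on being accurate; inadmissible queries keep
  -- their answer. Memoryless oracles allow this query by query.
  have hex : ∀ v, ∃ Q : PMF (Option Val), (∀ w ∈ Q.support, w ∈ (R v).support) ∧
      (∀ w, ENNReal.ofReal (1 - η) * Q w ≤ R v w) ∧
      ∀ (s : ℕ) (χ : Val) (φ : Cube n → Bool → ℝ), v = .pair (.int s) χ → 1 ≤ s →
        s ≤ tauInv n a → QueryComputes (t₂ n) χ φ →
        ∀ k : ℤ, some (.int k) ∈ Q.support →
          |∑ x, (D x).toReal * φ x (f x) - (k : ℝ) / s| ≤ 1 / (s : ℝ) := by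
    intro v
    by_cases hv : Admissible n (t₂ n) (tauInv n a) v
    · obtain ⟨s, χ, φ, rfl, hs1, hs, hφ⟩ := hv
      obtain ⟨Q, h1, h2⟩ := exists_restrict _ _ (hgood s χ φ hs1 hs hφ) hη
      refine ⟨Q, fun w hw => (h1 w hw).2, h2, ?_⟩
      intro s' χ' φ' he hs1' hs' hφ' k hk
      simp only [Val.pair.injEq, Val.int.injEq, Nat.cast_inj] at he
      obtain ⟨rfl, rfl⟩ := he
      obtain ⟨k', hk', h3⟩ := (h1 _ hk).1
      simp only [Option.some.injEq, Val.int.injEq] at hk'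
      rw [hk', hφ'.unique hφ]
      exact h3
    · refine ⟨R v, fun w hw => hw, fun w => ?_, ?_⟩
      · calc ENNReal.ofReal (1 - η) * R v w ≤ 1 * R v w :=
              mul_le_mul_left (by rw [ENNReal.ofReal_le_one]; linarith) _
          _ = _ := one_mul _
      · intro s χ φ he hs1 hs hφ
        exact absurd ⟨s, χ, φ, he, hs1, hs, hφ⟩ hv
  choose R' h1 h2 h3 using hex
  have hR' : IsStat f D (t₂ n) (tauInv n a) R' := by
    refine ⟨⟨fun s χ hv w hw => hR.admissible s χ hv w (h1 _ w hw), fun v hv => ?_⟩,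
      fun s χ φ hs1 hs hφ k hk => h3 _ s χ φ rfl hs1 hs hφ k hk⟩
    -- The new answer is supported where the old one is, and the latter is a point mass at `none`.
    have h4 := h1 v
    rw [hR.otherwise v hv, PMF.support_pure] at h4
    obtain ⟨w, hw⟩ := (R' v).support_nonempty
    have hsup : (R' v).support = {none} :=
      Set.Subset.antisymm h4 (by rintro _ rfl; have := h4 w hw; rwa [Set.mem_singleton_iff.1 this] at hw)
    ext o
    by_cases ho : o = none
    · rw [ho, ((R' v).apply_eq_one_iff none).2 hsup]
      simp
    · rw [((R' v).apply_eq_zero_iff o).2 (by rw [hsup]; exact ho)]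
      simp [ho]
  have hlearn := hA.learns n a b ha hb f hf D R' hR'
  have hθ : ENNReal.ofReal (1 - η) ≤ 1 := by rw [ENNReal.ofReal_le_one]; linarith
  have hO : ∀ k v w, ENNReal.ofReal (1 - η) * sqOracle R' D k v (some w) ≤
      sqOracle R D k v (some w) := by
    intro k v w
    unfold sqOracle
    split_ifs
    · exact h2 v _
    · exact (mul_le_mul_left hθ _).trans (one_mul _).le
    · exact (mul_le_mul_left hθ _).trans (one_mul _).le
  have hdom := exec_dom hθ hO (t₁ n a b) (program A) (args n a b (.pair (.orc 0) (.orc 1)))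
  simp only [← ENNReal.ofReal_pow (show 0 ≤ 1 - η by linarith)] at hdom
  have hfin := prob_ge_of_dom (pow_nonneg (show 0 ≤ 1 - η by linarith) _) hdom
    (E := {w | ∃ (h : Val) (φ : Cube n → Bool), w = some h ∧ Computes (t₁ n a b) h φ ∧
        err D φ f ≤ 1 / (a : ℝ)}) (by rintro ⟨h, φ, hc, -⟩; simp at hc)
  refine le_trans ?_ hfin
  -- Bernoulli's inequality.
  have hb1 : 1 - (t₁ n a b : ℝ) * η ≤ (1 - η) ^ t₁ n a b := by
    have := one_add_mul_le_pow (show (-2 : ℝ) ≤ -η by linarith) (t₁ n a b)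
    have e : (1 : ℝ) + -η = 1 - η := by ring
    rw [e] at this
    linarith
  have hb2 : (1 - η) ^ t₁ n a b ≤ 1 := pow_le_one₀ (by linarith) (by linarith)
  have hb0 : (0 : ℝ) ≤ 1 / b := by positivity
  have hb3 : (1 - η) ^ t₁ n a b * (1 - 1 / (b : ℝ)) ≤ _ :=
    mul_le_mul_of_nonneg_left hlearn (pow_nonneg (by linarith) _)
  refine le_trans ?_ hb3
  have hb4 : (1 - η) ^ t₁ n a b * (1 / (b : ℝ)) ≤ 1 * (1 / b) := mul_le_mul_of_nonneg_right hb2 hb0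
  linarith

/-- The context of a simulated statistical query oracle. -/
def statCtx (A o : Val) (l m j N p q : ℤ) : Val :=
  .pair A (.pair o (.pair (.int l) (.pair (.int m) (.pair (.int j) (.pair (.int N)
    (.pair (.int p) (.int q)))))))

/-- The body of a closure that answers statistical queries. -/
def statBody (Agen ev : Code) : Code := .app (.proc (stat Agen ev)) (.pair (.var 2) (.var 0))

/-- The body of a closure that draws points. -/
def drawBody (Agen : Code) : Code := .app (.proc (draw Agen)) (.fst (.var 2))

/-- The closures that replace the oracles of an SQ learner. -/
def sqSubst (Agen ev : Code) (E : Val) : ℕ → Val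
  | 0 => .clo (statBody Agen ev) E
  | 1 => .clo (drawBody Agen) E
  | k + 2 => .orc k

theorem sqSubst_isFn (Agen ev : Code) (E : Val) (k : ℕ) : (sqSubst Agen ev E k).IsFn := by
  match k with
  | 0 => trivial
  | 1 => trivial
  | k + 2 => trivial

theorem width_sqSubst (Agen ev : Code) {E : Val} {L : ℕ} (h : E.width ≤ L) (k : ℕ) :
    (sqSubst Agen ev E k).width ≤ L := by
  match k with
  | 0 => exact h
  | 1 => exact h
  | k + 2 => exact Nat.zero_le _

/-- The function value `h` computes `φ` within `t` steps, whatever the oracles. -/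
def ComputesAlways {n : ℕ} (t : ℕ) (h : Val) (φ : Cube n → Bool) : Prop :=
  ∀ O x, CallRuns O h (enc x) t (PMF.pure (Val.bit (φ x)))

/-- The value `h` runs without oracles and never aborts, so the handles inside it are never called,
and it does not matter what replaces them. Hence a hypothesis of the learner can be used in a
sampler that has no oracle. -/
theorem Computes.subst {n t : ℕ} {h : Val} {φ : Cube n → Bool} (hc : Computes t h φ)
    {σ : ℕ → Val} (hσ : ∀ k, (σ k).IsFn) : ComputesAlways (t + 1) (h.subst σ) φ := by
  intro O x
  have := (callRuns_of_noOracle (f := h) (a := enc x) (T := t) (μ := PMF.pure (Val.bit (φ x)))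
    (B := max t (max h.width (enc x).width)) (by simp) (by simp) (by simp)
    (by rw [hc x, PMF.pure_map])).2 O σ hσ
  rwa [PMF.pure_map, subst_enc, subst_bit] at this

/-- The answer of the simulated oracle to a query, as a distribution. -/
theorem exists_answer (O : Oracle) {Agen ev : Code} {L T n a b l m t S : ℕ} {j N p q : ℤ}
    {r o E : Val} {g : Cube n → Bool} {D U : PMF (Cube n)} (hL : 2 ^ 30 ≤ L)
    (hE : E.fst = statCtx (args n a b r) o l m j N p q) (hEw : E.width ≤ L) (hl : l < L)
    (hm : m < L) (hml : m * (2 * l) < L) (hT : T < L) (ht : t + 1 < L)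
    (hD : CallRuns O (program (draw Agen)) (args n a b r) (L ^ 5) (D.map enc))
    (hU : CallRuns O o (.int 0) 1 (U.map enc))
    (hg : ∀ x, exec noOracle T (program ev) (.pair (.int n) (.pair r (enc x)))
      = PMF.pure (some (Val.bit (g x)))) (v : Val) :
    ∃ Q : PMF (Option Val), (¬ Admissible n t S v → Q = PMF.pure none) ∧
      ∀ (s : ℕ) (χ : Val) (φ : Cube n → Bool → ℝ), v = .pair (.int s) χ → 1 ≤ s → s ≤ S →
        QueryComputes t χ φ → ∃ pq : Cube n → Bool → ℤ × ℤ,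
          (∀ x y, 0 < (pq x y).2 ∧ |(pq x y).1| ≤ (pq x y).2 ∧
            φ x y = ((pq x y).1 : ℝ) / (pq x y).2) ∧
          Q = (iidSum (prodDist D U) (statVar pq l g) m 0).map (fun u =>
            some (.int (clampZ s (statRound l m j N p q s u)))) ∧
          (v.width ≤ L → CallRuns O (sqSubst Agen ev E 0) (v.subst (sqSubst Agen ev E))
            (L ^ 9 + L ^ 2) ((iidSum (prodDist D U) (statVar pq l g) m 0).map fun u =>
              .int (clampZ s (statRound l m j N p q s u)))) := by
  by_cases hv : Admissible n t S v
  swap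
  · exact ⟨PMF.pure none, fun _ => rfl, fun s χ φ he h1 h2 h3 => absurd ⟨s, χ, φ, he, h1, h2, h3⟩ hv⟩
  obtain ⟨s, χ, φ, rfl, hs1, hs, hφ⟩ := hv
  choose p' q' h0 h1 h2 h3 using hφ
  refine ⟨(iidSum (prodDist D U) (statVar (fun x y => (p' x y, q' x y)) l g) m 0).map (fun u =>
    some (.int (clampZ s (statRound l m j N p q s u)))),
    fun h => absurd ⟨s, χ, φ, rfl, hs1, hs, fun x y => ⟨p' x y, q' x y, h0 x y, h1 x y, h2 x y,
      h3 x y⟩⟩ h, ?_⟩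
  intro s' χ' φ' he hs1' hs' hφ'
  simp only [Val.pair.injEq, Val.int.injEq, Nat.cast_inj] at he
  obtain ⟨rfl, rfl⟩ := he
  have hφφ : φ' = φ := hφ'.unique (fun x y => ⟨p' x y, q' x y, h0 x y, h1 x y, h2 x y, h3 x y⟩)
  refine ⟨fun x y => (p' x y, q' x y), fun x y => ⟨h0 x y, h1 x y, hφφ ▸ h3 x y⟩, rfl, ?_⟩
  intro hvw
  have hσ := sqSubst_isFn Agen ev E
  have hσw := width_sqSubst Agen ev hEw
  have hc : (statCtx (args n a b r) o l m j N p q).width ≤ L := by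
    rw [← hE]; exact (width_fst E).trans hEw
  simp only [statCtx, Val.width, max_le_iff] at hc
  simp only [Val.width, max_le_iff] at hvw
  have hx : ∀ x : Cube n, (enc x).width ≤ L := fun x => (width_enc x).trans (by omega)
  have hbit : ∀ b, (Val.bit b).width ≤ L := fun x => (width_bit x).trans (by omega)
  have hstat := stat_runs O (Agen := Agen) (ev := ev) (s := s) (χ := χ.subst (sqSubst Agen ev E))
    (pq := fun x y => (p' x y, q' x y)) (B := t + 1) (j := j) (N := N) (p := p) (q := q)
    hL hc.1 hc.2.1 (width_subst hσw χ hvw.2) hl hm hml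
    hc.2.2.2.2.1 hc.2.2.2.2.2.1 hc.2.2.2.2.2.2.1 hc.2.2.2.2.2.2.2 hvw.1 hT ht hD hU hg (by
      intro x y
      have hr := callRuns_of_noOracle (T := t) (B := L) (f := χ)
        (a := .pair (enc x) (Val.bit y)) (μ := PMF.pure (encPair (p' x y, q' x y))) hvw.2
        (max_le (hx x) (hbit y)) (by omega) (by rw [h2 x y, PMF.pure_map]; rfl)
      refine ⟨h0 x y, h1 x y, hr.1 _ (by simp), ?_⟩
      have := hr.2 O _ hσ
      rw [PMF.pure_map] at this
      simpa only [Val.subst, subst_enc, subst_bit, encPair] using this)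
  have hw : (Val.pair ((Val.pair (.int s) χ).subst (sqSubst Agen ev E))
      (.pair (sqSubst Agen ev E 0) E)).width ≤ L :=
    max_le (width_subst hσw _ (max_le hvw.1 hvw.2)) (max_le (hσw 0) hEw)
  refine runs_call hL hw rfl rfl ?_ hstat
  change Val.pair E.fst _ = _
  rw [hE]
  rfl

/-- The analysis runs the learner on the mathematical oracle `R` given by the laws of the simulated
answers, and `callRuns_of_exec` transfers the run to the closures. Halting holds for any guess and
count, as `R` always answers in the required form. Accuracy is needed only for the probability
bound. -/
theorem learner_runs (O : Oracle) {C : ConceptClass} {Asq : Code} {t₁ : ℕ → ℕ → ℕ → ℕ}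
    {t₂ : ℕ → ℕ} {tauInv : ℕ → ℕ → ℕ} (hA : IsSQLearner C Asq t₁ t₂ tauInv)
    {Agen ev : Code} {L T n a b a₃ b₃ l m : ℕ} {j N p q : ℤ}
    {r o E : Val} {g : Cube n → Bool} {D U : PMF (Cube n)} (hL : 2 ^ 30 ≤ L)
    (ha : 1 ≤ a) (hb : 1 ≤ b) (haw : (Val.int a).width ≤ L) (hbw : (Val.int b).width ≤ L)
    (hn : n < L)
    (hE : E.fst = statCtx (args n a₃ b₃ r) o l m j N p q) (hEw : E.width ≤ L) (hl : l < L)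
    (hm : m < L) (hml : m * (2 * l) < L) (hT : T < L) (ht₁ : t₁ n a b < L) (ht : t₂ n + 1 < L)
    (hD : CallRuns O (program (draw Agen)) (args n a₃ b₃ r) (L ^ 5) (D.map enc))
    (hU : CallRuns O o (.int 0) 1 (U.map enc))
    (hg : ∀ x, exec noOracle T (program ev) (.pair (.int n) (.pair r (enc x)))
      = PMF.pure (some (Val.bit (g x)))) :
    ∃ μ : PMF Val, CallRuns O (program Asq) (args n a b (.pair (.clo (statBody Agen ev) E)
        (.clo (drawBody Agen) E))) (L ^ 11) μ ∧
      (∀ v ∈ μ.support, v.width ≤ L ∧ ∃ φ : Cube n → Bool, ComputesAlways (t₁ n a b + 1) v φ) ∧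
      ∀ f ∈ C n, ∀ η : ℝ, 0 ≤ η → η < 1 →
        (∀ (s : ℕ) (φ : Cube n → Bool → ℝ) (pq : Cube n → Bool → ℤ × ℤ), 1 ≤ s →
          s ≤ tauInv n a →
          (∀ x y, 0 < (pq x y).2 ∧ |(pq x y).1| ≤ (pq x y).2 ∧
            φ x y = ((pq x y).1 : ℝ) / (pq x y).2) →
          prob (iidSum (prodDist D U) (statVar pq l g) m 0)
            {u | ¬ |∑ x, (D x).toReal * φ x (f x) -
              (clampZ s (statRound l m j N p q s u) : ℝ) / s| ≤ 1 / (s : ℝ)} ≤ η) →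
        prob μ {v | ¬ ∃ φ : Cube n → Bool, ComputesAlways (t₁ n a b + 1) v φ ∧
          err D φ f ≤ 1 / (a : ℝ)} ≤ 1 / b + t₁ n a b * η := by
  -- `R` is defined on all queries, wide ones included; only for queries of width at most `L` is
  -- there a run that realises it.
  choose R hR1 hR2 using exists_answer O (S := tauInv n a) hL hE hEw hl hm hml hT ht hD hU hg
  have hσ := sqSubst_isFn Agen ev E
  have hσw := width_sqSubst Agen ev hEw
  have hsR : ∀ (s : ℕ) (χ : Val), Admissible n (t₂ n) (tauInv n a) (.pair (.int s) χ) →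
      ∀ w ∈ (R (.pair (.int s) χ)).support, ∃ k : ℤ, |k| ≤ s ∧ w = some (.int k) := by
    rintro s χ ⟨s', χ', φ, he, hs1, hs, hφ⟩ w hw
    simp only [Val.pair.injEq, Val.int.injEq, Nat.cast_inj] at he
    obtain ⟨rfl, rfl⟩ := he
    obtain ⟨pq, -, h2, -⟩ := hR2 _ s χ φ rfl hs1 hs hφ
    rw [h2, PMF.support_map] at hw
    obtain ⟨u, -, rfl⟩ := hw
    exact ⟨_, abs_clampZ_le (by positivity) _, rfl⟩
  have hans : Answers n (t₂ n) (tauInv n a) R := ⟨hsR, hR1⟩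
  have hsim : Simulates (sqOracle R D) O (sqSubst Agen ev E) (L ^ 9 + L ^ 2) L := by
    intro k v hv hn
    match k with
    | 0 =>
      have hn' : none ∉ (R v).support := hn
      by_cases hadm : Admissible n (t₂ n) (tauInv n a) v
      swap
      · rw [hR1 v hadm] at hn'
        simp at hn'
      obtain ⟨s, χ, φ, rfl, hs1, hs, hφ⟩ := hadm
      obtain ⟨pq, -, h2, h3⟩ := hR2 _ s χ φ rfl hs1 hs hφ
      refine ⟨_, ?_, ?_, h3 hv⟩
      · change R _ = _
        rw [h2, PMF.map_comp]
        rfl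
      · intro w hw
        rw [PMF.support_map] at hw
        obtain ⟨u, -, rfl⟩ := hw
        refine ⟨rfl, ?_⟩
        -- Clamping keeps the answer no wider than the integer `s` in the query, as the simulation
        -- requires.
        have h4 : |clampZ s (statRound l m j N p q s u)| ≤ s := abs_clampZ_le (by positivity) _
        have h5 : (Val.int (s : ℤ)).width ≤ L := (le_max_left _ _).trans hv
        refine le_trans (Nat.size_le_size ?_) h5
        zify
        simpa using h4
    | 1 =>
      refine ⟨D.map enc, ?_, ?_, ?_⟩
      · change D.map _ = _
        rw [PMF.map_comp]
        rfl
      · intro w hw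
        rw [PMF.support_map] at hw
        obtain ⟨x, -, rfl⟩ := hw
        exact ⟨subst_enc x, (width_enc x).trans (by omega)⟩
      · have hw : (Val.pair (v.subst (sqSubst Agen ev E)) (.pair (sqSubst Agen ev E 1) E)).width ≤
            L := max_le (width_subst hσw v hv) (max_le (hσw 1) hEw)
        refine CallRuns.mono (B := L ^ 5 + L ^ 2) ?_ ?_
        · refine runs_call hL hw rfl rfl ?_ hD
          change E.fst.fst = _
          rw [hE]
          rfl
        · have := Nat.pow_le_pow_right (show 0 < L by omega) (show 5 ≤ 9 by norm_num)
          omega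
    | k + 2 => exact absurd (by simp [sqOracle]) hn
  have hhalt := hA.halts n a b ha hb D R hans
  obtain ⟨μ, hμ⟩ := exists_map_some (exec (sqOracle R D) (t₁ n a b) (program Asq)
      (args n a b (.pair (.orc 0) (.orc 1)))) (by
    rw [PMF.apply_eq_zero_iff]
    intro hc
    obtain ⟨h, φ, he, -⟩ := hhalt _ hc
    simp at he)
  have haw' : (args n a b (.pair (.orc 0) (.orc 1))).width ≤ L := by
    simp only [args, Val.width, max_le_iff] at haw hbw ⊢
    exact ⟨size_le_of_le hn.le, haw, hbw, by simp⟩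
  obtain ⟨hw, hrun⟩ := callRuns_of_exec hσ hsim (f := program Asq) (by simp [program, Val.width])
    haw' ht₁.le hμ
  refine ⟨μ.map (Val.subst (sqSubst Agen ev E)), hrun.mono ?_, ?_, ?_⟩
  · have h1 : L ^ 9 + L ^ 2 + 1 ≤ L ^ 10 := by
      have := Nat.pow_le_pow_right (show 0 < L by omega) (show 2 ≤ 9 by norm_num)
      have h3 : 0 < L ^ 9 := by positivity
      have : 3 * L ^ 9 ≤ L ^ 10 := by
        rw [pow_succ L 9, mul_comm]; exact Nat.mul_le_mul_left _ (by omega)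
      omega
    calc _ ≤ L ^ 10 * L := Nat.mul_le_mul h1 ht₁
      _ = L ^ 11 := by ring
  · intro v hv
    rw [PMF.support_map] at hv
    obtain ⟨w, hw', rfl⟩ := hv
    obtain ⟨h, φ, he, hc⟩ := hhalt (some w) (by rw [hμ, PMF.support_map]; exact ⟨w, hw', rfl⟩)
    simp only [Option.some.injEq] at he
    subst he
    exact ⟨width_subst hσw w (hw w hw'), φ, hc.subst hσ⟩
  · intro f hf η hη0 hη hgood
    have hl := hA.learns_of_prob ha hb hf hans hη0 hη (D := D) (by
      intro s χ φ hs1 hs hφ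
      obtain ⟨pq, h1, h2, -⟩ := hR2 _ s χ φ rfl hs1 hs hφ
      rw [h2, prob_map]
      refine le_trans (prob_mono _ ?_) (hgood s φ pq hs1 hs h1)
      intro u hu hc
      exact hu ⟨_, rfl, hc⟩)
    rw [hμ, prob_map] at hl
    rw [prob_map]
    have h2 := prob_compl μ (some ⁻¹' {w | ∃ (h : Val) (φ : Cube n → Bool), w = some h ∧
      Computes (t₁ n a b) h φ ∧ err D φ f ≤ 1 / (a : ℝ)})
    refine le_trans (prob_mono _ ?_) (show prob μ _ ≤ _ from h2.le.trans (by linarith))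
    intro w hw' hc
    obtain ⟨h, φ, he, h3, h4⟩ := hc
    simp only [Option.some.injEq] at he
    subst he
    exact hw' ⟨φ, h3.subst hσ, h4⟩

/-! ### Runs of the ingredients -/

/-- A point `x` is output with probability `(1 - q) D(x)`, so `l1_unifSat_le` applies. The failure
symbol is decoded to an arbitrary point, which costs at most `2 q`. -/
theorem genDist_close {C' : RepClass} {Agen : Code} {T : ℕ → ℕ → ℕ → ℕ}
    (hA : IsApproxGen C' Agen T) {n a b : ℕ} (ha : 1 ≤ a) (hb : 1 ≤ b) {r : Val}
    (hr : r ∈ C'.Rep n) (hg : (sat (C'.fn n r)).Nonempty) :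
    l1 (genDist Agen (T n a b) n a b r) (unifSat (C'.fn n r) hg) ≤ 2 * (1 / b) + 1 / a := by
  obtain ⟨D, h0, h1, h2⟩ := hA.correct n a ha r hr hg
  obtain ⟨q, hq, hq', h3⟩ := h2 b hb
  have hG : (0 : ℝ) < (sat (C'.fn n r)).card := by exact_mod_cast hg.card_pos
  have ha' : (1 : ℝ) ≤ a := by exact_mod_cast ha
  have hq0 : 0 ≤ q := hq' ▸ prob_nonneg _ _
  have hle : l1 (genDist Agen (T n a b) n a b r) (unifSat (C'.fn n r) hg) ≤ 2 * q + 1 / a := by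
    refine l1_unifSat_le _ hg D _ hq0 (fun x hx => by rw [h0 x hx, ENNReal.toReal_zero]) ?_ ?_
    · intro x hx
      obtain ⟨u1, u2⟩ := h1 x hx
      have hinv : 1 - 1 / (a : ℝ) ≤ 1 / (1 + 1 / (a : ℝ)) := by
        rw [le_div_iff₀ (by positivity)]
        nlinarith [sq_nonneg (1 / (a : ℝ))]
      have hG1 : (0 : ℝ) < 1 / ((sat (C'.fn n r)).card : ℝ) := by positivity
      have h4 := mul_le_mul_of_nonneg_right hinv hG1.le
      have e : 1 / (a : ℝ) / ((sat (C'.fn n r)).card : ℝ) =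
          1 / a * (1 / ((sat (C'.fn n r)).card : ℝ)) := by ring
      rw [e, abs_le]
      constructor <;> linarith
    · intro x
      rw [← h3 x, ← prob_singleton, genDist, prob_map]
      refine prob_mono _ ?_
      rintro _ rfl
      exact dec_enc x
  linarith

theorem count_runs (O : Oracle) {C' : RepClass} {A : Code} {T : ℕ → ℕ → ℕ → ℕ}
    (hA : IsApproxCount C' A T) {L n a b : ℕ} (ha : 1 ≤ a) (hb : 1 ≤ b) {r : Val}
    (hr : r ∈ C'.Rep n) (hw : (args n a b r).width ≤ L) (hT : T n a b ≤ L) :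
    ∃ μ : PMF Val, CallRuns O (program A) (args n a b r) (T n a b + 1) μ ∧
      (∀ v ∈ μ.support, v.width ≤ L) ∧
      prob μ {v | ¬ (0 < (decPair v).2 ∧
        1 / (1 + 1 / (a : ℝ)) * bias (C'.fn n r) ≤ ((decPair v).1 : ℝ) / (decPair v).2 ∧
        ((decPair v).1 : ℝ) / (decPair v).2 ≤ (1 + 1 / (a : ℝ)) * bias (C'.fn n r))} ≤ 1 / b := by
  obtain ⟨μ, hμ⟩ := exists_map_some _ (hA.halts n a b ha hb r hr)
  refine ⟨μ, callRuns_of_noOracle' hμ O, (callRuns_of_noOracle (f := program A) (B := L)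
    (by simp [Val.width, program]) hw hT hμ).1, ?_⟩
  have h := hA.correct n a b ha hb r hr
  rw [hμ, prob_map] at h
  have h2 := prob_compl μ (some ⁻¹' {w | ∃ p q : ℤ, w = some (Val.pair (.int p) (.int q)) ∧ 0 < q ∧
        1 / (1 + 1 / (a : ℝ)) * bias (C'.fn n r) ≤ (p : ℝ) / q ∧
        (p : ℝ) / q ≤ (1 + 1 / (a : ℝ)) * bias (C'.fn n r)})
  refine le_trans (prob_mono _ ?_) (show prob μ _ ≤ _ from h2.le.trans (by linarith))
  rintro w hw' ⟨p, q, he, h3⟩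
  simp only [Option.some.injEq] at he
  subst he
  exact hw' h3

theorem sampleOracle_runs {n : ℕ} (D : PMF (Cube n)) (v : Val) :
    CallRuns (sampleOracle D) (.orc 0) v 1 (D.map enc) :=
  callRuns_orc (by rw [PMF.map_comp]; rfl)

theorem densifier_runs {C : ConceptClass} {C' : RepClass} {gammaInv T : ℕ → ℕ → ℕ → ℕ} {A : Code}
    (hA : IsDensifier C C' gammaInv A T) {L n a b j : ℕ} (hL : 2 ^ 30 ≤ L) (ha : 1 ≤ a)
    (hb : 1 ≤ b) {f : Cube n → Bool} (hfC : f ∈ C n) (hf : (sat f).Nonempty) (hj : 1 ≤ j)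
    (hj' : j ≤ 2 ^ n) (hw : (args n a b (.pair (.int j) (.orc 0))).width ≤ L) (hT : T n a b < L) :
    ∃ μ : PMF Val, CallRuns (sampleOracle (unifSat f hf)) (program A)
        (args n a b (.pair (.int j) (.orc 0))) (L ^ 2) μ ∧
      (∀ r ∈ μ.support, r.width ≤ L ∧ r ∈ C'.Rep n ∧ ∀ x : Cube n,
        exec noOracle (T n a b) (program C'.ev) (.pair (.int n) (.pair r (enc x)))
          = PMF.pure (some (Val.bit (C'.fn n r x)))) ∧
      (bias f ≤ (j : ℝ) / 2 ^ n → (j : ℝ) / 2 ^ n < (1 + 1 / (a : ℝ)) * bias f →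
        prob μ {r | ¬ (1 - 1 / (a : ℝ) ≤ condProb f (C'.fn n r) ∧
          1 / (gammaInv n a b : ℝ) ≤ condProb (C'.fn n r) f)} ≤ 1 / b) := by
  have hh := hA.halts n a b ha hb f hfC hf j hj hj'
  obtain ⟨μ, hμ⟩ := exists_map_some (exec (sampleOracle (unifSat f hf)) (T n a b) (program A)
    (args n a b (.pair (.int j) (.orc 0)))) (by
      rw [PMF.apply_eq_zero_iff]
      intro hc
      obtain ⟨r, -, he, -⟩ := hh _ hc
      simp at he)
  have hsim : Simulates (sampleOracle (unifSat f hf)) (sampleOracle (unifSat f hf)) Val.orc 1 L := by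
    refine simulates_self fun k v w hw => ?_
    unfold sampleOracle at hw
    split_ifs at hw
    · rw [PMF.support_map] at hw
      obtain ⟨x, -, he⟩ := hw
      simp only [Option.some.injEq] at he
      rw [← he]
      exact (width_enc x).trans (by omega)
    · simp at hw
  obtain ⟨h1, h2⟩ := callRuns_of_exec (σ := Val.orc) (fun _ => trivial) hsim (f := program A)
    (by simp [Val.width, program]) hw hT.le hμ
  rw [subst_orc, subst_orc, map_subst_orc] at h2
  refine ⟨μ, h2.mono ?_, ?_, ?_⟩
  · nlinarith
  · intro r hr
    obtain ⟨r', hr', he, hev⟩ := hh (some r) (by rw [hμ, PMF.support_map]; exact ⟨r, hr, rfl⟩)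
    simp only [Option.some.injEq] at he
    subst he
    exact ⟨h1 r hr, hr', hev⟩
  · intro hj1 hj2
    have h := hA.dense n a b ha hb f hfC hf j hj hj' hj1 hj2
    rw [hμ, prob_map] at h
    have h3 := prob_compl μ (some ⁻¹' {w | ∃ r ∈ C'.Rep n, w = some r ∧
        1 - 1 / (a : ℝ) ≤ condProb f (C'.fn n r) ∧
        1 / (gammaInv n a b : ℝ) ≤ condProb (C'.fn n r) f})
    refine le_trans (prob_mono _ ?_) (show prob μ _ ≤ _ from h3.le.trans (by linarith))
    rintro w hw' ⟨r, -, he, h4⟩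
    simp only [Option.some.injEq] at he
    subst he
    exact hw' h4

/-! ### Runs with guarantees -/

/-- The run of `t` halts within `B` steps, its value satisfies `Sure` with certainty, and `Good`
except with probability `δ`. -/
def Meets (O : Oracle) (env : Val) (t : Code) (B : ℕ) (Sure Good : Val → Prop) (δ : ℝ) : Prop :=
  ∃ μ : PMF Val, Runs O env t B μ ∧ (∀ v ∈ μ.support, Sure v) ∧ prob μ {v | ¬ Good v} ≤ δ

theorem Meets.mono {O : Oracle} {env : Val} {t : Code} {B B' : ℕ} {Sure Good : Val → Prop}
    {δ δ' : ℝ} (h : Meets O env t B Sure Good δ) (hB : B ≤ B') (hδ : δ ≤ δ') :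
    Meets O env t B' Sure Good δ' := by
  obtain ⟨μ, h1, h2, h3⟩ := h
  exact ⟨μ, h1.mono hB, h2, h3.trans hδ⟩

theorem Meets.imp {O : Oracle} {env : Val} {t : Code} {B : ℕ} {Sure Good Sure' Good' : Val → Prop}
    {δ : ℝ} (h : Meets O env t B Sure Good δ) (hS : ∀ v, Sure v → Sure' v)
    (hG : ∀ v, Sure v → Good v → Good' v) : Meets O env t B Sure' Good' δ := by
  obtain ⟨μ, h1, h2, h3⟩ := h
  refine ⟨μ, h1, fun v hv => hS v (h2 v hv), le_trans (prob_mono_support _ ?_) h3⟩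
  exact fun v hv hn hg => hn (hG v (h2 v hv) hg)

theorem Meets.of_pure {O : Oracle} {env v : Val} {t : Code} {B : ℕ} {Sure Good : Val → Prop}
    {δ : ℝ} (h : Runs O env t B (PMF.pure v)) (hS : Sure v) (hG : Good v) (hδ : 0 ≤ δ) :
    Meets O env t B Sure Good δ := by
  classical
  refine ⟨_, h, by simpa using hS, ?_⟩
  rw [prob_pure, if_neg (by simpa using hG)]
  exact hδ

/-- The second phase may rely on `Sure` for halting. For success it may also suppose `Good`, whose
failure is paid for by `δ`. -/
theorem Meets.let_ {O : Oracle} {env : Val} {s t : Code} {B B' : ℕ}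
    {Sure Good Sure' Good' : Val → Prop} {δ δ' : ℝ} (hδ' : 0 ≤ δ')
    (hs : Meets O env s B Sure Good δ)
    (ht : ∀ v, Sure v → Meets O (.pair v (.pair (.clo t env) env)) t B' Sure'
      (fun w => Good v → Good' w) δ') :
    Meets O env (let_ s t) (B + B' + 4) Sure' Good' (δ + δ') := by
  classical
  obtain ⟨μ, h1, h2, h3⟩ := hs
  have ht' : ∀ v, ∃ κ : PMF Val, Sure v →
      Runs O (.pair v (.pair (.clo t env) env)) t B' κ ∧ (∀ w ∈ κ.support, Sure' w) ∧
        prob κ {w | ¬ (Good v → Good' w)} ≤ δ' := by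
    intro v
    by_cases hv : Sure v
    · obtain ⟨κ, hκ⟩ := ht v hv
      exact ⟨κ, fun _ => hκ⟩
    -- A dummy law for values that do not occur.
    · exact ⟨PMF.pure (.int 0), fun h => absurd h hv⟩
  choose κ hκ using ht'
  refine ⟨μ.bind κ, runs_let h1 fun v hv => (hκ v (h2 v hv)).1, ?_, ?_⟩
  · intro w hw
    rw [PMF.mem_support_bind_iff] at hw
    obtain ⟨v, hv, hw⟩ := hw
    exact (hκ v (h2 v hv)).2.1 w hw
  · refine prob_bind_le μ κ _ {v | ¬ Good v} hδ' h3 fun v hv hg => ?_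
    refine le_trans (prob_mono _ ?_) (hκ v (h2 v hv)).2.2
    intro w hw hc
    exact hw (hc (not_not.1 hg))

theorem Meets.let_pure {O : Oracle} {env v : Val} {s t : Code} {B B' : ℕ}
    {Sure Good : Val → Prop} {δ : ℝ} (hs : Runs O env s B (PMF.pure v))
    (ht : Meets O (.pair v (.pair (.clo t env) env)) t B' Sure Good δ) :
    Meets O env (InvGen.let_ s t) (B + B' + 4) Sure Good δ := by
  obtain ⟨μ, h1, h2⟩ := ht
  exact ⟨μ, runs_let_pure hs h1, h2⟩

/-! ### Candidates -/

theorem prob_union_le {α : Type} (p : PMF α) (E F : Set α) :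
    prob p (E ∪ F) ≤ prob p E + prob p F := by
  unfold prob
  rw [← ENNReal.toReal_add (outer_ne_top p E) (outer_ne_top p F)]
  exact ENNReal.toReal_mono (ENNReal.add_ne_top.2 ⟨outer_ne_top p E, outer_ne_top p F⟩)
    (MeasureTheory.measure_union_le E F)

theorem expect_indicator_mem {n : ℕ} (D : PMF (Cube n)) (A : Cube n → Bool) :
    0 ≤ ∑ x, (D x).toReal * (if A x then (1 : ℝ) else 0) ∧
      ∑ x, (D x).toReal * (if A x then (1 : ℝ) else 0) ≤ 1 := by
  constructor
  · refine Finset.sum_nonneg fun x _ => mul_nonneg ENNReal.toReal_nonneg ?_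
    split <;> simp
  · refine (Finset.sum_le_sum fun x _ => mul_le_of_le_one_right ENNReal.toReal_nonneg ?_).trans
      (sum_toReal D).le
    split <;> simp

/-- The finer of the two tolerances, `κ / (8 Γ)`, governs both tails. -/
theorem accurate_tail {n : ℕ} {f : Cube n → Bool} (hf : (sat f).Nonempty) (A : Cube n → Bool)
    (D : PMF (Cube n)) {κ η : ℝ} {Γ m : ℕ} (hκ : 0 ≤ κ) (hκ1 : κ ≤ 1) (hΓ : 1 ≤ Γ)
    (hη : 2 * Real.exp (-(m * (κ / (8 * Γ)) ^ 2 / 4)) ≤ η) :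
    prob (iidSum (prodDist D (unifSat f hf)) (testVar A) m 0)
      {u | ¬ Accurate f A D κ Γ m u} ≤ 2 * η := by
  have hΓ' : (1 : ℝ) ≤ Γ := by exact_mod_cast hΓ
  have hξ0 : 0 ≤ κ / (8 * Γ) := by positivity
  have hξ1 : κ / (8 * Γ) ≤ κ := div_le_self hκ (by linarith)
  have hi : ∀ x : Cube n, (if A x then (1 : ℝ) else 0) = 0 ∨ (if A x then (1 : ℝ) else 0) = 1 := by
    intro x; split <;> simp
  have e1 : ∑ ω, (prodDist D (unifSat f hf) ω).toReal * ((testVar A ω).1 : ℝ) =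
      ((sat A ∩ sat f).card : ℝ) / (sat f).card := by
    have := sum_prodDist D (unifSat f hf) (fun _ => 0) (fun y => if A y then (1 : ℝ) else 0)
    rw [sum_indicator_unifSat] at this
    simp only [zero_add, mul_zero, Finset.sum_const_zero] at this
    rw [← this]
    refine Finset.sum_congr rfl fun ω _ => ?_
    simp only [testVar]
    split <;> simp
  have e2 : ∑ ω, (prodDist D (unifSat f hf) ω).toReal * ((testVar A ω).2 : ℝ) =
      ∑ x, (D x).toReal * (if A x then (1 : ℝ) else 0) := by
    have := sum_prodDist D (unifSat f hf) (fun y => if A y then (1 : ℝ) else 0) (fun _ => 0)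
    simp only [add_zero, mul_zero, Finset.sum_const_zero] at this
    rw [← this]
    refine Finset.sum_congr rfl fun ω _ => ?_
    simp only [testVar]
    split <;> simp
  have b1 := expect_indicator_mem (unifSat f hf) A
  rw [sum_indicator_unifSat] at b1
  have b2 := expect_indicator_mem D A
  have t1 := iidSum_tail (prodDist D (unifSat f hf)) (testVar A) (fun u => (u.1 : ℝ))
    (fun s t => by simp) e1 (c := 1) (t := κ) (fun ω => by
      have : ((testVar A ω).1 : ℝ) = 0 ∨ ((testVar A ω).1 : ℝ) = 1 := by
        simp only [testVar]; split <;> simp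
      rw [abs_le]
      rcases this with h | h <;> rw [h] <;> constructor <;> linarith) one_pos hκ (by linarith) m
  have t2 := iidSum_tail (prodDist D (unifSat f hf)) (testVar A) (fun u => (u.2 : ℝ))
    (fun s t => by simp) e2 (c := 1) (t := κ / (8 * Γ)) (fun ω => by
      have : ((testVar A ω).2 : ℝ) = 0 ∨ ((testVar A ω).2 : ℝ) = 1 := by
        simp only [testVar]; split <;> simp
      rw [abs_le]
      rcases this with h | h <;> rw [h] <;> constructor <;> linarith) one_pos hξ0 (by linarith) m
  have hm : (0 : ℝ) ≤ m := by positivity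
  have t1' := t1.trans (show _ ≤ η by
    refine le_trans (mul_le_mul_of_nonneg_left (Real.exp_le_exp.2 ?_) (by norm_num)) hη
    have : (κ / (8 * Γ)) ^ 2 ≤ κ ^ 2 := pow_le_pow_left₀ hξ0 hξ1 2
    have := mul_le_mul_of_nonneg_left this hm
    norm_num
    linarith)
  have t2' := t2.trans (show _ ≤ η by simpa using hη)
  rw [two_mul]
  refine le_trans (le_trans (prob_mono _ ?_) (prob_union_le _ _ _)) (add_le_add t1' t2')
  intro u hu
  by_contra hc
  simp only [Set.mem_union, not_or, Set.mem_ofPred_eq, not_not] at hc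
  exact hu ⟨hc.1, hc.2⟩

/-- The term `(n, (a, (b, rest)))`. -/
def argsCode (n a b rest : Code) : Code := .pair n (.pair a (.pair b rest))

/-- The parameters of a candidate:
`(n, (a₁, (b₁, (a₂, (K, (b₃, (m, (R, (Γ, (N, o))))))))))`. -/
def paramVal (n a₁ b₁ a₂ K b₃ m R Γ : ℕ) (N : ℤ) (o : Val) : Val :=
  .pair (.int n) (.pair (.int a₁) (.pair (.int b₁) (.pair (.int a₂) (.pair (.int K)
    (.pair (.int b₃) (.pair (.int m) (.pair (.int R) (.pair (.int Γ) (.pair (.int N) o)))))))))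

/-- The tail of a list. -/
def tailCode : ℕ → Code → Code
  | 0, c => c
  | i + 1, c => .snd (tailCode i c)

/-- The `i`-th parameter, from a term for the pair of the parameters and `j`. -/
def par (i : ℕ) (c : Code) : Code := .fst (tailCode i (.fst c))

/-- The oracle handle among the parameters. -/
def parOracle (c : Code) : Code := tailCode 10 (.fst c)

/-- The term for `statCtx`: variable `0` is the approximate count, variable `2` the
representation, and variable `4` the argument of `cand`. -/
def ctxCode : Code :=
  .pair (argsCode (par 0 (.var 4)) (par 4 (.var 4)) (par 5 (.var 4)) (.var 2))
    (.pair (parOracle (.var 4)) (.pair (par 4 (.var 4)) (.pair (par 6 (.var 4))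
      (.pair (.snd (.var 4)) (.pair (par 9 (.var 4))
        (.pair (.arith .add (.fst (.var 0)) (.lit 0)) (.arith .add (.snd (.var 0)) (.lit 0))))))))

/-- The term for `Passes`: variable `0` is the pair of sums, variable `4` the context of the
query oracle, and variable `10` the argument of `cand`. -/
def passesCode : Code :=
  let pq : Code := tailCode 6 (.var 4)
  let ca : Code := par 1 (.var 10)
  let m : Code := par 6 (.var 10)
  .ite (.arith .le (.lit 1) (.snd pq))
    (.ite (.arith .le (.arith .mul (.arith .sub ca (.lit 4)) m) (.arith .mul ca (.fst (.var 0))))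
      (.ite (.arith .le m (.arith .mul (.arith .mul (.lit 4) (par 8 (.var 10))) (.snd (.var 0))))
        (.arith .le
          (.arith .mul (.arith .mul (.arith .mul (.snd (.var 0)) (.fst pq)) (par 9 (.var 10))) ca)
          (.arith .mul (.arith .mul (.arith .mul (.arith .add ca (.lit 5)) (.snd (.var 10))) m)
            (.snd pq)))
        (.lit 0))
      (.lit 0))
    (.lit 0)

/-- The body of the sampler: variable `4` is the hypothesis, variable `6` the context of the
query oracle, and variable `12` the argument of `cand`. -/
def rejBody (Agen ev : Code) : Code :=
  .app (.proc (rej Agen ev)) (.pair (par 7 (.var 12)) (.pair (.fst (.var 6)) (.var 4)))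

/-- `(params, j) ↦` a sampler made from the guess `j`, with the outcome of its test. -/
def cand (Aden Agen Acount Asq ev : Code) : Code :=
  let_ (.app (.proc Aden) (argsCode (par 0 (.var 0)) (par 1 (.var 0)) (par 2 (.var 0))
    (.pair (.snd (.var 0)) (parOracle (.var 0)))))
  (let_ (.app (.proc Acount) (argsCode (par 0 (.var 2)) (par 4 (.var 2)) (par 5 (.var 2)) (.var 0)))
  (let_ ctxCode
  (let_ (.app (.proc Asq) (argsCode (par 0 (.var 6)) (par 3 (.var 6)) (par 2 (.var 6))
    (.pair (.lam (statBody Agen ev)) (.lam (drawBody Agen)))))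
  (let_ (.app (.proc sumLoop) (.pair (par 6 (.var 8)) (.pair (.pair (.proc (testStep Agen ev))
      (.pair (.fst (.var 2)) (.pair (parOracle (.var 8)) (.var 0)))) (.pair (.lit 0) (.lit 0)))))
  (.pair passesCode (.lam (rejBody Agen ev)))))))

theorem den_passesCode {n a₁ b₁ a₂ K b₃ m R Γ j : ℕ} {N p q : ℤ} 
    {o A o' h e1 e2 e3 e4 e5 e6 w r : Val} {l' m' j' N' : ℤ} {u : ℤ × ℤ} :
    (den passesCode (.pair (encPair u) (.pair e1 (.pair h (.pair e2 (.pair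
      (statCtx A o' l' m' j' N' p q) (.pair e3 (.pair w (.pair e4 (.pair r (.pair e5 (.pair (.pair
        (paramVal n a₁ b₁ a₂ K b₃ m R Γ N o) (.int j)) e6)))))))))))).truthy = true ↔
      Passes a₁ Γ m N j p q u := by
  by_cases h1 : 1 ≤ q <;> by_cases h2 : ((a₁ : ℤ) - 4) * m ≤ a₁ * u.1 <;>
    by_cases h3 : (m : ℤ) ≤ 4 * Γ * u.2 <;>
    by_cases h4 : u.2 * p * N * a₁ ≤ ((a₁ : ℤ) + 5) * j * m * q <;>
    simp [passesCode, den, par, tailCode, Arith.apply, Val.toInt, Val.lookup, Val.fst, Val.snd,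
      Val.truthy, Passes, encPair, statCtx, paramVal, h1, h2, h3, h4, Int.lt_iff_add_one_le]

/-- The relations between the parameters that the analysis of a candidate needs. -/
structure Accuracy (a₁ K b₃ m R Γ S : ℕ) (η : ℝ) : Prop where
  ha₁ : 64 ≤ a₁
  hΓ : 1 ≤ Γ
  hK : 16 * a₁ * Γ ≤ K
  hKS : 1024 * (S + 1) ≤ K
  hb₃ : 2 * K ≤ b₃
  hR : 16 * Γ * a₁ ≤ R
  hm : 0 < m
  stat_tail : 2 * Real.exp (-(m / (20736 * ((S : ℝ) + 1) ^ 2))) ≤ η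
  test_tail : 2 * Real.exp (-(m * (1 / (a₁ : ℝ) / (8 * Γ)) ^ 2 / 4)) ≤ η
  lt_one : η < 1

/-- The guess `j` is an accurate estimate of `|f⁻¹(1)|`. -/
def RightGuess {n : ℕ} (f : Cube n → Bool) (K j : ℕ) : Prop :=
  ((sat f).card : ℝ) ≤ j ∧ (j : ℝ) < (1 + 1 / (K : ℝ)) * (sat f).card

/-- The outcome of a densifier. -/
def IsDense {n : ℕ} (f g : Cube n → Bool) (a₁ Γ : ℕ) : Prop :=
  1 - 1 / (a₁ : ℝ) ≤ condProb f g ∧ 1 / (Γ : ℝ) ≤ condProb g f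

/-- The outcome of an approximate count. -/
def IsCount {n : ℕ} (g : Cube n → Bool) (K : ℕ) (p q : ℤ) : Prop :=
  0 < q ∧ 1 / (1 + 1 / (K : ℝ)) * bias g ≤ (p : ℝ) / q ∧ (p : ℝ) / q ≤ (1 + 1 / (K : ℝ)) * bias g

/-- A conditional probability over an empty set is `0` by convention, but the density is positive.
-/
theorem IsDense.nonempty {n : ℕ} {f g : Cube n → Bool} {a₁ Γ : ℕ} (hΓ : 1 ≤ Γ)
    (h : IsDense f g a₁ Γ) : (sat g).Nonempty := by
  by_contra hc
  have h2 := h.2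
  have hΓ' : (0 : ℝ) < 1 / Γ := by positivity
  rw [Finset.not_nonempty_iff_eq_empty] at hc
  rw [condProb, hc] at h2
  simp at h2
  linarith [inv_pos.2 (show (0 : ℝ) < Γ by positivity)]

theorem IsCount.pos {n : ℕ} {g : Cube n → Bool} {K : ℕ} {p q : ℤ} (h : IsCount g K p q)
    (hg : (sat g).Nonempty) : 0 < p := by
  have hG : (0 : ℝ) < (sat g).card := by exact_mod_cast hg.card_pos
  have h1 : 0 < 1 / (1 + 1 / (K : ℝ)) * bias g := by
    unfold bias
    positivity
  have hq : (0 : ℝ) < q := by exact_mod_cast h.1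
  have h2 := (div_pos_iff_of_pos_right hq).1 (h1.trans_le h.2.1)
  exact_mod_cast h2

/-- Supplies the hypotheses of `stat_correct`. Since `g` covers nearly all of `f`, the ratio of the
cardinalities is at most 2, and so its estimate is at most 4. -/
theorem stat_tail_of_right {n : ℕ} {f g : Cube n → Bool} (hf : (sat f).Nonempty)
    {D : PMF (Cube n)} {a₁ K b₃ m R Γ S j : ℕ} {p q : ℤ} {η : ℝ}
    (hacc : Accuracy a₁ K b₃ m R Γ S η)
    (hD : ∀ hg : (sat g).Nonempty, l1 D (unifSat g hg) ≤ 2 / K)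
    (hj : RightGuess f K j) (hd : IsDense f g a₁ Γ) (hc : IsCount g K p q) (s : ℕ)
    (φ : Cube n → Bool → ℝ) (pq : Cube n → Bool → ℤ × ℤ) (hs1 : 1 ≤ s) (hs : s ≤ S)
    (hpq : ∀ x y, 0 < (pq x y).2 ∧ |(pq x y).1| ≤ (pq x y).2 ∧
      φ x y = ((pq x y).1 : ℝ) / (pq x y).2) :
    prob (iidSum (prodDist D (unifSat f hf)) (statVar pq K g) m 0)
      {u | ¬ |∑ x, (D x).toReal * φ x (f x) -
        (clampZ s (statRound K m j (2 ^ n) p q s u) : ℝ) / s| ≤ 1 / (s : ℝ)} ≤ η := by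
  have hg := hd.nonempty hacc.hΓ
  have hp := hc.pos hg
  have hF : (0 : ℝ) < (sat f).card := by exact_mod_cast hf.card_pos
  have hG : (0 : ℝ) < (sat g).card := by exact_mod_cast hg.card_pos
  have hp' : (0 : ℝ) < p := by exact_mod_cast hp
  have hq' : (0 : ℝ) < q := by exact_mod_cast hc.1
  have hK1 : 1024 ≤ K := le_trans (by omega) hacc.hKS
  have hK : (1024 : ℝ) ≤ K := by exact_mod_cast hK1
  have hρ := ratio_error (n := n) hF hG (by linarith) hq' hp' hj.1 hj.2.le hc.2.1 hc.2.2
  have hFG : ((sat f).card : ℝ) / (sat g).card ≤ 2 := by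
    have h1 := hd.1
    have ha : (64 : ℝ) ≤ a₁ := by exact_mod_cast hacc.ha₁
    have h2 : 1 / (a₁ : ℝ) ≤ 1 / 64 := one_div_le_one_div_of_le (by norm_num) ha
    have h3 : ((sat f ∩ sat g).card : ℝ) ≤ (sat g).card := by
      exact_mod_cast Finset.card_le_card Finset.inter_subset_right
    rw [condProb, le_div_iff₀ hF] at h1
    rw [div_le_iff₀ hG]
    nlinarith
  have hFG0 : 0 < ((sat f).card : ℝ) / (sat g).card := by positivity
  have hK3 : 3 / (K : ℝ) ≤ 1 := by rw [div_le_one (by linarith)]; linarith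
  have e : (((j : ℤ) : ℝ) * q / (((2 : ℤ) ^ n : ℤ) * p) : ℝ) = j * q / (2 ^ n * p) := by
    push_cast; rfl
  refine (stat_correct hf hg (j := j) (p := p) (q := q) hacc.hKS hs1 hs hacc.hm hpq (hD hg) hp
    ?_ ?_ ?_).trans hacc.stat_tail
  · rw [e]; exact hρ
  · rw [e]; positivity
  · rw [e]
    have := abs_le.1 hρ
    nlinarith

/-- Soundness is claimed for every guess that is not too large, completeness for the right guess
only. The guarantees of densifier and learner are supposed under the latter condition alone. -/
theorem cand_analysis {n : ℕ} {f g φ : Cube n → Bool} (hf : (sat f).Nonempty)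
    {D : PMF (Cube n)} {a₁ K b₃ m R Γ S j : ℕ} {p q : ℤ} {η : ℝ} {u : ℤ × ℤ}
    (hacc : Accuracy a₁ K b₃ m R Γ S η) (x₀ : Cube n)
    (hD : ∀ hg : (sat g).Nonempty, l1 D (unifSat g hg) ≤ 2 / K)
    (hd : RightGuess f K j → IsDense f g a₁ Γ) (hc : IsCount g K p q)
    (herr : RightGuess f K j → IsDense f g a₁ Γ → IsCount g K p q →
      err D φ f ≤ 1 / ((a₁ * Γ : ℕ) : ℝ))
    (hu : Accurate f (fun x => g x && φ x) D (1 / a₁) Γ m u) :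
    (Passes a₁ Γ m (2 ^ n : ℕ) j p q u → (j : ℝ) ≤ (1 + 1 / (K : ℝ)) * (sat f).card →
      l1 (rejDist D (fun x => g x && φ x) x₀ R) (unifSat f hf) ≤ 64 * (1 / a₁)) ∧
    (RightGuess f K j → Passes a₁ Γ m (2 ^ n : ℕ) j p q u) := by
  have ha : (64 : ℝ) ≤ a₁ := by exact_mod_cast hacc.ha₁
  have hΓ : (1 : ℝ) ≤ Γ := by exact_mod_cast hacc.hΓ
  have hK : (16 : ℝ) * a₁ * Γ ≤ K := by exact_mod_cast hacc.hK
  have hm : (0 : ℝ) < m := by exact_mod_cast hacc.hm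
  have hF : (0 : ℝ) < (sat f).card := by exact_mod_cast hf.card_pos
  have haK : (a₁ : ℝ) ≤ K := by nlinarith
  have hK0 : (0 : ℝ) < K := by linarith
  have hKa : 1 / (K : ℝ) ≤ 1 / a₁ := one_div_le_one_div_of_le (by linarith) haK
  have h2K : 2 / (K : ℝ) ≤ 1 / a₁ / (8 * Γ) := by
    rw [div_div, div_le_div_iff₀ hK0 (by positivity)]
    linarith
  have hbias : 0 ≤ bias g := by unfold bias; positivity
  have hAg : ∀ x, (g x && φ x) = true → g x = true := fun x h => (Bool.and_eq_true _ _ ▸ h).1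
  constructor
  · intro hp hj
    by_cases hg : (sat g).Nonempty
    swap
    -- If `g` is unsatisfiable then `A` is empty, so the second empirical frequency is below `1 / a₁
    -- / (8 Γ)` and the second check fails.
    · exfalso
      have h0 : ∀ x, g x = false := by
        intro x
        by_contra hx
        exact hg ⟨x, by simpa [sat] using hx⟩
      obtain ⟨-, -, h2, -⟩ := hp
      have h3 := hu.snd
      simp only [h0, Bool.false_and, Bool.false_eq_true, if_false, mul_zero,
        Finset.sum_const_zero, sub_zero] at h3
      have h2' : (m : ℝ) ≤ 4 * Γ * u.2 := by exact_mod_cast h2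
      have h4 := (abs_lt.1 h3).2
      have e : 4 * Γ * (m * (1 / (a₁ : ℝ) / (8 * Γ))) = m * (1 / 2 * (1 / a₁)) := by
        field_simp; norm_num
      have h5 : 4 * Γ * (u.2 : ℝ) ≤ 4 * Γ * (m * (1 / (a₁ : ℝ) / (8 * Γ))) :=
        mul_le_mul_of_nonneg_left h4.le (by positivity)
      rw [e] at h5
      have h6 : 1 / (a₁ : ℝ) ≤ 1 / 64 := one_div_le_one_div_of_le (by norm_num) ha
      have h7 : m * (1 / 2 * (1 / (a₁ : ℝ))) ≤ m * (1 / 2 * (1 / 64)) := by gcongr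
      linarith
    have hDg := (hD hg).trans h2K
    have hc1 : 1 / (1 + 1 / (a₁ : ℝ)) * bias g ≤ (p : ℝ) / q := by
      refine le_trans (mul_le_mul_of_nonneg_right ?_ hbias) hc.2.1
      exact one_div_le_one_div_of_le (by positivity) (by linarith)
    obtain ⟨s1, s2, s3⟩ := passes_sound hf hg hAg hacc.ha₁ hacc.hΓ hacc.hm hDg hu hc1
      (hj.trans (mul_le_mul_of_nonneg_right (by linarith) hF.le)) hp
    refine rejDist_close hf hg hAg x₀ (by positivity)
      (one_div_le_one_div_of_le (by norm_num) ha) hacc.hΓ hDg s1 s2 s3 ?_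
    have hR : (16 : ℝ) * Γ * a₁ ≤ R := by exact_mod_cast hacc.hR
    rw [one_div, le_inv_mul_iff₀ (by positivity)]
    linarith
  · intro hr
    have hd' := hd hr
    have hg := hd'.nonempty hacc.hΓ
    refine passes_complete hf hg hacc.ha₁ hacc.hΓ hacc.hm ((hD hg).trans h2K) hu hc.1
      (hc.2.2.trans (mul_le_mul_of_nonneg_right (by linarith) hbias)) (hc.pos hg) hr.1 hd'.1 hd'.2
      (herr hr hd' hc)

theorem ComputesAlways.unique {n t : ℕ} {h : Val} {φ φ' : Cube n → Bool}
    (h1 : ComputesAlways t h φ) (h2 : ComputesAlways t h φ') : φ = φ' := by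
  funext x
  have e1 := (h1 noOracle x).exec le_rfl
  have e2 := (h2 noOracle x).exec le_rfl
  rw [e1, PMF.pure_map, PMF.pure_map] at e2
  have h3 : some (Val.bit (φ x)) ∈ (PMF.pure (some (Val.bit (φ' x)))).support := by
    rw [← e2]; simp
  simp only [PMF.support_pure, Set.mem_singleton_iff, Option.some.injEq] at h3
  have := congrArg Val.truthy h3
  rwa [truthy_bit, truthy_bit] at this

/-- Every number has a bit length below `L`, and every running time is below `L`. -/
structure Sizes (L n a₁ b₁ a₂ K b₃ m R Γ Td Tg Tc T₁ t₂ : ℕ) : Prop where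
  hL : 2 ^ 30 ≤ L
  hn : n + 1 < L
  ha₁ : a₁.size ≤ L
  hb₁ : b₁.size ≤ L
  ha₂ : a₂.size ≤ L
  hb₃ : b₃.size ≤ L
  hΓ : Γ.size ≤ L
  hK : K < L
  hm : m < L
  hmK : m * (2 * K) < L
  hR : R < L
  hTd : Td < L
  hTg : Tg < L
  hTc : Tc < L
  hT₁ : T₁ + 1 < L
  ht₂ : t₂ + 1 < L

theorem Sizes.width_paramVal {L n a₁ b₁ a₂ K b₃ m R Γ Td Tg Tc T₁ t₂ : ℕ}
    (h : Sizes L n a₁ b₁ a₂ K b₃ m R Γ Td Tg Tc T₁ t₂) {o : Val} (ho : o.width ≤ L) :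
    (paramVal n a₁ b₁ a₂ K b₃ m R Γ (2 ^ n : ℕ) o).width ≤ L := by
  simp only [paramVal, Val.width, max_le_iff, Int.natAbs_natCast]
  refine ⟨size_le_of_le (by have := h.hn; omega), h.ha₁, h.hb₁, h.ha₂, size_le_of_le h.hK.le,
    h.hb₃, size_le_of_le h.hm.le, size_le_of_le h.hR.le, h.hΓ, ?_, ho⟩
  rw [Nat.size_pow]
  exact h.hn.le

/-- The function value `G` samples from `D` within `B` steps, whatever the oracles. -/
def SamplesAlways {n : ℕ} (B : ℕ) (G : Val) (D : PMF (Cube n)) : Prop :=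
  ∀ O, CallRuns O G (.int 0) B (D.map enc)

/-- A phase whose guarantee presupposes `H` is charged only if `H` holds; for a wrong guess it costs
nothing. -/
theorem prob_not_imp_le {α : Type} (p : PMF α) {H : Prop} {E : α → Prop} {δ : ℝ} (hδ : 0 ≤ δ)
    (h : H → prob p {v | ¬ E v} ≤ δ) : prob p {v | ¬ (H → E v)} ≤ δ := by
  by_cases hH : H
  · simpa [hH] using h hH
  · have : {v | ¬ (H → E v)} = (∅ : Set α) := by ext v; simp [hH]
    rw [this]
    simpa [prob] using hδ

/-- The indices in `hx` are those of `rejBody` lowered by two: on entering the closure, its argument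
and the closure itself are put in front of `E`. -/
theorem rejBody_samples {Agen ev : Code} {L n a b R : ℕ} {r h E : Val} {A : Cube n → Bool}
    {D : PMF (Cube n)} (hL : 2 ^ 30 ≤ L) (hn : n < L) (hw : (args n a b r).width ≤ L)
    (hh : h.width ≤ L)
    (hD : ∀ O, CallRuns O (program (draw Agen)) (args n a b r) (L ^ 5) (D.map enc))
    (hA : ∀ O x, CallRuns O (program (acc ev)) (.pair (args n a b r) (.pair h (enc x))) (L ^ 3)
      (PMF.pure (Val.bit (A x)))) (hR : R < L) (hE : E.width ≤ L)
    (hx : den (.pair (par 7 (.var 10)) (.pair (.fst (.var 4)) (.var 2))) E =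
      .pair (.int R) (.pair (args n a b r) h)) :
    SamplesAlways (L ^ 8) (.clo (rejBody Agen ev) E) (rejDist D A (dec n (.int 0)) R) := by
  intro O
  have hr := rej_runs O hL hn hw hh (hD O) (hA O) R hR
  have hwE : (Val.pair (.int 0) (.pair (.clo (rejBody Agen ev) E) E)).width ≤ L :=
    max_le (by simp [Val.width]) (max_le hE hE)
  refine CallRuns.mono (B := L ^ 7 + L ^ 2) (runs_call hL hwE rfl rfl hx hr) ?_
  have e1 : 100 * L ^ 7 ≤ L ^ 8 := by
    rw [pow_succ L 7, mul_comm]; exact Nat.mul_le_mul_left _ (by omega)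
  have e2 := Nat.pow_le_pow_right (show 0 < L by omega) (show 2 ≤ 7 by norm_num)
  omega

/-- The count and the test are charged for every guess. The densifier and the learner are charged
through `δ₁` and `δ₂`, which may vanish unless the guess is right. Whatever the guess, the result
contains a program that samples from some distribution. -/
theorem cand_meets {C : ConceptClass} {C' : RepClass} {Aden Agen Acount Asq : Code}
    {Tden gammaInv Tgen Tcount t₁ : ℕ → ℕ → ℕ → ℕ} {t₂ : ℕ → ℕ} {tauInv : ℕ → ℕ → ℕ}
    (hden : IsDensifier C C' gammaInv Aden Tden) (hgen : IsApproxGen C' Agen Tgen)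
    (hcount : IsApproxCount C' Acount Tcount) (hsq : IsSQLearner C Asq t₁ t₂ tauInv)
    {L n a₁ b₁ K b₃ m R j : ℕ} {η δ₁ δ₂ : ℝ} {f : Cube n → Bool} (hfC : f ∈ C n)
    (hf : (sat f).Nonempty) (hb₁ : 1 ≤ b₁)
    (hacc : Accuracy a₁ K b₃ m R (gammaInv n a₁ b₁) (tauInv n (a₁ * gammaInv n a₁ b₁)) η)
    (hsz : Sizes L n a₁ b₁ (a₁ * gammaInv n a₁ b₁) K b₃ m R (gammaInv n a₁ b₁) (Tden n a₁ b₁)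
      (Tgen n K b₃) (Tcount n K b₃) (t₁ n (a₁ * gammaInv n a₁ b₁) b₁) (t₂ n))
    (hj : 1 ≤ j) (hj' : j ≤ 2 ^ n) (hδ₁ : 0 ≤ δ₁) (hδ₁' : RightGuess f K j → 1 / (b₁ : ℝ) ≤ δ₁)
    (hδ₂ : 0 ≤ δ₂) (hδ₂' : RightGuess f K j →
      1 / (b₁ : ℝ) + t₁ n (a₁ * gammaInv n a₁ b₁) b₁ * η ≤ δ₂) :
    Meets (sampleOracle (unifSat f hf))
      (.pair (.pair (paramVal n a₁ b₁ (a₁ * gammaInv n a₁ b₁) K b₃ m R (gammaInv n a₁ b₁)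
        (2 ^ n : ℕ) (.orc 0)) (.int j)) (.pair (program (cand Aden Agen Acount Asq C'.ev)) (.int 0)))
      (cand Aden Agen Acount Asq C'.ev) (L ^ 12)
      (fun v => v.width ≤ L ^ 2 ∧ ∃ D : PMF (Cube n), SamplesAlways (L ^ 8) v.snd D)
      (fun v => (v.fst.truthy = true → (j : ℝ) ≤ (1 + 1 / (K : ℝ)) * (sat f).card →
          ∃ D : PMF (Cube n), SamplesAlways (L ^ 8) v.snd D ∧
            l1 D (unifSat f hf) ≤ 64 * (1 / a₁)) ∧
        (RightGuess f K j → v.fst.truthy = true))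
      (δ₁ + (1 / b₃ + (δ₂ + (2 * η + 0)))) := by
  have hL := hsz.hL
  have hn := hsz.hn
  have ha₁ : 1 ≤ a₁ := le_trans (by norm_num) hacc.ha₁
  have hΓ := hacc.hΓ
  have hK1 : 1 ≤ K := le_trans (by omega) hacc.hKS
  have hb₃ : 1 ≤ b₃ := le_trans (by omega) hacc.hb₃
  have hη : 0 ≤ η := le_trans (by positivity) hacc.stat_tail
  have hjw : (Val.int (j : ℤ)).width ≤ L := by
    refine le_trans (Nat.size_le_size (show j ≤ 2 ^ n from hj')) ?_
    rw [Nat.size_pow]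
    exact hn.le
  have hnw : (Val.int (n : ℤ)).width ≤ L := size_le_of_le (by omega)
  have hKw : (Val.int (K : ℤ)).width ≤ L := size_le_of_le hsz.hK.le
  generalize hcv : cand Aden Agen Acount Asq C'.ev = cd
  have w0 := width_program (A := cd) (show (Val.pair (paramVal n a₁ b₁ (a₁ * gammaInv n a₁ b₁) K b₃
    m R (gammaInv n a₁ b₁) (2 ^ n : ℕ) (.orc 0)) (.int j)).width ≤ L from
    max_le (hsz.width_paramVal (Nat.zero_le _)) hjw)
  generalize hp : program cd = pc at w0
  subst hcv
  set O := sampleOracle (unifSat f hf) with hO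
  have hU : CallRuns O (.orc 0) (.int 0) 1 ((unifSat f hf).map enc) := sampleOracle_runs _ _
  refine Meets.mono (B := (L ^ 2 + L ^ 2) + (((Tcount n K b₃ + 1) + L ^ 2) + (L ^ 2 +
    ((L ^ 11 + L ^ 2) + ((L ^ 8 + L ^ 2) + L ^ 2 + 4) + 4) + 4) + 4) + 4) ?_ ?_ le_rfl
  swap
  · have e1 : 100 * L ^ 11 ≤ L ^ 12 := by
      rw [pow_succ L 11, mul_comm]; exact Nat.mul_le_mul_left _ (by omega)
    have e2 := Nat.pow_le_pow_right (show 0 < L by omega) (show 2 ≤ 11 by norm_num)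
    have e3 := Nat.pow_le_pow_right (show 0 < L by omega) (show 8 ≤ 11 by norm_num)
    have e4 := Nat.pow_le_pow_right (show 0 < L by omega) (show 1 ≤ 11 by norm_num)
    rw [pow_one] at e4
    have := hsz.hTc
    omega
  -- the densifier
  obtain ⟨μ₁, r1, s1, g1⟩ := densifier_runs hden hL ha₁ hb₁ hfC hf hj hj'
    (show (args n a₁ b₁ (.pair (.int j) (.orc 0))).width ≤ L from
      max_le hnw (max_le hsz.ha₁ (max_le hsz.hb₁ (max_le hjw (Nat.zero_le _))))) hsz.hTd
  refine Meets.let_ (by positivity) ⟨μ₁, runs_call hL w0 rfl rfl rfl r1, s1,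
    prob_not_imp_le (H := RightGuess f K j) μ₁ hδ₁ fun hr => (g1 ?_ ?_).trans (hδ₁' hr)⟩ ?_
  · rw [bias]
    exact div_le_div_of_nonneg_right hr.1 (by positivity)
  · rw [bias, mul_div_assoc']
    refine div_lt_div_of_pos_right (hr.2.trans_le ?_) (by positivity)
    refine mul_le_mul_of_nonneg_right ?_ (by positivity)
    -- A right guess is accurate to `1 / K`, which is finer than the accuracy `1 / a₁` that the
    -- densifier asks for.
    have : (a₁ : ℝ) ≤ K := by
      have h1 : a₁ ≤ K := by
        have := hacc.hK
        nlinarith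
      exact_mod_cast h1
    have h0 : (0 : ℝ) < a₁ := by exact_mod_cast ha₁
    linarith [one_div_le_one_div_of_le h0 this]
  rintro r ⟨hrw, hrep, hev⟩
  clear g1 s1 r1
  have w1 := fun t => width_let (t := t) hrw w0
  have hAw : (args n K b₃ r).width ≤ L := max_le hnw (max_le hKw (max_le hsz.hb₃ hrw))
  -- the approximate count
  obtain ⟨μ₂, r2, s2, g2⟩ := count_runs O hcount hK1 hb₃ hrep hAw hsz.hTc.le
  refine Meets.let_ (by positivity) ⟨μ₂, runs_call hL (w1 _) rfl rfl rfl r2, s2, g2⟩ ?_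
  intro w hw
  clear g2 s2 r2
  have w2 := fun t t' => width_let (t := t) hw (w1 t')
  have hpw : (Val.int (decPair w).1).width ≤ L :=
    (size_toInt w.fst).trans ((width_fst w).trans hw)
  have hqw : (Val.int (decPair w).2).width ≤ L :=
    (size_toInt w.snd).trans ((width_snd w).trans hw)
  have hNw : (Val.int ((2 ^ n : ℕ) : ℤ)).width ≤ L := by
    refine le_trans (le_of_eq ?_) hn.le
    exact Nat.size_pow
  have hcw : (statCtx (args n K b₃ r) (.orc 0) K m j (2 ^ n : ℕ) (decPair w).1
      (decPair w).2).width ≤ L :=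
    max_le hAw (max_le (Nat.zero_le _) (max_le hKw (max_le (size_le_of_le hsz.hm.le)
      (max_le hjw (max_le hNw (max_le hpw hqw))))))
  refine Meets.let_pure (v := statCtx (args n K b₃ r) (.orc 0) K m j (2 ^ n : ℕ) (decPair w).1
      (decPair w).2) (runs_short hL (w2 _ _) rfl ?_) ?_
  · simp [ctxCode, argsCode, par, parOracle, tailCode, den, Val.lookup, Val.fst, Val.snd, statCtx,
      args, decPair, Arith.apply, paramVal, Val.toInt]
  have w3 := fun t t' t'' => width_let (t := t) hcw (w2 t' t'')
  have hD := draw_runs O hL (by omega : n < L) hAw hsz.hTg (hgen.halts n K b₃ hK1 hb₃ r hrep)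
  have hDg : ∀ hg : (sat (C'.fn n r)).Nonempty,
      l1 (genDist Agen (Tgen n K b₃) n K b₃ r) (unifSat (C'.fn n r) hg) ≤ 2 / K := by
    intro hg
    refine (genDist_close hgen hK1 hb₃ hrep hg).trans ?_
    have h1 : (2 : ℝ) * K ≤ b₃ := by exact_mod_cast hacc.hb₃
    have h2 : (0 : ℝ) < K := by exact_mod_cast hK1
    have h3 := one_div_le_one_div_of_le (by positivity) h1
    have e : 1 / (2 * (K : ℝ)) = 1 / 2 * (1 / K) := by ring
    have e' : 2 / (K : ℝ) = 2 * (1 / K) := by ring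
    rw [e] at h3
    linarith
  generalize hDD : genDist Agen (Tgen n K b₃) n K b₃ r = D at hD hDg
  -- the learner
  obtain ⟨μ₃, r3, s3, g3⟩ := learner_runs O hsq (E := .pair (statCtx (args n K b₃ r) (.orc 0) K m j
      (2 ^ n : ℕ) (decPair w).1 (decPair w).2) _) hL
    (by nlinarith : 1 ≤ a₁ * gammaInv n a₁ b₁) hb₁ hsz.ha₂ hsz.hb₁ (by omega : n < L) rfl
    (w3 _ _ _) hsz.hK hsz.hm hsz.hmK hsz.hTd (by have := hsz.hT₁; omega) hsz.ht₂ hD hU hev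
  -- The simulated answers are accurate only if guess, densifier and count are; otherwise nothing is
  -- claimed about the hypothesis.
  refine Meets.let_ (by positivity) ⟨μ₃, runs_call hL (w3 _ _ _) rfl rfl rfl r3, s3,
    prob_not_imp_le (H := RightGuess f K j ∧ IsDense f (C'.fn n r) a₁ (gammaInv n a₁ b₁) ∧
      IsCount (C'.fn n r) K (decPair w).1 (decPair w).2) μ₃ hδ₂
      fun hr => (g3 f hfC η hη hacc.lt_one ?_).trans (hδ₂' hr.1)⟩ ?_
  · intro s φ pq hs1 hs hpq
    have := stat_tail_of_right hf hacc hDg hr.1 hr.2.1 hr.2.2 s φ pq hs1 hs hpq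
    exact_mod_cast this
  rintro h ⟨hhw, φ, hφ⟩
  clear g3 s3 r3
  have w4 := fun t t1 t2 t3 => width_let (t := t) hhw (w3 t1 t2 t3)
  have hA : ∀ O' x, CallRuns O' (program (acc C'.ev)) (.pair (args n K b₃ r) (.pair h (enc x)))
      (L ^ 3) (PMF.pure (Val.bit (C'.fn n r x && φ x))) := fun O' x =>
    acc_runs O' hL hAw hhw hsz.hTd hsz.hT₁ x (hev x) (hφ O' x)
  have hstep := testStep_runs O (o := .orc 0) hL hAw (Nat.zero_le _) hhw hD hU (hA O)
  have hM : ∀ ω, |(testVar (fun x => C'.fn n r x && φ x) ω).1| ≤ 1 ∧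
      |(testVar (fun x => C'.fn n r x && φ x) ω).2| ≤ 1 := by
    intro ω
    unfold testVar
    constructor <;> dsimp only <;> split <;> simp
  have hm2 : (m : ℤ) * 1 < 2 ^ L := by
    rw [mul_one]
    exact_mod_cast hsz.hm.trans Nat.lt_two_pow_self
  have hsum := sumLoop_runs O (F := program (testStep Agen C'.ev)) hL
    (by simp [program, Val.width]) (show (Val.pair (args n K b₃ r) (.pair (.orc 0) h)).width ≤ L from
      max_le hAw (max_le (Nat.zero_le _) hhw)) hM zero_le_one hstep m hsz.hm hm2
  have htail := accurate_tail hf (fun x => C'.fn n r x && φ x) D (κ := 1 / a₁)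
    (Γ := gammaInv n a₁ b₁) (m := m) (by positivity)
    (by rw [div_le_one (by positivity)]; exact_mod_cast ha₁) hΓ hacc.test_tail
  -- the test
  refine Meets.let_ (Sure := fun v => ∃ u : ℤ × ℤ, v = encPair u ∧ (encPair u).width ≤ L)
    (Good := fun v => Accurate f (fun x => C'.fn n r x && φ x) D (1 / a₁) (gammaInv n a₁ b₁) m
      (decPair v)) le_rfl
    ⟨_, runs_call hL (w4 _ _ _ _) rfl rfl rfl hsum, ?_, ?_⟩ ?_
  · intro v hv
    rw [PMF.support_map] at hv
    obtain ⟨u, hu, rfl⟩ := hv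
    have hu' := iidSum_support hM m 0 u hu
    simp only [Prod.fst_zero, Prod.snd_zero, abs_zero, zero_add] at hu'
    exact ⟨u, rfl, width_encPair (hu'.1.trans_lt hm2) (hu'.2.trans_lt hm2)⟩
  · rw [prob_map]
    exact htail
  rintro _ ⟨u, rfl, huw⟩
  have w5 := fun t t1 t2 t3 t4 => width_let (t := t) huw (w4 t1 t2 t3 t4)
  have hsamp := fun t t1 t2 t3 t4 => rejBody_samples (Agen := Agen) (ev := C'.ev) hL
    (by omega : n < L) hAw hhw (fun O' => hDD ▸ draw_runs O' hL (by omega : n < L) hAw hsz.hTg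
      (hgen.halts n K b₃ hK1 hb₃ r hrep)) hA hsz.hR (w5 t t1 t2 t3 t4) rfl
  refine Meets.of_pure (runs_short hL (w5 _ _ _ _ _) rfl rfl) ⟨?_, _, hsamp _ _ _ _ _⟩ ?_ le_rfl
  · refine (width_short (w5 _ _ _ _ _) rfl).trans ?_
    nlinarith
  · intro hu herr hc hd
    -- The accurate function promised by the learner is the `φ` fixed above, since `h` computes only
    -- one function.
    have hpass := cand_analysis hf hacc (dec n (.int 0)) hDg hd hc (fun h1 h2 h3 => by
      obtain ⟨φ', hφ', he⟩ := herr ⟨h1, h2, h3⟩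
      rw [hφ.unique hφ']
      exact he) hu
    have hden := fun e1 e2 e3 e4 e5 e6 => den_passesCode (n := n) (a₁ := a₁) (b₁ := b₁)
      (a₂ := a₁ * gammaInv n a₁ b₁) (K := K) (b₃ := b₃) (m := m) (R := R)
      (Γ := gammaInv n a₁ b₁) (j := j) (N := (2 ^ n : ℕ)) (p := (decPair w).1)
      (q := (decPair w).2) (o := .orc 0) (A := args n K b₃ r) (o' := .orc 0) (h := h) (e1 := e1)
      (e2 := e2) (e3 := e3) (e4 := e4) (e5 := e5) (e6 := e6) (w := w) (r := r) (l' := K) (m' := m)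
      (j' := j) (N' := (2 ^ n : ℕ)) (u := u)
    refine ⟨fun hv hj => ⟨_, hsamp _ _ _ _ _, hpass.1 ((hden _ _ _ _ _ _).1 hv) hj⟩, fun hr =>
      (hden _ _ _ _ _ _).2 (hpass.2 hr)⟩

/-! ### The search for the right guess -/

/-- The guess after `j`. -/
def nextGuess (n K j : ℕ) : ℕ := min (2 ^ n) (j + j / K + 1)

/-- Within `k` guesses from `j` on, the first one that is not too small is accurate. -/
def Reaches {n : ℕ} (f : Cube n → Bool) (K : ℕ) : ℕ → ℕ → Prop
  | 0, _ => False
  | k + 1, j => RightGuess f K j ∨ (j < (sat f).card ∧ Reaches f K k (nextGuess n K j))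

theorem card_sat_le {n : ℕ} (f : Cube n → Bool) : (sat f).card ≤ 2 ^ n := by
  refine (Finset.card_le_univ _).trans ?_
  simp

/-- The step from `j` is at most `j / K + 1`, and `j + 1` is at most the target, so the overshoot is
less than a fraction `1 / K` of the target. -/
theorem rightGuess_of_le {n : ℕ} {f : Cube n → Bool} {K j : ℕ} (hK : 1 ≤ K)
    (hj : j < (sat f).card) (h : (sat f).card ≤ nextGuess n K j) :
    RightGuess f K (nextGuess n K j) := by
  refine ⟨by exact_mod_cast h, ?_⟩
  have hK' : (0 : ℝ) < K := by exact_mod_cast hK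
  have h1 : (nextGuess n K j : ℝ) ≤ j + j / K + 1 := by
    have h2 : nextGuess n K j ≤ j + j / K + 1 := min_le_right _ _
    have h3 : ((j / K : ℕ) : ℝ) ≤ (j : ℝ) / K := Nat.cast_div_le
    have h4 : (nextGuess n K j : ℝ) ≤ j + (j / K : ℕ) + 1 := by exact_mod_cast h2
    linarith
  have h5 : (j : ℝ) + 1 ≤ (sat f).card := by exact_mod_cast hj
  have h6 : (j : ℝ) / K < (sat f).card / K := by
    rw [div_lt_div_iff_of_pos_right hK']
    linarith
  have e : (1 + 1 / (K : ℝ)) * (sat f).card = (sat f).card + (sat f).card / K := by ring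
  rw [e]
  linarith

theorem rightGuess_self {n : ℕ} {f : Cube n → Bool} {K : ℕ} (hK : 1 ≤ K)
    (hf : (sat f).Nonempty) : RightGuess f K (sat f).card := by
  refine ⟨le_rfl, ?_⟩
  have hF : (0 : ℝ) < (sat f).card := by exact_mod_cast hf.card_pos
  have hK' : (0 : ℝ) < 1 / K := by positivity
  nlinarith

/-- From a guess below the target, the next one either meets or passes it and is then right, or has
grown by the factor `1 + 1 / K` at least. The cap `2 ^ n` is inactive in the second case. -/
theorem reaches_of_pow {n : ℕ} {f : Cube n → Bool} (hf : (sat f).Nonempty) {K : ℕ} (hK : 1 ≤ K)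
    (k j : ℕ) (hj' : j ≤ (sat f).card)
    (h : ((sat f).card : ℝ) ≤ (1 + 1 / (K : ℝ)) ^ k * j) : Reaches f K (k + 1) j := by
  induction k generalizing j with
  | zero =>
    left
    rw [pow_zero, one_mul] at h
    have : j = (sat f).card := le_antisymm hj' (by exact_mod_cast h)
    rw [this]
    exact rightGuess_self hK hf
  | succ k ih =>
    rcases hj'.eq_or_lt with he | hlt
    · left
      rw [he]
      exact rightGuess_self hK hf
    right
    refine ⟨hlt, ?_⟩
    rcases le_or_gt (sat f).card (nextGuess n K j) with hge | hle
    · exact Or.inl (rightGuess_of_le hK hlt hge)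
    · refine ih _ hle.le (h.trans ?_)
      have hn : nextGuess n K j = j + j / K + 1 := by
        have := card_sat_le f
        unfold nextGuess at hle ⊢
        omega
      have h1 : (1 + 1 / (K : ℝ)) * j ≤ nextGuess n K j := by
        have h2 : j < (j / K + 1) * K := by
          rw [mul_comm]
          exact Nat.lt_mul_div_succ j hK
        have hK' : (0 : ℝ) < K := by exact_mod_cast hK
        have h3 : (j : ℝ) / K ≤ (j / K : ℕ) + 1 := by
          rw [div_le_iff₀ hK']
          exact_mod_cast h2.le
        rw [hn]
        push_cast at h3 ⊢
        have e : (1 + 1 / (K : ℝ)) * j = j + j / K := by ring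
        rw [e]
        linarith
      rw [pow_succ, mul_assoc]
      exact mul_le_mul_of_nonneg_left h1 (by positivity)

/-- By Bernoulli's inequality `K` steps at least double the guess, and the target is at most `2 ^
n`. -/
theorem reaches_one {n : ℕ} {f : Cube n → Bool} (hf : (sat f).Nonempty) {K : ℕ} (hK : 1 ≤ K) :
    Reaches f K (n * K + 1) 1 := by
  refine reaches_of_pow hf hK (n * K) 1 hf.card_pos ?_
  rw [Nat.cast_one, mul_one, mul_comm n K, pow_mul]
  have hK' : (0 : ℝ) < K := by exact_mod_cast hK
  have h1 : (2 : ℝ) ≤ (1 + 1 / (K : ℝ)) ^ K := by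
    have := one_add_mul_le_pow (show (-2 : ℝ) ≤ 1 / K by
      have : (0 : ℝ) < 1 / K := by positivity
      linarith) K
    have e : 1 + (K : ℝ) * (1 / K) = 2 := by field_simp; norm_num
    linarith
  refine le_trans ?_ (pow_le_pow_left₀ (by norm_num) h1 n)
  exact_mod_cast card_sat_le f

/-- The term for `nextGuess`: variable `2` is the argument of `search`. -/
def nextCode : Code :=
  let j : Code := .snd (.snd (.var 2))
  let j' : Code := .arith .add (.arith .add j (.arith .div j (par 4 (.snd (.var 2))))) (.lit 1)
  .ite (.arith .le (par 9 (.snd (.var 2))) j') (par 9 (.snd (.var 2))) j'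

theorem den_nextCode {n a₁ b₁ a₂ K b₃ m R Γ j : ℕ} {o k v e1 e : Val} :
    den nextCode (.pair v (.pair e1 (.pair (.pair k (.pair
      (paramVal n a₁ b₁ a₂ K b₃ m R Γ (2 ^ n : ℕ) o) (.int j))) e))) =
      .int (nextGuess n K j : ℕ) := by
  have h : ((nextGuess n K j : ℕ) : ℤ) =
      if ((2 ^ n : ℕ) : ℤ) ≤ (j : ℤ) + j / K + 1 then ((2 ^ n : ℕ) : ℤ) else (j : ℤ) + j / K + 1 := by
    unfold nextGuess
    split
    · rename_i h
      rw [min_eq_left (by exact_mod_cast h)]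
    · rename_i h
      rw [min_eq_right (by push Not at h; exact_mod_cast h.le)]
      push_cast
      rfl
  rw [h]
  by_cases h1 : ((2 ^ n : ℕ) : ℤ) ≤ (j : ℤ) + j / K + 1
  · rw [if_pos h1]
    simp only [nextCode, den, par, tailCode, Val.lookup, Val.fst, Val.snd, paramVal, Val.toInt,
      Arith.apply, h1, if_true, Val.truthy]
    simp
  · rw [if_neg h1]
    simp only [nextCode, den, par, tailCode, Val.lookup, Val.fst, Val.snd, paramVal, Val.toInt,
      Arith.apply, h1, if_false, Val.truthy]
    simp

/-- The body of a sampler that returns a fixed point; the context is the argument of `search`. -/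
def constBody : Code := .app (.proc san) (.pair (par 0 (.snd (.var 2))) (.lit 0))

/-- The treatment of a candidate: variable `0` is the candidate, and variable `2` the argument of
`search`. -/
def searchStep : Code :=
  .ite (.fst (.var 0)) (.snd (.var 0))
    (.app (.var 3) (.pair (.arith .sub (.fst (.var 2)) (.lit 1))
      (.pair (.fst (.snd (.var 2))) nextCode)))

/-- `(k, (params, j)) ↦` the first of `k` candidates that passes its test, from the guess `j`
on. -/
def search (cd : Code) : Code :=
  .ite (.fst (.var 0))
    (let_ (.app (.proc cd) (.snd (.var 0))) searchStep)
    (.lam constBody)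

theorem Meets.of_forall {O : Oracle} {env : Val} {t : Code} {B : ℕ} {Sure Good Good' : Val → Prop}
    {δ δ' : ℝ} (h : Meets O env t B Sure Good δ) (hG : ∀ v, Good' v) (hδ : 0 ≤ δ') :
    Meets O env t B Sure Good' δ' := by
  obtain ⟨μ, h1, h2, -⟩ := h
  refine ⟨μ, h1, h2, ?_⟩
  have : {v | ¬ Good' v} = (∅ : Set Val) := by ext v; simp [hG v]
  rw [this]
  simpa [prob] using hδ

theorem Meets.cond_true {O : Oracle} {env : Val} {c t e : Code} {L B : ℕ} {Sure Good : Val → Prop}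
    {δ : ℝ} (hL : 2 ^ 30 ≤ L) (hw : env.width ≤ L) (hs : short c = true)
    (hc : (den c env).truthy = true) (h : Meets O env t B Sure Good δ) :
    Meets O env (.ite c t e) (B + L ^ 2) Sure Good δ := by
  obtain ⟨μ, h1, h2⟩ := h
  exact ⟨μ, runs_then hL hw hs hc h1, h2⟩

theorem Meets.cond_false {O : Oracle} {env : Val} {c t e : Code} {L B : ℕ} {Sure Good : Val → Prop}
    {δ : ℝ} (hL : 2 ^ 30 ≤ L) (hw : env.width ≤ L) (hs : short c = true)
    (hc : (den c env).truthy = false) (h : Meets O env e B Sure Good δ) :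
    Meets O env (.ite c t e) (B + L ^ 2) Sure Good δ := by
  obtain ⟨μ, h1, h2⟩ := h
  exact ⟨μ, runs_else hL hw hs hc h1, h2⟩

theorem Meets.call {O : Oracle} {env va : Val} {A f a : Code} {L B : ℕ} {Sure Good : Val → Prop}
    {δ : ℝ} (hL : 2 ^ 30 ≤ L) (hw : env.width ≤ L) (hs : short (.pair f a) = true)
    (hf : den f env = program A) (ha : den a env = va)
    (h : Meets O (.pair va (.pair (program A) (.int 0))) A B Sure Good δ) :
    Meets O env (.app f a) (B + L ^ 2) Sure Good δ := by
  obtain ⟨μ, h1, h2⟩ := h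
  exact ⟨μ, runs_call hL hw hs hf ha h1, h2⟩

/-- Every guess is charged `δ₀`, and `δ` is charged once. Before the right guess, a pass is harmless
by soundness and a rejection moves on. At the right guess, a pass is forced except with probability
`δ₀ + δ`. -/
theorem search_meets (O : Oracle) {cd : Code} {L n a₁ b₁ a₂ K b₃ m R Γ : ℕ} {o : Val}
    {f : Cube n → Bool} (hf : (sat f).Nonempty) {ε δ₀ δ : ℝ} (hδ₀ : 0 ≤ δ₀) (hδ : 0 ≤ δ)
    (hL : 2 ^ 30 ≤ L) (hn : n + 1 < L)
    (hpw : (paramVal n a₁ b₁ a₂ K b₃ m R Γ (2 ^ n : ℕ) o).width ≤ L)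
    (hcd : ∀ j, 1 ≤ j → j ≤ 2 ^ n → ∀ δ', 0 ≤ δ' → (RightGuess f K j → δ ≤ δ') →
      Meets O (.pair (.pair (paramVal n a₁ b₁ a₂ K b₃ m R Γ (2 ^ n : ℕ) o) (.int j))
          (.pair (program cd) (.int 0))) cd (L ^ 12)
        (fun v => v.width ≤ L ^ 2 ∧ ∃ D : PMF (Cube n), SamplesAlways (L ^ 8) v.snd D)
        (fun v => (v.fst.truthy = true → (j : ℝ) ≤ (1 + 1 / (K : ℝ)) * (sat f).card →
            ∃ D : PMF (Cube n), SamplesAlways (L ^ 8) v.snd D ∧ l1 D (unifSat f hf) ≤ ε) ∧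
          (RightGuess f K j → v.fst.truthy = true)) (δ₀ + δ'))
    (k : ℕ) (hk : k ≤ L) (j : ℕ) (hj : 1 ≤ j) (hj' : j ≤ 2 ^ n) :
    Meets O (.pair (.pair (.int k) (.pair (paramVal n a₁ b₁ a₂ K b₃ m R Γ (2 ^ n : ℕ) o) (.int j)))
        (.pair (program (search cd)) (.int 0))) (search cd) ((k + 1) * (2 * L ^ 12))
      (fun G => ∃ D : PMF (Cube n), SamplesAlways (L ^ 8) G D)
      (fun G => Reaches f K k j →
        ∃ D : PMF (Cube n), SamplesAlways (L ^ 8) G D ∧ l1 D (unifSat f hf) ≤ ε)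
      (k * δ₀ + δ) := by
  have hjw : ∀ j : ℕ, j ≤ 2 ^ n → (Val.int (j : ℤ)).width ≤ L := fun j hj => by
    refine le_trans (Nat.size_le_size (show j ≤ 2 ^ n from hj)) ?_
    rw [Nat.size_pow]
    exact hn.le
  have e2 := Nat.pow_le_pow_right (show 0 < L by omega) (show 2 ≤ 12 by norm_num)
  have e8 : 100 * L ^ 7 ≤ L ^ 8 := by
    rw [pow_succ L 7, mul_comm]; exact Nat.mul_le_mul_left _ (by omega)
  have e2' := Nat.pow_le_pow_right (show 0 < L by omega) (show 2 ≤ 7 by norm_num)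
  have e4' := Nat.pow_le_pow_right (show 0 < L by omega) (show 4 ≤ 7 by norm_num)
  have e12 := Nat.pow_le_pow_right (show 0 < L by omega) (show 8 ≤ 12 by norm_num)
  have hL2 : 2 ^ 30 ≤ L ^ 2 := by nlinarith
  have hL3 : L ≤ L ^ 2 := by nlinarith
  have hL4 : (L ^ 2) ^ 2 = L ^ 4 := by ring
  have hLp : 0 < L ^ 7 := by positivity
  induction k generalizing j with
  | zero =>
    have w0 := width_program (A := search cd) (show (Val.pair (.int (0 : ℕ)) (.pair
      (paramVal n a₁ b₁ a₂ K b₃ m R Γ (2 ^ n : ℕ) o) (.int j))).width ≤ L from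
      max_le (by simp [Val.width]) (max_le hpw (hjw j hj')))
    refine Meets.mono (B := L ^ 2 + L ^ 2) (δ := 0) ?_ (by omega) (by simpa using hδ)
    -- With no guess left a constant sampler is returned; nothing is promised about it, as `Reaches
    -- f K 0 j` is false.
    refine Meets.cond_false hL w0 rfl rfl (Meets.of_pure (runs_short hL w0 rfl rfl) ?_
      (fun h => h.elim) le_rfl)
    refine ⟨PMF.pure (dec n (.int 0)), fun O' => ?_⟩
    rw [PMF.pure_map]
    refine CallRuns.mono (B := L ^ 4 + L ^ 2) (runs_call hL (env := .pair (.int 0) (.pair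
      (.clo constBody _) _)) (max_le (by simp [Val.width]) (max_le w0 w0)) rfl rfl rfl
      (san_runs O' hL n (.int 0) (by omega) (by simp [Val.width]))) (by omega)
  | succ k ih =>
    have w0 := width_program (A := search cd) (show (Val.pair (.int (k + 1 : ℕ)) (.pair
      (paramVal n a₁ b₁ a₂ K b₃ m R Γ (2 ^ n : ℕ) o) (.int j))).width ≤ L from
      max_le (size_le_of_le hk) (max_le hpw (hjw j hj')))
    have hnx : 1 ≤ nextGuess n K j ∧ nextGuess n K j ≤ 2 ^ n :=
      ⟨le_min Nat.one_le_two_pow (Nat.le_add_left _ _), min_le_left _ _⟩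
    have ih := ih (by omega) (nextGuess n K j) hnx.1 hnx.2
    set Q := (k + 1) * (2 * L ^ 12) with hQ
    refine Meets.mono (B := (L ^ 12 + L ^ 2) + ((Q + L ^ 4) + L ^ 4) + 4 + L ^ 2)
      (δ := δ₀ + (k * δ₀ + δ)) ?_ ?_ (by push_cast; linarith)
    swap
    · rw [add_mul, ← hQ]
      omega
    refine Meets.cond_true hL w0 rfl (truthy_natCast_succ k) ?_
    have hkδ : 0 ≤ k * δ₀ := by positivity
    -- The proposition `P` will be the good event of the candidate, supposed without charge in the
    -- continuation. A rejected candidate must either contradict `P` or leave enough failure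
    -- probability for the remaining guesses.
    have hcont : ∀ v, (v.width ≤ L ^ 2 ∧ ∃ D : PMF (Cube n), SamplesAlways (L ^ 8) v.snd D) →
        ∀ (δ' : ℝ) (P : Prop), 0 ≤ δ' →
        (v.fst.truthy = true → P → Reaches f K (k + 1) j →
          ∃ D : PMF (Cube n), SamplesAlways (L ^ 8) v.snd D ∧ l1 D (unifSat f hf) ≤ ε) →
        (v.fst.truthy = false → (P → Reaches f K (k + 1) j → Reaches f K k (nextGuess n K j)) ∧
          (P → k * δ₀ + δ ≤ δ')) →
        Meets O (.pair v (.pair (.clo searchStep (.pair (.pair (.int (k + 1 : ℕ)) (.pair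
          (paramVal n a₁ b₁ a₂ K b₃ m R Γ (2 ^ n : ℕ) o) (.int j)))
            (.pair (program (search cd)) (.int 0)))) (.pair (.pair (.int (k + 1 : ℕ)) (.pair
          (paramVal n a₁ b₁ a₂ K b₃ m R Γ (2 ^ n : ℕ) o) (.int j)))
            (.pair (program (search cd)) (.int 0))))) searchStep ((Q + L ^ 4) + L ^ 4)
          (fun G => ∃ D : PMF (Cube n), SamplesAlways (L ^ 8) G D)
          (fun G => P → Reaches f K (k + 1) j →
            ∃ D : PMF (Cube n), SamplesAlways (L ^ 8) G D ∧ l1 D (unifSat f hf) ≤ ε) δ' := by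
      rintro v ⟨hvw, hvD⟩ δ' P hδ' h1 h2
      have w1 := fun t => width_let (t := t) hvw (w0.trans hL3)
      rw [← hL4]
      cases hv : v.fst.truthy with
      | true =>
        refine Meets.mono (B := (L ^ 2) ^ 2 + (L ^ 2) ^ 2) (Meets.cond_true hL2 (w1 _) rfl hv
          (Meets.of_pure (runs_short hL2 (w1 _) rfl rfl) hvD (h1 hv) hδ')) (by omega) le_rfl
      | false =>
        refine Meets.cond_false hL2 (w1 _) rfl hv (Meets.call hL2 (w1 _) rfl rfl
          (va := .pair (.int k) (.pair (paramVal n a₁ b₁ a₂ K b₃ m R Γ (2 ^ n : ℕ) o)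
            (.int (nextGuess n K j : ℕ)))) ?_ ?_)
        · rw [← den_nextCode (n := n) (a₁ := a₁) (b₁ := b₁) (a₂ := a₂) (K := K) (b₃ := b₃) (m := m)
            (R := R) (Γ := Γ) (j := j) (o := o) (k := .int (k + 1 : ℕ)) (v := v)]
          simp [den, Arith.apply, Val.toInt, Val.lookup, Val.fst, Val.snd]
          rfl
        · by_cases hP : P
          · exact (ih.mono le_rfl ((h2 hv).2 hP)).imp (fun _ h => h)
              (fun G _ hG hP hR => hG ((h2 hv).1 hP hR))
          · exact ih.of_forall (fun _ h => absurd h hP) hδ'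
    -- At the right guess the good event excludes rejection, so the whole of `δ` may be spent here.
    -- At any other guess `δ` is kept for later.
    by_cases hr : RightGuess f K j
    · refine Meets.mono (δ := (δ₀ + δ) + k * δ₀) (Meets.let_ hkδ (Meets.call hL w0 rfl rfl rfl
        (hcd j hj hj' δ hδ fun _ => le_rfl)) fun v hv => hcont v hv _ _ hkδ ?_ ?_) le_rfl
        (by linarith)
      · exact fun h1 h2 _ => h2.1 h1 hr.2.le
      · intro h1
        refine ⟨fun h2 => ?_, fun h2 => ?_⟩ <;>
        · have := h2.2 hr
          rw [h1] at this
          exact absurd this (by simp)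
    · refine Meets.mono (δ := (δ₀ + 0) + (k * δ₀ + δ)) (Meets.let_ (by positivity)
        (Meets.call hL w0 rfl rfl rfl (hcd j hj hj' 0 le_rfl fun h => absurd h hr))
        fun v hv => hcont v hv _ _ (by positivity) ?_ ?_) le_rfl (by linarith)
      · intro h1 h2 h3
        refine h2.1 h1 ?_
        rcases h3 with h3 | h3
        · exact absurd h3 hr
        -- A guess before the right one is below the target, hence a pass is sound.
        · have h4 : (j : ℝ) ≤ (sat f).card := by exact_mod_cast h3.1.le
          have h5 : (0 : ℝ) ≤ 1 / K := by positivity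
          have h6 : (0 : ℝ) ≤ 1 / K * (sat f).card := by positivity
          linarith
      · exact fun _ => ⟨fun _ h3 => (h3.resolve_left hr).2, fun _ => le_rfl⟩

/-! ### The choice of the parameters -/

/-- The accuracy of the generator and of the counter. -/
def accParam (a₂ S : ℕ) : ℕ := 16 * a₂ * (S + 1)

/-- The confidence of the generator and of the counter. -/
def confParam (K b n T : ℕ) : ℕ := 16 * K * b * (n + 1) * (T + 1)

/-- The number of samples. -/
def sampleParam (K s T n : ℕ) : ℕ := 16 * K * K * (s + T + n + K)

/-- `K` is at least `1024 (S + 1)` and at least `16 * (64 a) * Γ`. The number of samples is `16 K ^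
2` times the desired scale `Q = b.size + T + n + K`, so both Hoeffding exponents are at least `16
Q`. -/
theorem accuracy_params {a b Γ S T n : ℕ} (ha : 1 ≤ a) (hb : 1 ≤ b) (hΓ : 1 ≤ Γ) :
    Accuracy (64 * a) (accParam (64 * a * Γ) S) (confParam (accParam (64 * a * Γ) S) b n T)
      (sampleParam (accParam (64 * a * Γ) S) b.size T n) (16 * (64 * a * Γ)) Γ S
      (2 * Real.exp (-(16 * (b.size + T + n + accParam (64 * a * Γ) S : ℕ)))) := by
  set K := accParam (64 * a * Γ) S with hK
  have haΓ : 1 ≤ a * Γ := Nat.mul_pos ha hΓ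
  have hK1 : 16 * (64 * a) * Γ ≤ K := by
    rw [hK, accParam]
    calc 16 * (64 * a) * Γ ≤ 16 * (64 * a) * Γ * (S + 1) := Nat.le_mul_of_pos_right _ (by omega)
      _ = 16 * (64 * a * Γ) * (S + 1) := by ring
  have hK2 : 1024 * (S + 1) ≤ K := by
    rw [hK, accParam]
    calc 1024 * (S + 1) ≤ a * Γ * (1024 * (S + 1)) := Nat.le_mul_of_pos_left _ haΓ
      _ = 16 * (64 * a * Γ) * (S + 1) := by ring
  have hK0 : 1 ≤ K := by omega
  set Q := b.size + T + n + K with hQ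
  have hm : sampleParam K b.size T n = 16 * K * K * Q := rfl
  have hQ0 : (0 : ℝ) ≤ Q := by positivity
  have ha' : (1 : ℝ) ≤ a := by exact_mod_cast ha
  have hΓ' : (1 : ℝ) ≤ Γ := by exact_mod_cast hΓ
  have hK1' : (16 : ℝ) * (64 * a) * Γ ≤ K := by exact_mod_cast hK1
  have hK2' : (1024 : ℝ) * (S + 1) ≤ K := by exact_mod_cast hK2
  refine ⟨by omega, hΓ, hK1, hK2, ?_, le_of_eq (by ring), ?_, ?_, ?_, ?_⟩
  · have h1 : 1 ≤ b * (n + 1) * (T + 1) := Nat.mul_pos (Nat.mul_pos hb (by omega)) (by omega)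
    have h2 : 2 * K * 1 ≤ 16 * K * (b * (n + 1) * (T + 1)) := Nat.mul_le_mul (by omega) h1
    rw [confParam]
    calc 2 * K ≤ 16 * K * (b * (n + 1) * (T + 1)) := by omega
      _ = _ := by ring
  · rw [hm]
    have : 1 ≤ Q := by omega
    positivity
  · refine mul_le_mul_of_nonneg_left (Real.exp_le_exp.2 (neg_le_neg ?_)) (by norm_num)
    rw [le_div_iff₀ (by positivity), hm]
    push_cast
    have h1 : (1024 * ((S : ℝ) + 1)) ^ 2 ≤ (K : ℝ) ^ 2 := pow_le_pow_left₀ (by positivity) hK2' 2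
    have h2 := mul_le_mul_of_nonneg_right h1 hQ0
    have h3 : 0 ≤ ((S : ℝ) + 1) ^ 2 * Q := by positivity
    nlinarith
  · refine mul_le_mul_of_nonneg_left (Real.exp_le_exp.2 (neg_le_neg ?_)) (by norm_num)
    have e : (sampleParam K b.size T n : ℝ) * (1 / ((64 * a : ℕ) : ℝ) / (8 * Γ)) ^ 2 / 4 =
        (sampleParam K b.size T n : ℝ) / (16 * (64 * a) * Γ) ^ 2 := by
      push_cast
      field_simp
      ring
    rw [e, le_div_iff₀ (by positivity), hm]
    push_cast
    have h1 := pow_le_pow_left₀ (by positivity) hK1' 2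
    have h2 := mul_le_mul_of_nonneg_right h1 hQ0
    nlinarith
  · have h1 : (1 : ℝ) ≤ Q := by exact_mod_cast (by omega : 1 ≤ Q)
    have h2 := Real.add_one_le_exp (16 * (Q : ℝ))
    rw [Real.exp_neg, ← div_eq_mul_inv, div_lt_one (Real.exp_pos _)]
    linarith

/-- Each of `n + 1`, `T + 1`, `K + 1` is at most a power of two with exponent `n`, `T`, `K`, and `b
≤ 2 ^ b.size`. So a number of samples linear in the bit length of `b` makes the tails small against
`1 / b`. -/
theorem exp_neg_le {b n T K : ℕ} (hK : 1 ≤ K) :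
    Real.exp (-(16 * (b.size + T + n + K : ℕ))) * 64 * (b * (n + 1) * (T + 1) * (K + 1)) ≤ 1 := by
  set Q := b.size + T + n + K with hQ
  have h1 : b * (n + 1) * (T + 1) * (K + 1) ≤ 2 ^ Q := by
    have hb : b ≤ 2 ^ b.size := (Nat.lt_size_self b).le
    have hn : n + 1 ≤ 2 ^ n := Nat.lt_two_pow_self
    have hT : T + 1 ≤ 2 ^ T := Nat.lt_two_pow_self
    have hK : K + 1 ≤ 2 ^ K := Nat.lt_two_pow_self
    calc b * (n + 1) * (T + 1) * (K + 1) ≤ 2 ^ b.size * 2 ^ n * 2 ^ T * 2 ^ K :=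
          Nat.mul_le_mul (Nat.mul_le_mul (Nat.mul_le_mul hb hn) hT) hK
      _ = 2 ^ Q := by rw [hQ]; ring
  have h1' : (b * (n + 1) * (T + 1) * (K + 1) : ℝ) ≤ 2 ^ Q := by exact_mod_cast h1
  have h2 : (64 : ℝ) * 2 ^ Q ≤ Real.exp (16 * (Q : ℝ)) := by
    have hQ1 : 1 ≤ Q := by omega
    have h3 : (2 : ℝ) ≤ Real.exp 1 := by linarith [Real.add_one_le_exp (1 : ℝ)]
    have h4 : (2 : ℝ) ^ (16 * Q) ≤ Real.exp (16 * (Q : ℝ)) := by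
      calc (2 : ℝ) ^ (16 * Q) ≤ Real.exp 1 ^ (16 * Q) := pow_le_pow_left₀ (by norm_num) h3 _
        _ = Real.exp (16 * (Q : ℝ)) := by rw [← Real.exp_nat_mul]; congr 1; push_cast; ring
    refine le_trans ?_ h4
    calc (64 : ℝ) * 2 ^ Q = 2 ^ (6 + Q) := by rw [pow_add (2 : ℝ) 6 Q]; norm_num
      _ ≤ 2 ^ (16 * Q) := pow_le_pow_right₀ (by norm_num) (by omega)
  rw [Real.exp_neg, mul_assoc, inv_mul_le_one₀ (Real.exp_pos _)]
  linarith

/-- The factors `K * (n + 1)` in `confParam` absorb the number of guesses. In units of `1 / b` the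
total is at most 1/16 for the counts, 6/64 for the tails, and 1/64 each for densifier and learner.
-/
theorem failure_params {b n T K : ℕ} (hb : 1 ≤ b) (hK : 1 ≤ K) {η : ℝ}
    (hη : η = 2 * Real.exp (-(16 * (b.size + T + n + K : ℕ)))) :
    ((n * K + 1 : ℕ) : ℝ) * (1 / (confParam K b n T : ℝ) + 2 * η) +
      (1 / ((64 * b : ℕ) : ℝ) + (1 / ((64 * b : ℕ) : ℝ) + T * η)) ≤ 1 / b := by
  have hb' : (1 : ℝ) ≤ b := by exact_mod_cast hb
  have hK' : (1 : ℝ) ≤ K := by exact_mod_cast hK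
  have hn' : (0 : ℝ) ≤ n := by positivity
  have hT' : (0 : ℝ) ≤ T := by positivity
  have h0 := exp_neg_le (b := b) (n := n) (T := T) hK
  rw [hη]
  have hx : 0 < Real.exp (-(16 * (b.size + T + n + K : ℕ))) := Real.exp_pos _
  generalize Real.exp (-(16 * (b.size + T + n + K : ℕ))) = x at h0 hx
  have hb0 : (0 : ℝ) < b := by linarith
  have h1 : ((n * K + 1 : ℕ) : ℝ) * (1 / (confParam K b n T : ℝ)) ≤ 1 / 16 * (1 / b) := by
    rw [confParam]
    push_cast
    have e : 1 / 16 * (1 / (b : ℝ)) = (n + 1) * K * (T + 1) *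
        (1 / (16 * K * b * (n + 1) * (T + 1))) := by field_simp
    rw [e]
    refine mul_le_mul_of_nonneg_right ?_ (by positivity)
    have h2 : (n : ℝ) * K + 1 ≤ (n + 1) * K := by linarith
    exact h2.trans (le_mul_of_one_le_right (by positivity) (by linarith))
  have h2 : ((n * K + 1 : ℕ) : ℝ) * (2 * (2 * x)) + T * (2 * x) ≤ 6 / 64 * (1 / b) := by
    push_cast
    have h3 : x * ((n + 1) * (T + 1) * (K + 1)) ≤ 1 / 64 * (1 / b) := by
      have e : 1 / 64 * (1 / (b : ℝ)) = 1 / (64 * b) := by ring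
      rw [e, le_div_iff₀ (by positivity)]
      linarith
    have h4 : 4 * ((n : ℝ) * K + 1) + 2 * T ≤ 6 * ((n + 1) * (T + 1) * (K + 1)) := by
      have h5 : 0 ≤ (n : ℝ) * K := by positivity
      have h6 : 0 ≤ (n : ℝ) * T := by positivity
      have h7 : 0 ≤ (T : ℝ) * K := by positivity
      have h8 : 0 ≤ (n : ℝ) * T * K := by positivity
      linarith
    have h9 := mul_le_mul_of_nonneg_left h4 hx.le
    linarith
  have h3 : 1 / ((64 * b : ℕ) : ℝ) = 1 / 64 * (1 / b) := by push_cast; ring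
  have h4 : 0 < 1 / (b : ℝ) := by positivity
  rw [h3]
  linarith

/-- Exponents of `Z` are tracked: 3 for `a₂`, 5 for `K`, 17 for the number of samples, 23 for the
largest sum, whence 24. The confidence parameters enter through their bit lengths only. -/
theorem sizes_params {n a b Γ S Td Tg Tc T₁ t₂ Z : ℕ} (ha : 1 ≤ a)
    (hZ : 64 + n + a + b.size + Td + Γ + Tg + Tc + T₁ + t₂ + S ≤ Z) :
    Sizes (Z ^ 24) n (64 * a) (64 * b) (64 * a * Γ) (accParam (64 * a * Γ) S)
      (confParam (accParam (64 * a * Γ) S) b n T₁)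
      (sampleParam (accParam (64 * a * Γ) S) b.size T₁ n) (16 * (64 * a * Γ)) Γ Td Tg Tc T₁ t₂ ∧
    n * accParam (64 * a * Γ) S + 1 < Z ^ 24 := by
  have hZ64 : 64 ≤ Z := by omega
  have hZ0 : 0 < Z := by omega
  have hpow : ∀ {i j : ℕ}, i ≤ j → Z ^ i ≤ Z ^ j := fun h => Nat.pow_le_pow_right hZ0 h
  have hlt : Z ^ 23 < Z ^ 24 := Nat.pow_lt_pow_right (by omega) (by norm_num)
  have h23 : ∀ x, x ≤ Z → x < Z ^ 24 := fun x hx =>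
    (hx.trans (by simpa using hpow (show 1 ≤ 23 by norm_num))).trans_lt hlt
  have ha₁ : 64 * a ≤ Z ^ 2 := by rw [pow_two]; exact Nat.mul_le_mul hZ64 (by omega)
  have ha₂ : 64 * a * Γ ≤ Z ^ 3 := by
    rw [pow_succ Z 2]; exact Nat.mul_le_mul ha₁ (by omega)
  have hR : 16 * (64 * a * Γ) ≤ Z ^ 4 := by
    rw [pow_succ Z 3, mul_comm]; exact Nat.mul_le_mul ha₂ (by omega)
  have hK : accParam (64 * a * Γ) S ≤ Z ^ 5 := by
    rw [accParam, pow_succ Z 4]; exact Nat.mul_le_mul hR (by omega)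
  set K := accParam (64 * a * Γ) S
  have h15 : Z ≤ Z ^ 5 := by simpa using hpow (show 1 ≤ 5 by norm_num)
  have hQ : b.size + T₁ + n + K ≤ Z ^ 6 := by
    have : 64 * Z ^ 5 ≤ Z ^ 6 := by
      rw [pow_succ Z 5, mul_comm]; exact Nat.mul_le_mul_left _ hZ64
    omega
  have hm : sampleParam K b.size T₁ n ≤ Z ^ 17 := by
    calc sampleParam K b.size T₁ n = 16 * K * K * (b.size + T₁ + n + K) := rfl
      _ ≤ Z * Z ^ 5 * Z ^ 5 * Z ^ 6 :=
          Nat.mul_le_mul (Nat.mul_le_mul (Nat.mul_le_mul (by omega) hK) hK) hQ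
      _ = Z ^ 17 := by ring
  have hmK : sampleParam K b.size T₁ n * (2 * K) ≤ Z ^ 23 := by
    calc _ ≤ Z ^ 17 * (Z * Z ^ 5) := Nat.mul_le_mul hm (Nat.mul_le_mul (by omega) hK)
      _ = Z ^ 23 := by ring
  have hsz : ∀ i x, i ≤ 23 → x ≤ Z ^ i → x < Z ^ 24 := fun i x hi hx =>
    (hx.trans (hpow hi)).trans_lt hlt
  have h64 : (64 : ℕ).size ≤ 7 := by decide
  have h16 : (16 : ℕ).size ≤ 5 := by decide
  refine ⟨⟨?_, ?_, ?_, ?_, ?_, ?_, ?_, hsz 5 _ (by norm_num) hK, hsz 17 _ (by norm_num) hm,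
    hmK.trans_lt hlt, hsz 4 _ (by norm_num) hR, h23 _ (by omega), h23 _ (by omega),
    h23 _ (by omega), h23 _ (by omega), h23 _ (by omega)⟩, ?_⟩
  · calc 2 ^ 30 ≤ 64 ^ 24 := by norm_num
      _ ≤ Z ^ 24 := Nat.pow_le_pow_left hZ64 24
  · exact h23 _ (by omega)
  · exact size_le_of_le (hsz 2 _ (by norm_num) ha₁).le
  · refine (size_mul_le 64 b).trans (h23 _ (by omega)).le
  · exact size_le_of_le (hsz 3 _ (by norm_num) ha₂).le
  · refine le_trans ?_ (hpow (show 6 ≤ 24 by norm_num))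
    have s1 := size_mul_le 16 K
    have s2 := size_mul_le (16 * K) b
    have s3 := size_mul_le (16 * K * b) (n + 1)
    have s4 := size_mul_le (16 * K * b * (n + 1)) (T₁ + 1)
    have s5 : K.size ≤ Z ^ 5 := size_le_of_le hK
    have s6 : (n + 1).size ≤ n + 1 := size_le_of_le le_rfl
    have s7 : (T₁ + 1).size ≤ T₁ + 1 := size_le_of_le le_rfl
    have : 64 * Z ^ 5 ≤ Z ^ 6 := by
      rw [pow_succ Z 5, mul_comm]; exact Nat.mul_le_mul_left _ hZ64
    rw [confParam]
    omega
  · exact size_le_of_le (h23 _ (by omega)).le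
  · refine hsz 7 _ (by norm_num) ?_
    have h1 : n * K ≤ Z * Z ^ 5 := Nat.mul_le_mul (by omega) hK
    have h2 : Z * Z ^ 5 = Z ^ 6 := by ring
    have : 64 * Z ^ 6 ≤ Z ^ 7 := by
      rw [pow_succ Z 6, mul_comm]; exact Nat.mul_le_mul_left _ hZ64
    have : 0 < Z ^ 6 := by positivity
    omega

/-! ### The algorithm -/

/-- The term `64 a`, from a term for the argument. -/
def codeA (x : Code) : Code := .arith .mul (.lit 64) (.fst (.snd x))

/-- The term `64 b`, from a term for the argument. -/
def codeB (x : Code) : Code := .arith .mul (.lit 64) (.fst (.snd (.snd x)))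

/-- The argument of `search`: the variables are, in this order, `K`, the bit length of `b`, `2 ^ n`,
`T₁`, `S`, `Γ`, and the argument of the algorithm. -/
def searchArg : Code :=
  let x : Code := .var 12
  let n : Code := .fst x
  let b : Code := .fst (.snd (.snd x))
  let a₂ : Code := .arith .mul (codeA x) (.var 10)
  let K : Code := .var 0
  .pair (.arith .add (.arith .mul n K) (.lit 1))
    (.pair
      (.pair n (.pair (codeA x) (.pair (codeB x) (.pair a₂ (.pair K
        (.pair (.arith .mul (.arith .mul (.arith .mul (.arith .mul (.lit 16) K) b)
            (.arith .add n (.lit 1))) (.arith .add (.var 6) (.lit 1)))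
          (.pair (.arith .mul (.arith .mul (.arith .mul (.lit 16) K) K)
              (.arith .add (.arith .add (.arith .add (.var 2) (.var 6)) n) K))
            (.pair (.arith .mul (.lit 16) a₂) (.pair (.var 10) (.pair (.var 4)
              (.snd (.snd (.snd x)))))))))))))
      (.lit 1))

/-- The inverse approximate uniform generation algorithm. -/
def invGen (Aden Agen Acount Asq ev Agam Atau At₁ : Code) : Code :=
  let_ (.app (.proc Agam) (argsCode (.fst (.var 0)) (codeA (.var 0)) (codeB (.var 0)) (.lit 0)))
  (let_ (.app (.proc Atau) (argsCode (.fst (.var 2)) (.arith .mul (codeA (.var 2)) (.var 0))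
    (codeB (.var 2)) (.lit 0)))
  (let_ (.app (.proc At₁) (argsCode (.fst (.var 4)) (.arith .mul (codeA (.var 4)) (.var 2))
    (codeB (.var 4)) (.lit 0)))
  (let_ (.app (.proc pow2) (.fst (.var 6)))
  (let_ (.app (.proc bitlen) (.fst (.snd (.snd (.var 8)))))
  (let_ (.arith .mul (.arith .mul (.lit 16) (.arith .mul (codeA (.var 10)) (.var 8)))
    (.arith .add (.var 6) (.lit 1)))
  (.app (.proc (search (cand Aden Agen Acount Asq ev))) searchArg))))))

theorem den_searchArg {n a b Γ S T s K : ℕ} {o e1 e2 e3 e4 e5 e6 e : Val} :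
    den searchArg (.pair (.int K) (.pair e1 (.pair (.int s) (.pair e2 (.pair (.int ((2 : ℤ) ^ n))
      (.pair e3 (.pair (.int T) (.pair e4 (.pair (.int S) (.pair e5 (.pair (.int Γ) (.pair e6
        (.pair (args n a b o) e))))))))))))) =
    .pair (.int (n * K + 1 : ℕ)) (.pair (paramVal n (64 * a) (64 * b) (64 * a * Γ) K
      (confParam K b n T) (sampleParam K s T n) (16 * (64 * a * Γ)) Γ (2 ^ n : ℕ) o)
      (.int (1 : ℕ))) := by
  simp [searchArg, codeA, codeB, den, Val.lookup, Val.fst, Val.snd, Val.toInt, Arith.apply, args,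
    paramVal, confParam, sampleParam]

theorem short_searchArg (cd : Code) : short (.pair (.proc cd) searchArg) = true := by
  simp [short, simple, sz, searchArg, codeA, codeB]

/-- With `L = Z ^ 24` the computation of the parameters and the search over `n K + 1` guesses take
at most `L ^ 15 = Z ^ 360` steps. -/
theorem invGen_meets {C : ConceptClass} {C' : RepClass} {Aden Agen Acount Asq Agam Atau At₁ : Code}
    {Tden gammaInv Tgen Tcount t₁ : ℕ → ℕ → ℕ → ℕ} {t₂ : ℕ → ℕ} {tauInv : ℕ → ℕ → ℕ}
    (hden : IsDensifier C C' gammaInv Aden Tden) (hgen : IsApproxGen C' Agen Tgen)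
    (hcount : IsApproxCount C' Acount Tcount) (hsq : IsSQLearner C Asq t₁ t₂ tauInv)
    {n a b Γ S T₁ K b₃ Z : ℕ} (ha : 1 ≤ a) (hb : 1 ≤ b)
    {f : Cube n → Bool} (hfC : f ∈ C n) (hf : (sat f).Nonempty)
    (hΓ : Γ = gammaInv n (64 * a) (64 * b)) (hS : S = tauInv n (64 * a * Γ))
    (hT₁ : T₁ = t₁ n (64 * a * Γ) (64 * b)) (hK : K = accParam (64 * a * Γ) S)
    (hb₃ : b₃ = confParam K b n T₁)
    (hgam : exec noOracle (Tden n (64 * a) (64 * b)) (program Agam)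
      (args n (64 * a) (64 * b) (.int 0)) = PMF.pure (some (.int Γ)))
    (htau : exec noOracle T₁ (program Atau)
      (args n (64 * a * Γ) (64 * b) (.int 0)) = PMF.pure (some (.int S)))
    (ht₁ : exec noOracle T₁ (program At₁)
      (args n (64 * a * Γ) (64 * b) (.int 0)) = PMF.pure (some (.int T₁)))
    (hZ : 64 + n + a + b.size + Tden n (64 * a) (64 * b) + Γ + Tgen n K b₃ + Tcount n K b₃ + T₁ +
      t₂ n + S ≤ Z) :
    Meets (sampleOracle (unifSat f hf)) (.pair (args n a b (.orc 0))
        (.pair (program (invGen Aden Agen Acount Asq C'.ev Agam Atau At₁)) (.int 0)))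
      (invGen Aden Agen Acount Asq C'.ev Agam Atau At₁) (Z ^ 360)
      (fun G => ∃ D : PMF (Cube n), SamplesAlways (Z ^ 360) G D)
      (fun G => ∃ D : PMF (Cube n), SamplesAlways (Z ^ 360) G D ∧
        l1 D (unifSat f hf) ≤ 1 / (a : ℝ)) (1 / b) := by
  have hΓ1 : 1 ≤ Γ := hΓ ▸ hden.pos n (64 * a) (64 * b) (by omega) (by omega)
  have hacc := accuracy_params (S := S) (T := T₁) (n := n) ha hb hΓ1
  obtain ⟨hsz, hk⟩ := sizes_params (b := b) ha hZ
  have hK1 : 1 ≤ K := by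
    have := hacc.hKS
    rw [← hK] at this
    omega
  have hfail := failure_params (n := n) (T := T₁) hb hK1 rfl
  rw [← hK, ← hb₃] at hacc hsz
  rw [← hK] at hk
  rw [← hb₃] at hfail
  set η := 2 * Real.exp (-(16 * (b.size + T₁ + n + K : ℕ))) with hη
  have hη0 : 0 ≤ η := by positivity
  have eZ : ∀ i j k : ℕ, i * j ≤ k → (Z ^ i) ^ j ≤ Z ^ k := fun i j k h => by
    rw [← pow_mul]; exact Nat.pow_le_pow_right (by omega) h
  have e8 := eZ 24 8 360 (by norm_num)
  have e15 := eZ 24 15 360 (by norm_num)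
  have hZL : Z ≤ Z ^ 24 := by
    simpa using Nat.pow_le_pow_right (show 0 < Z by omega) (show 1 ≤ 24 by norm_num)
  have hbZ : b.size < Z ^ 24 := lt_of_lt_of_le (by omega) hZL
  have haZ : a.size ≤ Z ^ 24 := size_le_of_le (le_trans (by omega) hZL)
  have hSZ : S ≤ Z ^ 24 := le_trans (by omega) hZL
  generalize Z ^ 24 = L at *
  have hL := hsz.hL
  have hn := hsz.hn
  have hnw : (Val.int (n : ℤ)).width ≤ L := size_le_of_le (by omega)
  have hT₁L := hsz.hT₁
  have hTdL := hsz.hTd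
  have hLp : ∀ i, i ≤ 14 → L ^ i ≤ L ^ 14 := fun i hi => Nat.pow_le_pow_right (by omega) hi
  have hsearch := search_meets (sampleOracle (unifSat f hf))
    (cd := cand Aden Agen Acount Asq C'.ev) (ε := 64 * (1 / (64 * a : ℕ)))
    (δ₀ := 1 / (b₃ : ℝ) + 2 * η)
    (δ := 1 / ((64 * b : ℕ) : ℝ) + (1 / ((64 * b : ℕ) : ℝ) + T₁ * η)) hf (by positivity)
    (by positivity) hL hn (hsz.width_paramVal (o := .orc 0) (Nat.zero_le _)) (by
      intro j hj hj' δ' hδ' hδr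
      -- For a wrong guess the charges for densifier and learner are set to zero.
      by_cases hr : RightGuess f K j
      · have hc := cand_meets hden hgen hcount hsq hfC hf (by omega) (hΓ ▸ hS ▸ hacc)
          (by rw [← hΓ, ← hT₁]; exact hsz) hj hj' (δ₁ := 1 / ((64 * b : ℕ) : ℝ))
          (δ₂ := 1 / ((64 * b : ℕ) : ℝ) + T₁ * η) (by positivity) (fun _ => le_rfl) (by positivity)
          (fun _ => by rw [← hΓ, ← hT₁])
        rw [← hΓ] at hc
        refine hc.mono le_rfl ?_
        have := hδr hr
        linarith
      · have hc := cand_meets hden hgen hcount hsq hfC hf (by omega) (hΓ ▸ hS ▸ hacc)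
          (by rw [← hΓ, ← hT₁]; exact hsz) hj hj' (δ₁ := 0) (δ₂ := 0) le_rfl
          (fun h => absurd h hr) le_rfl (fun h => absurd h hr)
        rw [← hΓ] at hc
        refine hc.mono le_rfl ?_
        linarith)
    (n * K + 1) hk.le 1 le_rfl Nat.one_le_two_pow
  refine Meets.imp (Sure := fun G => ∃ D : PMF (Cube n), SamplesAlways (L ^ 8) G D)
    (Good := fun G => Reaches f K (n * K + 1) 1 →
        ∃ D : PMF (Cube n), SamplesAlways (L ^ 8) G D ∧
          l1 D (unifSat f hf) ≤ 64 * (1 / (64 * a : ℕ))) ?_ ?_ ?_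
  rotate_left
  · rintro G ⟨D, hD⟩
    exact ⟨D, fun O => (hD O).mono e8⟩
  · rintro G - hG
    obtain ⟨D, hD, hl⟩ := hG (reaches_one hf hK1)
    refine ⟨D, fun O => (hD O).mono e8, hl.trans (le_of_eq ?_)⟩
    push_cast
    field_simp
  refine Meets.mono ?_ (le_refl _) hfail
  generalize hcv : invGen Aden Agen Acount Asq C'.ev Agam Atau At₁ = cd
  have w0 := width_program (A := cd) (show (args n a b (.orc 0)).width ≤ L from
    max_le hnw (max_le haZ (max_le hbZ.le (Nat.zero_le _))))
  generalize program cd = pc at w0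
  subst hcv
  refine Meets.mono (B := (Tden n (64 * a) (64 * b) + 1 + L ^ 2) + ((T₁ + 1 + L ^ 2) +
    ((T₁ + 1 + L ^ 2) + ((L ^ 4 + L ^ 2) + ((L ^ 4 + L ^ 2) + (L ^ 2 +
      ((n * K + 1 + 1) * (2 * L ^ 12) + L ^ 2) + 4) + 4) + 4) + 4) + 4) + 4) ?_ ?_ le_rfl
  swap
  · refine le_trans ?_ e15
    have h1 : (n * K + 1 + 1) * (2 * L ^ 12) ≤ L * (L * L ^ 12) :=
      Nat.mul_le_mul (by omega) (Nat.mul_le_mul_right _ (by omega))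
    have h2 : L * (L * L ^ 12) = L ^ 14 := by ring
    have h3 : 100 * L ^ 14 ≤ L ^ 15 := by
      rw [pow_succ L 14, mul_comm]; exact Nat.mul_le_mul_left _ (by omega)
    have h4 := hLp 2 (by norm_num)
    have h5 := hLp 4 (by norm_num)
    have h6 := hLp 1 (by norm_num)
    rw [pow_one] at h6
    omega
  have hO := fun {T : ℕ} {A : Code} {v w : Val} (h : exec noOracle T (program A) v =
    PMF.pure (some w)) => callRuns_of_noOracle' (μ := PMF.pure w) (by rw [h, PMF.pure_map])
      (sampleOracle (unifSat f hf))
  refine Meets.let_pure (runs_call hL w0 rfl rfl ?_ (hO hgam)) ?_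
  · simp [argsCode, codeA, codeB, den, Val.lookup, Val.fst, Val.snd, Val.toInt, Arith.apply, args]
  have w1 := fun t => width_let (t := t) (show (Val.int (Γ : ℤ)).width ≤ L from hsz.hΓ) w0
  refine Meets.let_pure (runs_call hL (w1 _) rfl rfl ?_ (hO htau)) ?_
  · simp [argsCode, codeA, codeB, den, Val.lookup, Val.fst, Val.snd, Val.toInt, Arith.apply, args]
  have w2 := fun t t1 => width_let (t := t)
    (show (Val.int (S : ℤ)).width ≤ L from size_le_of_le hSZ) (w1 t1)
  refine Meets.let_pure (runs_call hL (w2 _ _) rfl rfl ?_ (hO ht₁)) ?_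
  · simp [argsCode, codeA, codeB, den, Val.lookup, Val.fst, Val.snd, Val.toInt, Arith.apply, args]
  have w3 := fun t t1 t2 => width_let (t := t)
    (show (Val.int (T₁ : ℤ)).width ≤ L from size_le_of_le (by omega)) (w2 t1 t2)
  refine Meets.let_pure (runs_call hL (w3 _ _ _) rfl rfl rfl (pow2_runs _ hL n (by omega))) ?_
  have w4 := fun t t1 t2 t3 => width_let (t := t)
    (show (Val.int ((2 : ℤ) ^ n)).width ≤ L from size_intCast_le (by
      rw [abs_of_pos (by positivity)]
      exact pow_lt_pow_right₀ (by norm_num) (by omega))) (w3 t1 t2 t3)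
  refine Meets.let_pure (runs_call hL (w4 _ _ _ _) rfl rfl rfl (bitlen_runs _ hL b hbZ)) ?_
  have w5 := fun t t1 t2 t3 t4 => width_let (t := t)
    (show (Val.int (b.size : ℤ)).width ≤ L from size_le_of_le hbZ.le) (w4 t1 t2 t3 t4)
  refine Meets.let_pure (v := .int K) (runs_short hL (w5 _ _ _ _ _) rfl ?_) ?_
  · simp [codeA, den, Val.lookup, Val.fst, Val.snd, Val.toInt, Arith.apply, args, hK, accParam]
  have w6 := fun t t1 t2 t3 t4 t5 => width_let (t := t)
    (show (Val.int (K : ℤ)).width ≤ L from size_le_of_le hsz.hK.le) (w5 t1 t2 t3 t4 t5)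
  refine Meets.call hL (w6 _ _ _ _ _ _) (short_searchArg _) rfl den_searchArg ?_
  rw [← hb₃]
  exact hsearch

/-- `accParam` as a polynomial in `n, 1/ε, 1/γ, 1/τ, T₁`. -/
def accPoly : MvPolynomial (Fin 5) ℕ := .C 1024 * .X 1 * .X 2 * (.X 3 + 1)

/-- `confParam` as a polynomial in `n, 1/ε, 1/δ, 1/γ, 1/τ, T₁`. -/
def confPoly : MvPolynomial (Fin 6) ℕ :=
  .C 16384 * .X 1 * .X 3 * (.X 4 + 1) * .X 2 * (.X 0 + 1) * (.X 5 + 1)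

/-- The running time of the inverse generator as a polynomial in the parameters. -/
def timePoly : MvPolynomial (Fin 10) ℕ :=
  (.C 64 + .X 0 + .X 1 + .X 2 + .X 3 + .X 4 + .X 5 + .X 6 + .X 7 + .X 8 + .X 9) ^ 360

theorem eval_accPoly (n a Γ S T : ℕ) :
    MvPolynomial.eval ![n, a, Γ, S, T] accPoly = accParam (64 * a * Γ) S := by
  simp only [accPoly, accParam, map_mul, map_add, map_one, MvPolynomial.eval_C,
    MvPolynomial.eval_X]
  change 1024 * a * Γ * (S + 1) = _
  ring

theorem eval_confPoly (n a b Γ S T : ℕ) :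
    MvPolynomial.eval ![n, a, b, Γ, S, T] confPoly =
      confParam (accParam (64 * a * Γ) S) b n T := by
  simp only [confPoly, accParam, confParam, map_mul, map_add, map_one, MvPolynomial.eval_C,
    MvPolynomial.eval_X]
  change 16384 * a * Γ * (S + 1) * b * (n + 1) * (T + 1) = _
  ring

theorem eval_timePoly (v : Fin 10 → ℕ) :
    MvPolynomial.eval v timePoly =
      (64 + v 0 + v 1 + v 2 + v 3 + v 4 + v 5 + v 6 + v 7 + v 8 + v 9) ^ 360 := by
  simp only [timePoly, map_pow, map_add, MvPolynomial.eval_C, MvPolynomial.eval_X]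

end InvGen

end

theorem theorem3 :
    ∃ (c : ℕ) (pε : MvPolynomial (Fin 5) ℕ) (pδ : MvPolynomial (Fin 6) ℕ)
      (P : MvPolynomial (Fin 10) ℕ), 1 ≤ c ∧
      ∀ (C : ConceptClass) (C' : RepClass) (Aden Agen Acount Asq : Code)
        (Tden gammaInv Tgen Tcount t₁ : ℕ → ℕ → ℕ → ℕ) (t₂ : ℕ → ℕ) (tauInv : ℕ → ℕ → ℕ),
        IsDensifier C C' gammaInv Aden Tden →
        IsApproxGen C' Agen Tgen →
        IsApproxCount C' Acount Tcount →
        IsSQLearner C Asq t₁ t₂ tauInv →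
        ComputableWithin gammaInv Tden →
        ComputableWithin (fun n a _ => tauInv n a) t₁ →
        ComputableWithin t₁ t₁ →
        ∃ Ainv : Code,
          IsInvGen C Ainv (invTime c pε pδ P Tden gammaInv Tgen Tcount t₁ t₂ tauInv) := by
  -- With accuracy `1 / (64 a)` inside, the analysis yields an `ℓ¹` error of at most `64 * (1 / (64
  -- a)) = 1 / a`; the confidence `1 / (64 b)` leaves room for the other failures.
  refine ⟨64, accPoly, confPoly, timePoly, by norm_num, ?_⟩
  rintro C C' Aden Agen Acount Asq Tden gammaInv Tgen Tcount t₁ t₂ tauInv hden hgen hcount hsq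
    ⟨Agam, hgam⟩ ⟨Atau, htau⟩ ⟨At₁, ht₁⟩
  generalize hT : invTime 64 accPoly confPoly timePoly Tden gammaInv Tgen Tcount t₁ t₂ tauInv = T
  have key : ∀ n a b : ℕ, 1 ≤ a → 1 ≤ b → ∀ f ∈ C n, ∀ hf : (sat f).Nonempty, ∃ μ : PMF Val,
      exec (sampleOracle (unifSat f hf)) (T n a b)
        (program (invGen Aden Agen Acount Asq C'.ev Agam Atau At₁)) (args n a b (.orc 0)) =
          μ.map some ∧
      (∀ G ∈ μ.support, ∃ D : PMF (Cube n), IsSampler (T n a b) G D) ∧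
      prob μ {G | ∃ D : PMF (Cube n), IsSampler (T n a b) G D ∧
        dTV D (unifSat f hf) ≤ 1 / (a : ℝ)}ᶜ ≤ 1 / b := by
    intro n a b ha hb f hfC hf
    have h64a : 1 ≤ 64 * a := by omega
    have h64b : 1 ≤ 64 * b := by omega
    have hΓ1 := hden.pos n (64 * a) (64 * b) h64a h64b
    have ha₂ : 1 ≤ 64 * a * gammaInv n (64 * a) (64 * b) := Nat.mul_pos h64a hΓ1
    obtain ⟨μ, h1, h2, h3⟩ := invGen_meets hden hgen hcount hsq ha hb hfC hf rfl rfl rfl rfl rfl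
      (hgam n (64 * a) (64 * b) h64a h64b)
      (htau n (64 * a * gammaInv n (64 * a) (64 * b)) (64 * b) ha₂ h64b)
      (ht₁ n (64 * a * gammaInv n (64 * a) (64 * b)) (64 * b) ha₂ h64b) le_rfl
    generalize hZ : 64 + n + a + b.size + Tden n (64 * a) (64 * b) + _ + _ + _ + _ + _ + _ = Z
      at h1 h2 h3
    have hT' : T n a b = Z ^ 360 := by
      rw [← hZ, ← hT]
      simp only [invTime, eval_timePoly, eval_accPoly, eval_confPoly]
      congr 1
    rw [hT']
    have hs : ∀ {G : Val} {D : PMF (Cube n)}, SamplesAlways (Z ^ 360) G D →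
        IsSampler (Z ^ 360) G D := fun h => by
      rw [IsSampler, (h noOracle).exec le_rfl, PMF.map_comp]
      rfl
    refine ⟨μ, CallRuns.exec h1 le_rfl, fun G hG => ?_, le_trans (prob_mono _ ?_) h3⟩
    · obtain ⟨D, hD⟩ := h2 G hG
      exact ⟨D, hs hD⟩
    · rintro G hG ⟨D, hD, hl⟩
      refine hG ⟨D, hs hD, ?_⟩
      -- The total variation distance is half the `ℓ¹` distance, so a factor of two is to spare.
      have e : dTV D (unifSat f hf) = 1 / 2 * l1 D (unifSat f hf) := rfl
      rw [e]
      linarith [l1_nonneg D (unifSat f hf)]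
  refine ⟨invGen Aden Agen Acount Asq C'.ev Agam Atau At₁, ?_, ?_⟩
  · intro n a b ha hb f hfC hf w hw
    obtain ⟨μ, h1, h2, -⟩ := key n a b ha hb f hfC hf
    rw [h1, PMF.support_map] at hw
    obtain ⟨G, hG, rfl⟩ := hw
    obtain ⟨D, hD⟩ := h2 G hG
    exact ⟨G, D, rfl, hD⟩
  · intro n a b ha hb f hfC hf
    obtain ⟨μ, h1, -, h3⟩ := key n a b ha hb f hfC hf
    rw [h1, prob_map]
    have h5 := (prob_compl μ _).symm.le.trans h3
    refine (sub_le_comm.1 h5).trans (prob_mono μ ?_)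
    rintro G ⟨D, hD⟩
    exact ⟨G, D, rfl, hD⟩
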